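/- Finite types are generated from the ground types $0$ (natural numbers), $\Omega$ (sample space) and $S$ (events) by forming $\tau(\rho)$ (functions from $\rho$ to $\tau$); the pure types are $0$ and $n+1:=0(n)$. A type is small if it is $\rho_0(0)\ldots(0)$, and admissible if it is $\rho_0(\sigma_k)\ldots(\sigma_1)$ with all $\sigma_i$ small, where $\rho_0\in\{0,\Omega,S\}$. A $\forall$-formula ($\exists$-formula) is a quantifier-free formula preceded by a block of universal (existential) quantifiers of admissible types. Let $\mathcal{F}^\omega[\mathbb{P}]$ be the classical system consisting of weakly extensional Peano arithmetic in all these types (equality of type $0$, induction, combinators, simultaneous primitive recursion, and the quantifier-free rule of extensionality), the schemata of quantifier-free choice and of dependent choice, and constants and axioms stating that $S$ is an algebra of events over the non-empty sample space $\Omega$ and that $\mathbb{P}$, of type $1(S)$, is a probability content on it. Real numbers are represented by objects of type $1$ coding Cauchy sequences of rationals with modulus $2^{-n}$. For a pure type $\rho$, $\mathrm{UB}^{\Omega}_{\rho}$ is the schema $$\forall y^{\alpha(0)}\bigl(\forall k^0,x^\alpha,\underline z^{\underline\beta}\,\exists w^\rho\,\psi(y,k,\min\nolimits_\alpha(x,yk),\underline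 z,w)\to\exists\chi^{\rho(0)}\forall k^0,x^\alpha,\underline z^{\underline\beta}\,\exists w\le_\rho\chi k\;\psi(y,k,\min\nolimits_\alpha(x,yk),\underline z,w)\bigr),$$ where $\alpha=0(\sigma_k)\ldots(\sigma_1)$, each type in $\underline\beta$ has the form $\Omega(\tau_m)\ldots(\tau_1)$, and $\psi$ is an $\exists$-formula, possibly with further parameters; inequality and minimum are pointwise. $\mathrm{UB}^{S}_{\rho}$ is the same schema with $S$ in place of $\Omega$ in the condition on $\underline\beta$. For a formula $\varphi(\varpi^\Omega)$ with De Morgan dual $\overline\varphi$ and a term $\lambda$ of type $1$, put $$\mathbb{P}[\varphi]\ge\lambda:\equiv\forall A^S\bigl(\mathbb{P}(A)<\lambda\to\exists\varpi\in A^c\,\varphi(\varpi)\bigr),\qquad \mathbb{P}[\varphi]>\lambda:\equiv\forall A^S\bigl(\mathbb{P}(A)\le\lambda\to\exists\varpi\in A^c\,\varphi(\varpi)\bigr),$$ $$\mathbb{P}[\varphi]\le\lambda:\equiv\mathbb{P}[\overline\varphi]\ge1-\lambda,\qquad \mathbb{P}[\varphi]<\lambda:\equiv\mathbb{P}[\overline\varphi]>1-\lambda.$$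 **Proposition.** Let $\tau$ be a pure type, let $\varphi(x^\tau,\varpi^\Omega)$ be a formula, possibly with further free variables, and let $\lambda$ be a variable or, more generally, any term of type $1$ in which $x$ and $\varpi$ do not occur. 1. Let $\varphi$ be a $\forall$-formula and let $\mathrm{AM}$ be the formula $\forall\varpi^\Omega\,\forall x^\tau,y^\tau\,(y\ge_\tau x\wedge\varphi(y,\varpi)\to\varphi(x,\varpi))$ (anti-monotonicity in $x$). Then - $\mathcal{F}^\omega[\mathbb{P}]+\mathrm{UB}^{\Omega}_{\tau}$ proves $\mathrm{AM}\to\bigl(\mathbb{P}[\forall x^\tau\varphi(x)]\ge\lambda\leftrightarrow\forall x^\tau(\mathbb{P}[\varphi(x)]\ge\lambda)\bigr)$; - $\mathcal{F}^\omega[\mathbb{P}]+\mathrm{UB}^{S}_{\tau}$ proves $\mathrm{AM}\to\bigl(\forall\mu^{\mathbb{Q}}>0\,\exists x^\tau(\mathbb{P}[\varphi(x)]<\lambda+\mu)\leftrightarrow\mathbb{P}[\forall x^\tau\varphi(x)]\le\lambda\bigr)$. 2. Let $\varphi$ be an $\exists$-formula and let $\mathrm{M}$ be the formula $\forall\varpi^\Omega\,\forall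 x^\tau,y^\tau\,(y\ge_\tau x\wedge\varphi(x,\varpi)\to\varphi(y,\varpi))$ (monotonicity in $x$). Then - $\mathcal{F}^\omega[\mathbb{P}]+\mathrm{UB}^{\Omega}_{\tau}$ proves $\mathrm{M}\to\bigl(\mathbb{P}[\exists x^\tau\varphi(x)]\le\lambda\leftrightarrow\forall x^\tau(\mathbb{P}[\varphi(x)]\le\lambda)\bigr)$; - $\mathcal{F}^\omega[\mathbb{P}]+\mathrm{UB}^{S}_{\tau}$ proves $\mathrm{M}\to\bigl(\forall\mu^{\mathbb{Q}}>0\,\exists x^\tau(\mathbb{P}[\varphi(x)]>\lambda-\mu)\leftrightarrow\mathbb{P}[\exists x^\tau\varphi(x)]\ge\lambda\bigr)$. -/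

import Mathlib

namespace FinType

/-! ### Finite types over the natural numbers, the sample space and the event space -/

/-- The finite types over the three ground types `0` (here `nat`), `Ω` (here `Om`) and
`S` (here `Ev`). The type of functions from `ρ` to `τ`, usually written `τ(ρ)`, is `fn ρ τ`. -/
inductive Ty : Type
  | nat : Ty
  | Om : Ty
  | Ev : Ty
  | fn (ρ τ : Ty) : Ty

/-- `arr [σ₁, …, σₖ] τ` is the type `τ(σₖ)…(σ₁)` of `k`-ary functionals. -/
@[reducible] def arr : List Ty → Ty → Ty
  | [], τ => τ
  | σ :: σs, τ => Ty.fn σ (arr σs τ)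

/-- The type `1 = 0(0)` of number-theoretic functions, which also represents the reals. -/
abbrev one : Ty := Ty.fn Ty.nat Ty.nat

/-- The pure types `0` and `n + 1 := 0(n)`. -/
inductive IsPure : Ty → Prop
  | nat : IsPure Ty.nat
  | succ {τ : Ty} : IsPure τ → IsPure (Ty.fn τ Ty.nat)

/-- The ground types. -/
inductive IsGround : Ty → Prop
  | nat : IsGround Ty.nat
  | om : IsGround Ty.Om
  | ev : IsGround Ty.Ev

/-- Small types: `ρ₀(0)…(0)` with `ρ₀` a ground type. -/
inductive IsSmall : Ty → Prop
  | ground {τ : Ty} : IsGround τ → IsSmall τ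
  | fn {τ : Ty} : IsSmall τ → IsSmall (Ty.fn Ty.nat τ)

/-- Admissible types: `ρ₀(σₖ)…(σ₁)` with `ρ₀` a ground type and all `σᵢ` small. -/
inductive IsAdmissible : Ty → Prop
  | ground {τ : Ty} : IsGround τ → IsAdmissible τ
  | fn {σ τ : Ty} : IsSmall σ → IsAdmissible τ → IsAdmissible (Ty.fn σ τ)

/-! ### Variables, terms and substitution

Terms and formulas are typed and use de Bruijn indices. A context lists the types of the free
variables; its head is the variable that was bound last. -/

/-- The variables of type `σ` in a context. -/
inductive Var : List Ty → Ty → Type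
  | z {Γ : List Ty} {σ : Ty} : Var (σ :: Γ) σ
  | s {Γ : List Ty} {σ τ : Ty} : Var Γ σ → Var (τ :: Γ) σ

namespace Var

def map (f : Ty → Ty) : {Ξ : List Ty} → {σ : Ty} → Var Ξ σ → Var (Ξ.map f) (f σ)
  | _, _, z => z
  | _, _, s v => s (map f v)

def inl {Γ : List Ty} : {Ξ : List Ty} → {σ : Ty} → Var Ξ σ → Var (Ξ ++ Γ) σ
  | _, _, z => z
  | _, _, s v => s (inl v)

def inr {Γ : List Ty} : (Ξ : List Ty) → {σ : Ty} → Var Γ σ → Var (Ξ ++ Γ) σ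
  | [], _, v => v
  | _ :: Ξ, _, v => s (inr Ξ v)

end Var

/-- The type of the `j`-th step function of a simultaneous recursion in the types `ρs`, where
`ρ` is the `j`-th type: it takes the tuple of previous values and then the counter. -/
abbrev stepTy (ρs : List Ty) (ρ : Ty) : Ty := arr ρs (Ty.fn Ty.nat ρ)

/-- The constants. -/
inductive Con : Ty → Type
  | zero : Con Ty.nat
  | succ : Con one
  /-- the projector `Π` -/
  | proj (ρ τ : Ty) : Con (Ty.fn ρ (Ty.fn τ ρ))
  /-- the combinator `Σ` -/
  | comb (δ ρ τ : Ty) :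
      Con (Ty.fn (Ty.fn δ (Ty.fn ρ τ)) (Ty.fn (Ty.fn δ ρ) (Ty.fn δ τ)))
  /-- the `i`-th recursor of the simultaneous primitive recursion in the types `ρs` -/
  | recursor (ρs : List Ty) {ρ : Ty} (i : Var ρs ρ) :
      Con (Ty.fn Ty.nat (arr ρs (arr (ρs.map (stepTy ρs)) ρ)))
  | eqOm : Con (Ty.fn Ty.Om (Ty.fn Ty.Om Ty.nat))
  | mem : Con (Ty.fn Ty.Om (Ty.fn Ty.Ev Ty.nat))
  | union : Con (Ty.fn Ty.Ev (Ty.fn Ty.Ev Ty.Ev))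
  | compl : Con (Ty.fn Ty.Ev Ty.Ev)
  | empty : Con Ty.Ev
  | prob : Con (Ty.fn Ty.Ev one)
  /-- a constant witnessing that the sample space is not empty -/
  | pt : Con Ty.Om

/-- Terms of a given type in a given context. -/
inductive Tm : List Ty → Ty → Type
  | var {Γ : List Ty} {σ : Ty} : Var Γ σ → Tm Γ σ
  | con {Γ : List Ty} {σ : Ty} : Con σ → Tm Γ σ
  | app {Γ : List Ty} {σ τ : Ty} : Tm Γ (Ty.fn σ τ) → Tm Γ σ → Tm Γ τ

/-- Renamings of variables. -/
abbrev Ren (Γ Δ : List Ty) : Type := ∀ σ : Ty, Var Γ σ → Var Δ σ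

/-- Substitutions; also used for tuples of terms (of types `Γ`, in the context `Δ`). -/
abbrev Sub (Γ Δ : List Ty) : Type := ∀ σ : Ty, Var Γ σ → Tm Δ σ

def Ren.lift {Γ Δ : List Ty} (r : Ren Γ Δ) (τ : Ty) : Ren (τ :: Γ) (τ :: Δ)
  | _, Var.z => Var.z
  | _, Var.s v => Var.s (r _ v)

def Tm.ren {Γ Δ : List Ty} (r : Ren Γ Δ) : {σ : Ty} → Tm Γ σ → Tm Δ σ
  | _, Tm.var v => Tm.var (r _ v)
  | _, Tm.con c => Tm.con c
  | _, Tm.app t u => Tm.app (t.ren r) (u.ren r)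

/-- Weakening of a term by one new variable. -/
def Tm.wk {Γ : List Ty} {τ σ : Ty} (t : Tm Γ σ) : Tm (τ :: Γ) σ := t.ren fun _ v => Var.s v

/-- Weakening of a term by a block of new variables. -/
def Tm.wks {Γ : List Ty} (Ξ : List Ty) {σ : Ty} (t : Tm Γ σ) : Tm (Ξ ++ Γ) σ :=
  t.ren fun _ v => Var.inr Ξ v

namespace Sub

def id {Γ : List Ty} : Sub Γ Γ := fun _ v => Tm.var v

def cons {Γ Δ : List Ty} {τ : Ty} (t : Tm Δ τ) (s : Sub Γ Δ) : Sub (τ :: Γ) Δ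
  | _, Var.z => t
  | _, Var.s v => s _ v

def lift {Γ Δ : List Ty} (s : Sub Γ Δ) (τ : Ty) : Sub (τ :: Γ) (τ :: Δ)
  | _, Var.z => Tm.var Var.z
  | _, Var.s v => (s _ v).wk

def lifts {Γ Δ : List Ty} (s : Sub Γ Δ) : (Ξ : List Ty) → Sub (Ξ ++ Γ) (Ξ ++ Δ)
  | [] => s
  | τ :: Ξ => (lifts s Ξ).lift τ

def append {Γ Δ : List Ty} : {Ξ : List Ty} → Sub Ξ Δ → Sub Γ Δ → Sub (Ξ ++ Γ) Δ
  | [], _, s => s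
  | _ :: _, r, s => cons (r _ Var.z) (append (fun _ v => r _ (Var.s v)) s)

end Sub

def Tm.subst {Γ Δ : List Ty} (s : Sub Γ Δ) : {σ : Ty} → Tm Γ σ → Tm Δ σ
  | _, Tm.var v => s _ v
  | _, Tm.con c => Tm.con c
  | _, Tm.app t u => Tm.app (t.subst s) (u.subst s)

/-- Application of a term to a tuple of terms. -/
def appN {Δ : List Ty} : (ρs : List Ty) → {τ : Ty} → Tm Δ (arr ρs τ) → Sub ρs Δ → Tm Δ τ
  | [], _, t, _ => t
  | _ :: ρs, _, t, a => appN ρs (Tm.app t (a _ Var.z)) fun _ v => a _ (Var.s v)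

/-- The variable bound last, as a term. -/
abbrev v0 {Γ : List Ty} {σ : Ty} : Tm (σ :: Γ) σ := Tm.var Var.z

/-- The variable bound next to last, as a term. -/
abbrev v1 {Γ : List Ty} {σ τ : Ty} : Tm (τ :: σ :: Γ) σ := Tm.var (Var.s Var.z)

/-- The third variable of a context, as a term. -/
abbrev v2 {Γ : List Ty} {σ τ ρ : Ty} : Tm (ρ :: τ :: σ :: Γ) σ := Tm.var (Var.s (Var.s Var.z))

/-- Lambda abstraction, defined from the combinators. -/
def Tm.lam {Γ : List Ty} {σ : Ty} : {τ : Ty} → Tm (σ :: Γ) τ → Tm Γ (Ty.fn σ τ)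
  | _, Tm.var Var.z =>
      Tm.app (Tm.app (Tm.con (Con.comb σ (Ty.fn σ σ) σ)) (Tm.con (Con.proj σ (Ty.fn σ σ))))
        (Tm.con (Con.proj σ σ))
  | _, Tm.var (Var.s v) => Tm.app (Tm.con (Con.proj _ σ)) (Tm.var v)
  | _, Tm.con c => Tm.app (Tm.con (Con.proj _ σ)) (Tm.con c)
  | _, Tm.app t u => Tm.app (Tm.app (Tm.con (Con.comb σ _ _)) t.lam) u.lam

/-! ### Formulas -/

/-- Formulas in a given context; the only prime formulas are equations of type `0`. -/
inductive Fm : List Ty → Type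
  | eq {Γ : List Ty} : Tm Γ Ty.nat → Tm Γ Ty.nat → Fm Γ
  | and {Γ : List Ty} : Fm Γ → Fm Γ → Fm Γ
  | or {Γ : List Ty} : Fm Γ → Fm Γ → Fm Γ
  | imp {Γ : List Ty} : Fm Γ → Fm Γ → Fm Γ
  | all {Γ : List Ty} (σ : Ty) : Fm (σ :: Γ) → Fm Γ
  | ex {Γ : List Ty} (σ : Ty) : Fm (σ :: Γ) → Fm Γ

abbrev zro {Γ : List Ty} : Tm Γ Ty.nat := Tm.con Con.zero

abbrev suc {Γ : List Ty} (t : Tm Γ Ty.nat) : Tm Γ Ty.nat := Tm.app (Tm.con Con.succ) t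

namespace Fm

def subst : {Γ Δ : List Ty} → Sub Γ Δ → Fm Γ → Fm Δ
  | _, _, s, eq t u => eq (t.subst s) (u.subst s)
  | _, _, s, and φ ψ => and (φ.subst s) (ψ.subst s)
  | _, _, s, or φ ψ => or (φ.subst s) (ψ.subst s)
  | _, _, s, imp φ ψ => imp (φ.subst s) (ψ.subst s)
  | _, _, s, all σ φ => all σ (φ.subst (s.lift σ))
  | _, _, s, ex σ φ => ex σ (φ.subst (s.lift σ))

/-- Weakening of a formula by one new variable. -/
def wk {Γ : List Ty} {τ : Ty} (φ : Fm Γ) : Fm (τ :: Γ) := φ.subst fun _ v => Tm.var (Var.s v)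

/-- Weakening of a formula by one new variable, inserted below the variable bound last. -/
def wkBelow {Γ : List Ty} {σ τ : Ty} (φ : Fm (σ :: Γ)) : Fm (σ :: τ :: Γ) :=
  φ.subst (Sub.lift (fun _ v => Tm.var (Var.s v)) σ)

/-- Weakening of a formula by one new variable, inserted below the two variables bound last. -/
def wkBelow2 {Γ : List Ty} {ρ σ τ : Ty} (φ : Fm (ρ :: σ :: Γ)) : Fm (ρ :: σ :: τ :: Γ) :=
  φ.subst (Sub.lift (Sub.lift (fun _ v => Tm.var (Var.s v)) σ) ρ)

/-- Instantiation of the variable bound last. -/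
def inst {Γ : List Ty} {τ : Ty} (φ : Fm (τ :: Γ)) (t : Tm Γ τ) : Fm Γ :=
  φ.subst (Sub.cons t Sub.id)

/-- Exchange of the two variables bound last. -/
def swap {Γ : List Ty} {σ τ : Ty} (φ : Fm (σ :: τ :: Γ)) : Fm (τ :: σ :: Γ) :=
  φ.subst (Sub.cons v1 (Sub.cons v0 fun _ v => Tm.var (Var.s (Var.s v))))

/-- Falsity is the equation `0 = 1`. -/
def bot {Γ : List Ty} : Fm Γ := eq zro (suc zro)

def neg {Γ : List Ty} (φ : Fm Γ) : Fm Γ := imp φ bot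

def iff {Γ : List Ty} (φ ψ : Fm Γ) : Fm Γ := and (imp φ ψ) (imp ψ φ)

/-- Universal quantification over a block of variables. -/
def alls {Γ : List Ty} : (Ξ : List Ty) → Fm (Ξ ++ Γ) → Fm Γ
  | [], φ => φ
  | σ :: Ξ, φ => alls Ξ (all σ φ)

/-- Existential quantification over a block of variables. -/
def exs {Γ : List Ty} : (Ξ : List Ty) → Fm (Ξ ++ Γ) → Fm Γ
  | [], φ => φ
  | σ :: Ξ, φ => exs Ξ (ex σ φ)

/-- The De Morgan dual. -/
def dual : {Γ : List Ty} → Fm Γ → Fm Γ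
  | _, eq t u => neg (eq t u)
  | _, and φ ψ => or φ.dual ψ.dual
  | _, or φ ψ => and φ.dual ψ.dual
  | _, imp φ ψ => and φ ψ.dual
  | _, all σ φ => ex σ φ.dual
  | _, ex σ φ => all σ φ.dual

/-- Quantifier-free formulas. -/
def QF : {Γ : List Ty} → Fm Γ → Prop
  | _, eq _ _ => True
  | _, and φ ψ => φ.QF ∧ ψ.QF
  | _, or φ ψ => φ.QF ∧ ψ.QF
  | _, imp φ ψ => φ.QF ∧ ψ.QF
  | _, all _ _ => False
  | _, ex _ _ => False

end Fm

/-- `∀`-formulas: a block of universal quantifiers of admissible types in front of a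
quantifier-free formula. -/
inductive IsForall : {Γ : List Ty} → Fm Γ → Prop
  | qf {Γ : List Ty} {φ : Fm Γ} : φ.QF → IsForall φ
  | all {Γ : List Ty} {σ : Ty} {φ : Fm (σ :: Γ)} :
      IsAdmissible σ → IsForall φ → IsForall (Fm.all σ φ)

/-- `∃`-formulas: a block of existential quantifiers of admissible types in front of a
quantifier-free formula. -/
inductive IsExists : {Γ : List Ty} → Fm Γ → Prop
  | qf {Γ : List Ty} {φ : Fm Γ} : φ.QF → IsExists φ
  | ex {Γ : List Ty} {σ : Ty} {φ : Fm (σ :: Γ)} :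
      IsAdmissible σ → IsExists φ → IsExists (Fm.ex σ φ)

/-! ### The events -/

section Events

variable {Γ : List Ty}

def memT (x : Tm Γ Ty.Om) (A : Tm Γ Ty.Ev) : Tm Γ Ty.nat :=
  Tm.app (Tm.app (Tm.con Con.mem) x) A

/-- The formula `x ∈ A`. -/
def memF (x : Tm Γ Ty.Om) (A : Tm Γ Ty.Ev) : Fm Γ := Fm.eq (memT x A) zro

def cupT (A B : Tm Γ Ty.Ev) : Tm Γ Ty.Ev := Tm.app (Tm.app (Tm.con Con.union) A) B

def compT (A : Tm Γ Ty.Ev) : Tm Γ Ty.Ev := Tm.app (Tm.con Con.compl) A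

def emptyT : Tm Γ Ty.Ev := Tm.con Con.empty

/-- The sure event, the complement of the empty event. -/
def sureT : Tm Γ Ty.Ev := compT emptyT

def capT (A B : Tm Γ Ty.Ev) : Tm Γ Ty.Ev := compT (cupT (compT A) (compT B))

/-- The probability of an event, a term of type `1` that represents a real number. -/
def probT (A : Tm Γ Ty.Ev) : Tm Γ one := Tm.app (Tm.con Con.prob) A

def subsetF (A B : Tm Γ Ty.Ev) : Fm Γ :=
  Fm.all Ty.Om (Fm.imp (memF v0 A.wk) (memF v0 B.wk))

end Events

/-- Equality in all types: primitive in type `0`, given by the constant `eq` on `Ω`, defined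
by having the same elements on `S`, and pointwise in function types. -/
def eqF : {Γ : List Ty} → (σ : Ty) → Tm Γ σ → Tm Γ σ → Fm Γ
  | _, Ty.nat, s, t => Fm.eq s t
  | _, Ty.Om, s, t => Fm.eq (Tm.app (Tm.app (Tm.con Con.eqOm) s) t) zro
  | _, Ty.Ev, s, t => Fm.all Ty.Om (Fm.iff (memF v0 s.wk) (memF v0 t.wk))
  | _, Ty.fn ρ τ, s, t => Fm.all ρ (eqF τ (Tm.app s.wk v0) (Tm.app t.wk v0))

/-! ### Arithmetic -/

section Arithmetic

variable {Γ : List Ty}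

/-- The tuple of two terms. -/
def pairSub {σ τ : Ty} (a : Tm Γ σ) (b : Tm Γ τ) : Sub [σ, τ] Γ
  | _, Var.z => a
  | _, Var.s Var.z => b

/-- Primitive recursion on numbers: the value at `0` is `a`, and the value at `x + 1` is `b`,
where in `b` the variable `v0` is `x` and `v1` is the value at `x`. -/
def natRec (a : Tm Γ Ty.nat) (b : Tm (Ty.nat :: Ty.nat :: Γ) Ty.nat) (n : Tm Γ Ty.nat) :
    Tm Γ Ty.nat :=
  Tm.app (Tm.app (Tm.app (Tm.con (Con.recursor [Ty.nat] Var.z)) n) a) b.lam.lam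

def predT (n : Tm Γ Ty.nat) : Tm Γ Ty.nat := natRec zro v0 n

def addT (m n : Tm Γ Ty.nat) : Tm Γ Ty.nat := natRec m (suc v1) n

/-- Cut-off subtraction. -/
def subT (m n : Tm Γ Ty.nat) : Tm Γ Ty.nat := natRec m (predT v1) n

def mulT (m n : Tm Γ Ty.nat) : Tm Γ Ty.nat := natRec zro (addT v1 m.wk.wk) n

/-- `2 ^ n`. -/
def powT (n : Tm Γ Ty.nat) : Tm Γ Ty.nat := natRec (suc zro) (addT v1 v1) n

/-- `a` if `c = 0`, and `b` otherwise. -/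
def condT (c a b : Tm Γ Ty.nat) : Tm Γ Ty.nat := natRec a b.wk.wk c

/-- The triangular number `0 + 1 + ⋯ + n`. -/
def triT (n : Tm Γ Ty.nat) : Tm Γ Ty.nat := natRec zro (addT v1 (suc v0)) n

/-- The Cantor pairing function. -/
def pairT (a b : Tm Γ Ty.nat) : Tm Γ Ty.nat := addT (triT (addT a b)) b

/-- The two projections of the Cantor pairing function (`i` selects the component). The pairs
are enumerated in the order of their codes by a simultaneous recursion: `(0, b)` is followed by
`(b + 1, 0)`, and `(a + 1, b)` is followed by `(a, b + 1)`. In the step functions, `v2` and `v1`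
are the components of the previous pair. -/
def unpairT (i : Var [Ty.nat, Ty.nat] Ty.nat) (n : Tm Γ Ty.nat) : Tm Γ Ty.nat :=
  Tm.app (Tm.app
    (Tm.app (Tm.app (Tm.app (Tm.con (Con.recursor [Ty.nat, Ty.nat] i)) n) zro) zro)
    (Tm.lam (Tm.lam (Tm.lam (condT v2 (suc v1) (predT v2))))))
    (Tm.lam (Tm.lam (Tm.lam (condT v2 zro (suc v1)))))

def fstT (n : Tm Γ Ty.nat) : Tm Γ Ty.nat := unpairT Var.z n

def sndT (n : Tm Γ Ty.nat) : Tm Γ Ty.nat := unpairT (Var.s Var.z) n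

/-! ### Rational numbers

The number `⟨⟨a, b⟩, c⟩` codes the rational number `(a - b) / (c + 1)`. -/

def ratT (a b c : Tm Γ Ty.nat) : Tm Γ Ty.nat := pairT (pairT a b) c

def posT (q : Tm Γ Ty.nat) : Tm Γ Ty.nat := fstT (fstT q)

def negT (q : Tm Γ Ty.nat) : Tm Γ Ty.nat := sndT (fstT q)

/-- The denominator. -/
def denT (q : Tm Γ Ty.nat) : Tm Γ Ty.nat := suc (sndT q)

/-- For `q = (a - b) / d` and `r = (a' - b') / d'` this is `a d' + b' d`, so that `q < r` means
`crossT q r < crossT r q`. -/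
def crossT (q r : Tm Γ Ty.nat) : Tm Γ Ty.nat :=
  addT (mulT (posT q) (denT r)) (mulT (negT r) (denT q))

/-- A term that is `0` exactly if `q < r`. -/
def qltT (q r : Tm Γ Ty.nat) : Tm Γ Ty.nat := subT (suc (crossT q r)) (crossT r q)

def qltF (q r : Tm Γ Ty.nat) : Fm Γ := Fm.eq (qltT q r) zro

def qleF (q r : Tm Γ Ty.nat) : Fm Γ := Fm.eq (subT (crossT q r) (crossT r q)) zro

def qzero : Tm Γ Ty.nat := ratT zro zro zro

def qone : Tm Γ Ty.nat := ratT (suc zro) zro zro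

/-- The rational number `2 ^ (-n)`. -/
def qhalf (n : Tm Γ Ty.nat) : Tm Γ Ty.nat := ratT (suc zro) zro (predT (powT n))

def qadd (q r : Tm Γ Ty.nat) : Tm Γ Ty.nat :=
  ratT (addT (mulT (posT q) (denT r)) (mulT (posT r) (denT q)))
    (addT (mulT (negT q) (denT r)) (mulT (negT r) (denT q)))
    (predT (mulT (denT q) (denT r)))

def qneg (q : Tm Γ Ty.nat) : Tm Γ Ty.nat := ratT (negT q) (posT q) (sndT q)

def qsub (q r : Tm Γ Ty.nat) : Tm Γ Ty.nat := qadd q (qneg r)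

def qabs (q : Tm Γ Ty.nat) : Tm Γ Ty.nat :=
  ratT (addT (subT (posT q) (negT q)) (subT (negT q) (posT q))) zro (sndT q)

/-! ### Real numbers

A real number is given by any `f` of type `1`, through the sequence `hat f` of (codes of)
rationals. The latter satisfies `|hat f n - hat f (n + 1)| < 2 ^ (-n - 1)` for all `n`, and it is
`f` itself if `f` has this property; otherwise it is `f` up to the first `n` where the property
fails, and constant from there on. -/

/-- `0` exactly if `|f k - f (k + 1)| < 2 ^ (-k - 1)` for all `k < n`. -/
def badT (f : Tm Γ one) (n : Tm Γ Ty.nat) : Tm Γ Ty.nat :=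
  natRec zro
    (addT v1
      (qltT (qabs (qsub (Tm.app f.wk.wk v0) (Tm.app f.wk.wk (suc v0)))) (qhalf (suc v0)))) n

/-- The value of `hat f` at `n`. -/
def hatT (f : Tm Γ one) (n : Tm Γ Ty.nat) : Tm Γ Ty.nat :=
  natRec (Tm.app f zro)
    (condT (badT f.wk.wk (suc v0)) (Tm.app f.wk.wk (suc v0)) v1) n

def rltF (s t : Tm Γ one) : Fm Γ :=
  Fm.ex Ty.nat (qleF (qhalf v0) (qsub (hatT t.wk (suc v0)) (hatT s.wk (suc v0))))

def rleF (s t : Tm Γ one) : Fm Γ :=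
  Fm.all Ty.nat (qltF (qsub (hatT s.wk (suc v0)) (hatT t.wk (suc v0))) (qhalf v0))

def reqF (s t : Tm Γ one) : Fm Γ :=
  Fm.all Ty.nat (qltF (qabs (qsub (hatT s.wk (suc v0)) (hatT t.wk (suc v0)))) (qhalf v0))

/-- The real number given by a rational number. -/
def rrat (q : Tm Γ Ty.nat) : Tm Γ one := Tm.lam q.wk

def radd (s t : Tm Γ one) : Tm Γ one :=
  Tm.lam (qadd (hatT s.wk (suc v0)) (hatT t.wk (suc v0)))

def rsub (s t : Tm Γ one) : Tm Γ one :=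
  Tm.lam (qsub (hatT s.wk (suc v0)) (hatT t.wk (suc v0)))

def rzero : Tm Γ one := rrat qzero

def rone : Tm Γ one := rrat qone

end Arithmetic

/-- The inequality `s ≤ t` in all types: `s ∸ t = 0` in type `0`, trivial on `Ω`, comparison of
probabilities on `S`, and pointwise in function types. -/
def leF : {Γ : List Ty} → (σ : Ty) → Tm Γ σ → Tm Γ σ → Fm Γ
  | _, Ty.nat, s, t => Fm.eq (subT s t) zro
  | _, Ty.Om, _, _ => rleF (probT sureT) (probT sureT)
  | _, Ty.Ev, s, t => rleF (probT s) (probT t)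
  | _, Ty.fn ρ τ, s, t => Fm.all ρ (leF τ (Tm.app s.wk v0) (Tm.app t.wk v0))

/-- The pointwise minimum in the type `0(σₖ)…(σ₁)`. -/
def minT : {Γ : List Ty} → (σs : List Ty) →
    Tm Γ (arr σs Ty.nat) → Tm Γ (arr σs Ty.nat) → Tm Γ (arr σs Ty.nat)
  | _, [], s, t => subT s (subT s t)
  | _, _ :: σs, s, t => Tm.lam (minT σs (Tm.app s.wk v0) (Tm.app t.wk v0))

/-! ### Derivability -/

/-- A theory is given by its axioms, which may contain free variables. -/
abbrev Theory : Type := ∀ Γ : List Ty, Fm Γ → Prop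

/-- The theory with the axioms of two theories. -/
def Theory.plus (T U : Theory) : Theory := fun Γ φ => T Γ φ ∨ U Γ φ

/-- Derivability of a formula from finitely many assumptions in a theory: classical many-sorted
natural deduction, with the quantifier-free rule of extensionality, which applies only to
premises that are derivable without assumptions. -/
inductive Derives (T : Theory) : {Γ : List Ty} → List (Fm Γ) → Fm Γ → Prop
  | ax {Γ : List Ty} {H : List (Fm Γ)} {φ : Fm Γ} : T Γ φ → Derives T H φ
  | hyp {Γ : List Ty} {H : List (Fm Γ)} {φ : Fm Γ} : φ ∈ H → Derives T H φ
  | andI {Γ : List Ty} {H : List (Fm Γ)} {φ ψ : Fm Γ} :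
      Derives T H φ → Derives T H ψ → Derives T H (Fm.and φ ψ)
  | andL {Γ : List Ty} {H : List (Fm Γ)} {φ ψ : Fm Γ} :
      Derives T H (Fm.and φ ψ) → Derives T H φ
  | andR {Γ : List Ty} {H : List (Fm Γ)} {φ ψ : Fm Γ} :
      Derives T H (Fm.and φ ψ) → Derives T H ψ
  | orL {Γ : List Ty} {H : List (Fm Γ)} {φ ψ : Fm Γ} :
      Derives T H φ → Derives T H (Fm.or φ ψ)
  | orR {Γ : List Ty} {H : List (Fm Γ)} {φ ψ : Fm Γ} :
      Derives T H ψ → Derives T H (Fm.or φ ψ)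
  | orE {Γ : List Ty} {H : List (Fm Γ)} {φ ψ χ : Fm Γ} :
      Derives T H (Fm.or φ ψ) → Derives T (φ :: H) χ → Derives T (ψ :: H) χ → Derives T H χ
  | impI {Γ : List Ty} {H : List (Fm Γ)} {φ ψ : Fm Γ} :
      Derives T (φ :: H) ψ → Derives T H (Fm.imp φ ψ)
  | impE {Γ : List Ty} {H : List (Fm Γ)} {φ ψ : Fm Γ} :
      Derives T H (Fm.imp φ ψ) → Derives T H φ → Derives T H ψ
  | raa {Γ : List Ty} {H : List (Fm Γ)} {φ : Fm Γ} :
      Derives T (Fm.neg φ :: H) Fm.bot → Derives T H φ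
  | allI {Γ : List Ty} {H : List (Fm Γ)} {σ : Ty} {φ : Fm (σ :: Γ)} :
      Derives T (H.map Fm.wk) φ → Derives T H (Fm.all σ φ)
  | allE {Γ : List Ty} {H : List (Fm Γ)} {σ : Ty} {φ : Fm (σ :: Γ)} (t : Tm Γ σ) :
      Derives T H (Fm.all σ φ) → Derives T H (φ.inst t)
  | exI {Γ : List Ty} {H : List (Fm Γ)} {σ : Ty} {φ : Fm (σ :: Γ)} (t : Tm Γ σ) :
      Derives T H (φ.inst t) → Derives T H (Fm.ex σ φ)
  | exE {Γ : List Ty} {H : List (Fm Γ)} {σ : Ty} {φ : Fm (σ :: Γ)} {ψ : Fm Γ} :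
      Derives T H (Fm.ex σ φ) → Derives T (φ :: H.map Fm.wk) ψ.wk → Derives T H ψ
  | qfer {Γ : List Ty} {H : List (Fm Γ)} {ρ τ : Ty} {φ : Fm Γ} {s t : Tm Γ ρ}
      (r : Tm (ρ :: Γ) τ) : φ.QF → Derives T [] (Fm.imp φ (eqF ρ s t)) →
      Derives T H (Fm.imp φ
        (eqF τ (r.subst (Sub.cons s Sub.id)) (r.subst (Sub.cons t Sub.id))))

/-- Provability of a formula in a theory. -/
def Proves (T : Theory) {Γ : List Ty} (φ : Fm Γ) : Prop := Derives T [] φ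

/-! ### The system -/

/-- The substitution that replaces the existential variables `ys` of a formula by the values of
the choice functions at the universal variables `xs`. -/
def choiceSub {Γ : List Ty} (xs ys : List Ty) :
    Sub (ys ++ (xs ++ Γ)) (xs ++ (ys.map (arr xs) ++ Γ)) :=
  Sub.append
    (fun _ v => appN xs (Tm.var (Var.inr xs (Var.inl (v.map (arr xs)))))
      fun _ w => Tm.var (Var.inl w))
    (Sub.append (fun _ v => Tm.var (Var.inl v))
      fun _ v => Tm.var (Var.inr xs (Var.inr (ys.map (arr xs)) v)))

/-- The quantifier-free axiom of choice
`∀x ∃y φ(x, y) → ∃Y ∀x φ(x, Y x)`, where `x`, `y`, `Y` are tuples. -/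
def qfChoice {Γ : List Ty} (xs ys : List Ty) (φ : Fm (ys ++ (xs ++ Γ))) : Fm Γ :=
  Fm.imp (Fm.alls xs (Fm.exs ys φ))
    (Fm.exs (ys.map (arr xs)) (Fm.alls xs (φ.subst (choiceSub xs ys))))

/-- The substitution `y ↦ f n`, `z ↦ f (n + 1)` for the axiom of dependent choice. -/
def depSub {Γ : List Ty} (ρs : List Ty) :
    Sub (ρs ++ (ρs ++ (Ty.nat :: Γ))) (Ty.nat :: (ρs.map (Ty.fn Ty.nat) ++ Γ)) :=
  Sub.append
    (fun _ v => Tm.app (Tm.var (Var.s (Var.inl (v.map (Ty.fn Ty.nat))))) (suc v0))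
    (Sub.append
      (fun _ v => Tm.app (Tm.var (Var.s (Var.inl (v.map (Ty.fn Ty.nat))))) v0)
      (Sub.cons v0 fun _ v => Tm.var (Var.s (Var.inr (ρs.map (Ty.fn Ty.nat)) v))))

/-- The axiom of dependent choice
`∀n ∀y ∃z φ(n, y, z) → ∃f ∀n φ(n, f n, f (n + 1))`, where `y`, `z`, `f` are tuples. -/
def depChoice {Γ : List Ty} (ρs : List Ty) (φ : Fm (ρs ++ (ρs ++ (Ty.nat :: Γ)))) : Fm Γ :=
  Fm.imp (Fm.all Ty.nat (Fm.alls ρs (Fm.exs ρs φ)))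
    (Fm.exs (ρs.map (Ty.fn Ty.nat)) (Fm.all Ty.nat (φ.subst (depSub ρs))))

/-- The `i`-th component of the simultaneous recursion with initial values `a` and step
functions `b`, at `n`. -/
def recT {Γ : List Ty} (ρs : List Ty) {ρ : Ty} (i : Var ρs ρ) (n : Tm Γ Ty.nat)
    (a : Sub ρs Γ) (b : Sub (ρs.map (stepTy ρs)) Γ) : Tm Γ ρ :=
  appN (ρs.map (stepTy ρs)) (appN ρs (Tm.app (Tm.con (Con.recursor ρs i)) n) a) b

/-- The axioms of weakly extensional Peano arithmetic in all finite types. -/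
inductive Arith : Theory
  | eqRefl {Γ : List Ty} (t : Tm Γ Ty.nat) : Arith Γ (Fm.eq t t)
  | eqSymm {Γ : List Ty} (s t : Tm Γ Ty.nat) : Arith Γ (Fm.imp (Fm.eq s t) (Fm.eq t s))
  | eqTrans {Γ : List Ty} (s t u : Tm Γ Ty.nat) :
      Arith Γ (Fm.imp (Fm.and (Fm.eq s t) (Fm.eq t u)) (Fm.eq s u))
  | succNe {Γ : List Ty} (t : Tm Γ Ty.nat) : Arith Γ (Fm.neg (Fm.eq (suc t) zro))
  | succInj {Γ : List Ty} (s t : Tm Γ Ty.nat) :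
      Arith Γ (Fm.imp (Fm.eq (suc s) (suc t)) (Fm.eq s t))
  | ind {Γ : List Ty} (φ : Fm (Ty.nat :: Γ)) :
      Arith Γ (Fm.imp
        (Fm.and (φ.inst zro)
          (Fm.all Ty.nat
            (Fm.imp φ (φ.subst (Sub.cons (suc v0) fun _ v => Tm.var (Var.s v))))))
        (Fm.all Ty.nat φ))
  | proj {Γ : List Ty} {ρ τ : Ty} (s : Tm Γ ρ) (t : Tm Γ τ) :
      Arith Γ (eqF ρ (Tm.app (Tm.app (Tm.con (Con.proj ρ τ)) s) t) s)
  | comb {Γ : List Ty} {δ ρ τ : Ty} (s : Tm Γ (Ty.fn δ (Ty.fn ρ τ))) (t : Tm Γ (Ty.fn δ ρ))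
      (u : Tm Γ δ) :
      Arith Γ (eqF τ (Tm.app (Tm.app (Tm.app (Tm.con (Con.comb δ ρ τ)) s) t) u)
        (Tm.app (Tm.app s u) (Tm.app t u)))
  | recZero {Γ : List Ty} (ρs : List Ty) {ρ : Ty} (i : Var ρs ρ)
      (a : Sub ρs Γ) (b : Sub (ρs.map (stepTy ρs)) Γ) :
      Arith Γ (eqF ρ (recT ρs i zro a b) (a ρ i))
  | recSucc {Γ : List Ty} (ρs : List Ty) {ρ : Ty} (i : Var ρs ρ) (n : Tm Γ Ty.nat)
      (a : Sub ρs Γ) (b : Sub (ρs.map (stepTy ρs)) Γ) :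
      Arith Γ (eqF ρ (recT ρs i (suc n) a b)
        (Tm.app (appN ρs (b (stepTy ρs ρ) (i.map (stepTy ρs))) fun _ j => recT ρs j n a b) n))

/-- The axiom schemata of quantifier-free choice and of dependent choice. -/
inductive Choice : Theory
  | qfac {Γ : List Ty} (xs ys : List Ty) (φ : Fm (ys ++ (xs ++ Γ))) :
      φ.QF → Choice Γ (qfChoice xs ys φ)
  | dc {Γ : List Ty} (ρs : List Ty) (φ : Fm (ρs ++ (ρs ++ (Ty.nat :: Γ)))) :
      Choice Γ (depChoice ρs φ)

/-- The axioms of probability contents: equality of points is an equivalence relation,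
membership respects the operations on events, and `P` is a probability content (with additivity
given by inclusion-exclusion and monotonicity). -/
inductive Content : Theory
  | omRefl {Γ : List Ty} (x : Tm Γ Ty.Om) : Content Γ (eqF Ty.Om x x)
  | omSymm {Γ : List Ty} (x y : Tm Γ Ty.Om) :
      Content Γ (Fm.imp (eqF Ty.Om x y) (eqF Ty.Om y x))
  | omTrans {Γ : List Ty} (x y u : Tm Γ Ty.Om) :
      Content Γ (Fm.imp (Fm.and (eqF Ty.Om x y) (eqF Ty.Om y u)) (eqF Ty.Om x u))
  | memEmpty {Γ : List Ty} (x : Tm Γ Ty.Om) : Content Γ (Fm.neg (memF x emptyT))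
  | memCompl {Γ : List Ty} (x : Tm Γ Ty.Om) (A : Tm Γ Ty.Ev) :
      Content Γ (Fm.iff (memF x (compT A)) (Fm.neg (memF x A)))
  | memUnion {Γ : List Ty} (x : Tm Γ Ty.Om) (A B : Tm Γ Ty.Ev) :
      Content Γ (Fm.iff (memF x (cupT A B)) (Fm.or (memF x A) (memF x B)))
  | probNonneg {Γ : List Ty} (A : Tm Γ Ty.Ev) : Content Γ (rleF rzero (probT A))
  | probLeOne {Γ : List Ty} (A : Tm Γ Ty.Ev) : Content Γ (rleF (probT A) rone)
  | probEmpty {Γ : List Ty} : Content Γ (reqF (probT emptyT) rzero)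
  | probSure {Γ : List Ty} : Content Γ (reqF (probT sureT) rone)
  | probUnion {Γ : List Ty} (A B : Tm Γ Ty.Ev) :
      Content Γ (reqF (probT (cupT A B))
        (rsub (radd (probT A) (probT B)) (probT (capT A B))))
  | probMono {Γ : List Ty} (A B : Tm Γ Ty.Ev) :
      Content Γ (Fm.imp (subsetF A B) (rleF (probT A) (probT B)))

/-- The classical system of finite type arithmetic for probability contents. -/
def FP : Theory := Theory.plus (Theory.plus Arith Choice) Content

/-! ### Uniform boundedness -/

/-- For `φ(y, k, x, z, w)`, where `x` has the type `α = 0(σₖ)…(σ₁)`, the formula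
`∀y (∀k ∀x ∀z ∃w φ(y, k, min(x, y k), z, w) →
  ∃χ ∀k ∀x ∀z ∃w (w ≤ χ k ∧ φ(y, k, min(x, y k), z, w)))`. -/
def unifBound {Γ : List Ty} (ρ : Ty) (σs βs : List Ty)
    (φ : Fm (ρ :: (βs ++ (arr σs Ty.nat :: Ty.nat :: Ty.fn Ty.nat (arr σs Ty.nat) :: Γ)))) :
    Fm Γ :=
  Fm.all (Ty.fn Ty.nat (arr σs Ty.nat)) (Fm.imp
    (Fm.all Ty.nat (Fm.all (arr σs Ty.nat) (Fm.alls βs (Fm.ex ρ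
      (φ.subst (((Sub.cons (minT σs v0 (Tm.app v2 v1)) (Sub.cons v1 (Sub.cons v2
        fun _ v => Tm.var (Var.s (Var.s (Var.s v)))))).lifts βs).lift ρ))))))
    (Fm.ex (Ty.fn Ty.nat ρ)
      (Fm.all Ty.nat (Fm.all (arr σs Ty.nat) (Fm.alls βs (Fm.ex ρ (Fm.and
        (leF ρ v0 (Tm.wk (Tm.wks βs (Tm.app v2 v1))))
        (φ.subst (((Sub.cons (minT σs v0 (Tm.app (Tm.var (Var.s (Var.s (Var.s Var.z)))) v1))
          (Sub.cons v1 (Sub.cons (Tm.var (Var.s (Var.s (Var.s Var.z))))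
            fun _ v => Tm.var (Var.s (Var.s (Var.s (Var.s v))))))).lifts βs).lift ρ)))))))))

/-- The principle of uniform boundedness in the type `ρ` for the ground type `B`: the instances
where `φ` is an `∃`-formula and each type in the tuple of the types of `z` is of the form
`B(τₘ)…(τ₁)`. -/
inductive UB (B ρ : Ty) : Theory
  | inst {Γ : List Ty} (σs : List Ty) (τs : List (List Ty))
      (φ : Fm (ρ :: (τs.map (fun l => arr l B) ++
        (arr σs Ty.nat :: Ty.nat :: Ty.fn Ty.nat (arr σs Ty.nat) :: Γ)))) :
      IsExists φ → UB B ρ Γ (unifBound ρ σs (τs.map fun l => arr l B) φ)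

/-- The system with uniform boundedness for the sample space in the type `ρ`. -/
def FPUBOm (ρ : Ty) : Theory := FP.plus (UB Ty.Om ρ)

/-- The system with uniform boundedness for the event space in the type `ρ`. -/
def FPUBEv (ρ : Ty) : Theory := FP.plus (UB Ty.Ev ρ)

/-! ### Probabilistic statements -/

section Probability

variable {Γ : List Ty}

/-- `P[φ] ≥ l`, that is, `∀A (P(A) < l → ∃ϖ (ϖ ∈ Aᶜ ∧ φ(ϖ)))`. -/
def probGe (φ : Fm (Ty.Om :: Γ)) (l : Tm Γ one) : Fm Γ :=
  Fm.all Ty.Ev (Fm.imp (rltF (probT v0) l.wk)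
    (Fm.ex Ty.Om (Fm.and (memF v0 (compT v1)) φ.wkBelow)))

/-- `P[φ] > l`, that is, `∀A (P(A) ≤ l → ∃ϖ (ϖ ∈ Aᶜ ∧ φ(ϖ)))`. -/
def probGt (φ : Fm (Ty.Om :: Γ)) (l : Tm Γ one) : Fm Γ :=
  Fm.all Ty.Ev (Fm.imp (rleF (probT v0) l.wk)
    (Fm.ex Ty.Om (Fm.and (memF v0 (compT v1)) φ.wkBelow)))

/-- `P[φ] ≤ l`, that is, `P[φ̄] ≥ 1 - l` for the De Morgan dual `φ̄` of `φ`. -/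
def probLe (φ : Fm (Ty.Om :: Γ)) (l : Tm Γ one) : Fm Γ := probGe φ.dual (rsub rone l)

/-- `P[φ] < l`, that is, `P[φ̄] > 1 - l` for the De Morgan dual `φ̄` of `φ`. -/
def probLt (φ : Fm (Ty.Om :: Γ)) (l : Tm Γ one) : Fm Γ := probGt φ.dual (rsub rone l)

variable {τ : Ty}

/-- The instance of `φ(x, ϖ)` at the given terms for `x` and `ϖ`, with the remaining free
variables replaced according to `s`. -/
def Fm.at {Δ : List Ty} (φ : Fm (Ty.Om :: τ :: Γ)) (ϖ : Tm Δ Ty.Om) (x : Tm Δ τ)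
    (s : Sub Γ Δ) : Fm Δ :=
  φ.subst (Sub.cons ϖ (Sub.cons x s))

/-- `φ(x, ϖ)` is anti-monotone in `x`: `∀ϖ ∀x ∀y (y ≥ x ∧ φ(y, ϖ) → φ(x, ϖ))`. -/
def antiMono (φ : Fm (Ty.Om :: τ :: Γ)) : Fm Γ :=
  Fm.all Ty.Om (Fm.all τ (Fm.all τ
    (Fm.imp (Fm.and (leF τ v1 v0) (φ.at v2 v0 fun _ v => Tm.var (Var.s (Var.s (Var.s v)))))
      (φ.at v2 v1 fun _ v => Tm.var (Var.s (Var.s (Var.s v)))))))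

/-- `φ(x, ϖ)` is monotone in `x`: `∀ϖ ∀x ∀y (y ≥ x ∧ φ(x, ϖ) → φ(y, ϖ))`. -/
def mono (φ : Fm (Ty.Om :: τ :: Γ)) : Fm Γ :=
  Fm.all Ty.Om (Fm.all τ (Fm.all τ
    (Fm.imp (Fm.and (leF τ v1 v0) (φ.at v2 v1 fun _ v => Tm.var (Var.s (Var.s (Var.s v)))))
      (φ.at v2 v0 fun _ v => Tm.var (Var.s (Var.s (Var.s v)))))))

/-- The quantifier `∀μ > 0` over the rational numbers, where `μ` is given by a code. -/
def allRatPos (φ : Fm (Ty.nat :: Γ)) : Fm Γ := Fm.all Ty.nat (Fm.imp (qltF qzero v0) φ)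

end Probability

end FinType

namespace FinType

/-! ### Substitution -/

/-! The heart of the matter is an exchange of quantifiers. Fix an event `A` and let `θ(x, ϖ)` be an
`∃`-formula monotone in `x`. If every `ϖ` outside `A` satisfied `θ(x, ϖ)` for some `x`, uniform
boundedness over `Ω` would bound these `x` by a single `X`, and by monotonicity `θ(X, ϖ)` would hold
for all `ϖ` outside `A`. Hence if no `x` works for all `ϖ` outside `A`, then some `ϖ` outside `A`
fails for every `x` (`exists_forall_of_forall_exists`). With `θ` the dual of `φ`, respectively `φ`
itself, this is the nontrivial direction of the two statements over `Ω`.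

The statements with `μ` exchange `x` with the event instead (`forall_pos_exists_iff`). If `P(A) ≤ r
- μ`, then `P(A) < r`, so a point outside `A` and an `x` are available. Since `P(A) ≤ r - μ` is a
`∀`-formula, the implication is equivalent to an `∃`-formula, and uniform boundedness over `S`
yields one `x` for all `A`. Conversely, `P(A) < r` leaves room for a rational `μ > 0` with `P(A) ≤ r
- μ`.

These arguments are carried out in models and transferred to derivations by a completeness theorem
(`proves_of_forall_model`). The extensionality rule has a premise without assumptions, so it is
absorbed by taking all theorems as assumptions; what remains is plain predicate logic `PL`, for
which a Henkin construction gives models (`exists_model`, `termModel_sat`).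

In a model, the possibly nonstandard numbers modulo the model's equality form an ordered semiring
`Num`, by induction inside the model. It embeds into an ordered field (`exists_ordered_field`),
where coded rationals get values and coded reals get approximations, so that estimates become linear
arithmetic. Two facts about reals are needed: `exists_pos_of_RLt` and `RLt_of_RLe`. -/

theorem Tm.ren_eq_subst {Γ Δ : List Ty} (r : Ren Γ Δ) {σ : Ty} (t : Tm Γ σ) :
    t.ren r = t.subst fun _ v => Tm.var (r _ v) := by
  induction t with
  | var v => rfl
  | con c => rfl
  | app t u iht ihu => simp only [Tm.ren, Tm.subst, iht, ihu]

theorem Tm.wk_eq_subst {Γ : List Ty} {τ σ : Ty} (t : Tm Γ σ) :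
    (t.wk : Tm (τ :: Γ) σ) = t.subst fun _ v => Tm.var (Var.s v) :=
  Tm.ren_eq_subst _ t

theorem Tm.subst_subst {Γ Δ Ξ : List Ty} (s : Sub Γ Δ) (s' : Sub Δ Ξ) {σ : Ty} (t : Tm Γ σ) :
    (t.subst s).subst s' = t.subst fun _ v => (s _ v).subst s' := by
  induction t with
  | var v => rfl
  | con c => rfl
  | app t u iht ihu => simp only [Tm.subst, iht, ihu]

theorem Tm.subst_id {Γ : List Ty} {σ : Ty} (t : Tm Γ σ) :
    t.subst (fun _ v => Tm.var v) = t := by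
  induction t with
  | var v => rfl
  | con c => rfl
  | app t u iht ihu => simp only [Tm.subst, iht, ihu]

theorem Sub.lift_comp {Γ Δ Ξ : List Ty} (s : Sub Γ Δ) (s' : Sub Δ Ξ) (τ : Ty) :
    (fun σ v => (s.lift τ σ v).subst (s'.lift τ)) =
      Sub.lift (fun σ v => (s σ v).subst s') τ := by
  funext σ v
  cases v with
  | z => rfl
  | s v => simp only [Sub.lift, Tm.wk_eq_subst, Tm.subst_subst, Tm.subst]

theorem Sub.lift_var {Γ : List Ty} (τ : Ty) :
    Sub.lift (fun _ (v : Var Γ _) => Tm.var v) τ = fun _ v => Tm.var v := by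
  funext σ v
  cases v <;> rfl

theorem Fm.subst_subst {Γ Δ Ξ : List Ty} (s : Sub Γ Δ) (s' : Sub Δ Ξ) (φ : Fm Γ) :
    (φ.subst s).subst s' = φ.subst fun _ v => (s _ v).subst s' := by
  induction φ generalizing Δ Ξ with
  | eq t u => simp only [Fm.subst, Tm.subst_subst]
  | and φ ψ h₁ h₂ => simp only [Fm.subst, h₁, h₂]
  | or φ ψ h₁ h₂ => simp only [Fm.subst, h₁, h₂]
  | imp φ ψ h₁ h₂ => simp only [Fm.subst, h₁, h₂]
  | all σ φ h => simp only [Fm.subst, h, Sub.lift_comp]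
  | ex σ φ h => simp only [Fm.subst, h, Sub.lift_comp]

theorem Fm.subst_id {Γ : List Ty} (φ : Fm Γ) : φ.subst (fun _ v => Tm.var v) = φ := by
  induction φ with
  | eq t u => simp only [Fm.subst, Tm.subst_id]
  | and φ ψ h₁ h₂ => simp only [Fm.subst, h₁, h₂]
  | or φ ψ h₁ h₂ => simp only [Fm.subst, h₁, h₂]
  | imp φ ψ h₁ h₂ => simp only [Fm.subst, h₁, h₂]
  | all σ φ h => simp only [Fm.subst, Sub.lift_var, h]
  | ex σ φ h => simp only [Fm.subst, Sub.lift_var, h]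

theorem Sub.lift_comp_cons {Γ Δ Ξ : List Ty} (s : Sub Γ Δ) (s' : Sub Δ Ξ) {τ : Ty} (t : Tm Ξ τ) :
    (fun σ v => (s.lift τ σ v).subst (Sub.cons t s')) =
      Sub.cons t (fun σ v => (s σ v).subst s') := by
  funext σ v
  cases v with
  | z => rfl
  | s v => simp only [Sub.lift, Sub.cons, Tm.wk_eq_subst, Tm.subst_subst, Tm.subst]

theorem Sub.cons_comp {Γ Δ Ξ : List Ty} (s : Sub Γ Δ) (s' : Sub Δ Ξ) {τ : Ty} (t : Tm Δ τ) :
    (fun σ v => (Sub.cons t s σ v).subst s') =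
      Sub.cons (t.subst s') (fun σ v => (s σ v).subst s') := by
  funext σ v
  cases v <;> rfl

/-- Instantiating under a lifted substitution is the same as extending the substitution. This is
what matches the quantifier rules with extended assignments in the term model. -/
theorem Fm.lift_subst_inst {Γ Δ : List Ty} (s : Sub Γ Δ) {τ : Ty} (t : Tm Δ τ)
    (φ : Fm (τ :: Γ)) : (φ.subst (s.lift τ)).inst t = φ.subst (Sub.cons t s) := by
  rw [Fm.inst, Fm.subst_subst, Sub.lift_comp_cons]
  have h : (fun σ v => (s σ v).subst Sub.id) = s := by
    funext σ v
    exact Tm.subst_id _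
  rw [h]

theorem Fm.inst_subst {Γ Δ : List Ty} (s : Sub Γ Δ) {τ : Ty} (t : Tm Γ τ)
    (φ : Fm (τ :: Γ)) : (φ.inst t).subst s = (φ.subst (s.lift τ)).inst (t.subst s) := by
  rw [Fm.lift_subst_inst, Fm.inst, Fm.subst_subst, Sub.cons_comp]
  rfl

theorem Fm.wk_subst_lift {Γ Δ : List Ty} (s : Sub Γ Δ) {τ : Ty} (φ : Fm Γ) :
    φ.wk.subst (s.lift τ) = (φ.subst s).wk := by
  rw [Fm.wk, Fm.wk, Fm.subst_subst, Fm.subst_subst]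
  congr 1
  funext σ v
  simp only [Tm.subst, Sub.lift, Tm.wk_eq_subst]

theorem Fm.subst_lift_inst_v0 {Γ : List Ty} {τ : Ty} (φ : Fm (τ :: Γ)) :
    (φ.subst (Sub.lift (fun _ v => Tm.var (Var.s v)) τ)).inst v0 = φ := by
  rw [Fm.lift_subst_inst]
  conv_rhs => rw [← Fm.subst_id φ]
  congr 1
  funext σ v
  cases v <;> rfl

theorem Fm.neg_subst {Γ Δ : List Ty} (s : Sub Γ Δ) (φ : Fm Γ) :
    φ.neg.subst s = (φ.subst s).neg := rfl

/-- Every type has a closed term. -/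
def Tm.inhabitant {Γ : List Ty} : (σ : Ty) → Tm Γ σ
  | Ty.nat => Tm.con Con.zero
  | Ty.Om => Tm.con Con.pt
  | Ty.Ev => Tm.con Con.empty
  | Ty.fn ρ τ => Tm.app (Tm.con (Con.proj τ ρ)) (Tm.inhabitant τ)

/-! ### Classical predicate logic from arbitrary sets of assumptions -/

/-- Classical many-sorted natural deduction from a set of assumptions. -/
inductive PL : {Γ : List Ty} → Set (Fm Γ) → Fm Γ → Prop
  | hyp {Γ : List Ty} {S : Set (Fm Γ)} {φ : Fm Γ} : φ ∈ S → PL S φ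
  | andI {Γ : List Ty} {S : Set (Fm Γ)} {φ ψ : Fm Γ} : PL S φ → PL S ψ → PL S (Fm.and φ ψ)
  | andL {Γ : List Ty} {S : Set (Fm Γ)} {φ ψ : Fm Γ} : PL S (Fm.and φ ψ) → PL S φ
  | andR {Γ : List Ty} {S : Set (Fm Γ)} {φ ψ : Fm Γ} : PL S (Fm.and φ ψ) → PL S ψ
  | orL {Γ : List Ty} {S : Set (Fm Γ)} {φ ψ : Fm Γ} : PL S φ → PL S (Fm.or φ ψ)
  | orR {Γ : List Ty} {S : Set (Fm Γ)} {φ ψ : Fm Γ} : PL S ψ → PL S (Fm.or φ ψ)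
  | orE {Γ : List Ty} {S : Set (Fm Γ)} {φ ψ χ : Fm Γ} :
      PL S (Fm.or φ ψ) → PL (insert φ S) χ → PL (insert ψ S) χ → PL S χ
  | impI {Γ : List Ty} {S : Set (Fm Γ)} {φ ψ : Fm Γ} : PL (insert φ S) ψ → PL S (Fm.imp φ ψ)
  | impE {Γ : List Ty} {S : Set (Fm Γ)} {φ ψ : Fm Γ} : PL S (Fm.imp φ ψ) → PL S φ → PL S ψ
  | raa {Γ : List Ty} {S : Set (Fm Γ)} {φ : Fm Γ} : PL (insert (Fm.neg φ) S) Fm.bot → PL S φ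
  | allI {Γ : List Ty} {S : Set (Fm Γ)} {σ : Ty} {φ : Fm (σ :: Γ)} :
      PL (Fm.wk '' S) φ → PL S (Fm.all σ φ)
  | allE {Γ : List Ty} {S : Set (Fm Γ)} {σ : Ty} {φ : Fm (σ :: Γ)} (t : Tm Γ σ) :
      PL S (Fm.all σ φ) → PL S (φ.inst t)
  | exI {Γ : List Ty} {S : Set (Fm Γ)} {σ : Ty} {φ : Fm (σ :: Γ)} (t : Tm Γ σ) :
      PL S (φ.inst t) → PL S (Fm.ex σ φ)
  | exE {Γ : List Ty} {S : Set (Fm Γ)} {σ : Ty} {φ : Fm (σ :: Γ)} {ψ : Fm Γ} :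
      PL S (Fm.ex σ φ) → PL (insert φ (Fm.wk '' S)) ψ.wk → PL S ψ

namespace PL

variable {Γ : List Ty}

theorem mono {S S' : Set (Fm Γ)} {φ : Fm Γ} (h : PL S φ) (hS : S ⊆ S') : PL S' φ := by
  induction h with
  | hyp h => exact .hyp (hS h)
  | andI _ _ h₁ h₂ => exact .andI (h₁ hS) (h₂ hS)
  | andL _ h => exact .andL (h hS)
  | andR _ h => exact .andR (h hS)
  | orL _ h => exact .orL (h hS)
  | orR _ h => exact .orR (h hS)
  | orE _ _ _ h h₁ h₂ =>
      exact .orE (h hS) (h₁ (Set.insert_subset_insert hS)) (h₂ (Set.insert_subset_insert hS))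
  | impI _ h => exact .impI (h (Set.insert_subset_insert hS))
  | impE _ _ h₁ h₂ => exact .impE (h₁ hS) (h₂ hS)
  | raa _ h => exact .raa (h (Set.insert_subset_insert hS))
  | allI _ h => exact .allI (h (Set.image_mono hS))
  | allE t _ h => exact .allE t (h hS)
  | exI t _ h => exact .exI t (h hS)
  | exE _ _ h₁ h₂ => exact .exE (h₁ hS) (h₂ (Set.insert_subset_insert (Set.image_mono hS)))

theorem image_lift_wk {Δ : List Ty} (s : Sub Γ Δ) (σ : Ty) (S : Set (Fm Γ)) :
    Fm.subst (s.lift σ) '' (Fm.wk '' S) = Fm.wk '' (Fm.subst s '' S) := by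
  rw [Set.image_image, Set.image_image]
  exact Set.image_congr fun φ _ => Fm.wk_subst_lift s φ

theorem subst {S : Set (Fm Γ)} {φ : Fm Γ} (h : PL S φ) :
    ∀ {Δ : List Ty} (s : Sub Γ Δ), PL (Fm.subst s '' S) (φ.subst s) := by
  induction h with
  | hyp h => exact fun s => .hyp (Set.mem_image_of_mem _ h)
  | andI _ _ h₁ h₂ => exact fun s => .andI (h₁ s) (h₂ s)
  | andL _ h => exact fun s => .andL (h s)
  | andR _ h => exact fun s => .andR (h s)
  | orL _ h => exact fun s => .orL (h s)
  | orR _ h => exact fun s => .orR (h s)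
  | orE _ _ _ h h₁ h₂ =>
      intro Δ s
      have h₁ := h₁ s
      have h₂ := h₂ s
      rw [Set.image_insert_eq] at h₁ h₂
      exact .orE (h s) h₁ h₂
  | impI _ h =>
      intro Δ s
      have h := h s
      rw [Set.image_insert_eq] at h
      exact .impI h
  | impE _ _ h₁ h₂ => exact fun s => .impE (h₁ s) (h₂ s)
  | raa _ h =>
      intro Δ s
      have h := h s
      rw [Set.image_insert_eq] at h
      exact .raa h
  | allI _ h =>
      intro Δ s
      have h := h (s.lift _)
      rw [image_lift_wk] at h
      exact .allI h
  | allE t _ h =>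
      intro Δ s
      rw [Fm.inst_subst]
      exact .allE _ (h s)
  | exI t _ h =>
      intro Δ s
      have h := h s
      rw [Fm.inst_subst] at h
      exact .exI _ h
  | exE _ _ h₁ h₂ =>
      intro Δ s
      have h₂ := h₂ (s.lift _)
      rw [Set.image_insert_eq, image_lift_wk, Fm.wk_subst_lift] at h₂
      exact .exE (h₁ s) h₂

theorem wk {S : Set (Fm Γ)} {φ : Fm Γ} {σ : Ty} (h : PL S φ) :
    PL (Fm.wk '' S) (φ.wk : Fm (σ :: Γ)) := h.subst _

theorem botE {S : Set (Fm Γ)} {φ : Fm Γ} (h : PL S Fm.bot) : PL S φ :=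
  .raa (h.mono (Set.subset_insert _ _))

/-- Generalise over the new variable and instantiate with a closed term. Adding a variable preserves
consistency only because every type is inhabited. -/
theorem of_wk_bot {S : Set (Fm Γ)} {σ : Ty} (h : PL (Fm.wk (τ := σ) '' S) Fm.bot) :
    PL S Fm.bot :=
  PL.allE (φ := Fm.bot) (Tm.inhabitant σ) (.allI h)

theorem cut {S : Set (Fm Γ)} {φ ψ : Fm Γ} (h : PL S φ) (h' : PL (insert φ S) ψ) : PL S ψ :=
  .impE (.impI h') h

theorem insert_hyp (S : Set (Fm Γ)) (φ : Fm Γ) : PL (insert φ S) φ := .hyp (Set.mem_insert _ _)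

theorem weaken {S : Set (Fm Γ)} {φ ψ : Fm Γ} (h : PL S φ) : PL (insert ψ S) φ :=
  h.mono (Set.subset_insert _ _)

/-- The Henkin construction supplies witnesses for existential formulas only; a rejected universal
formula is turned into an existential one here. -/
theorem neg_all {S : Set (Fm Γ)} {σ : Ty} {φ : Fm (σ :: Γ)} (h : PL S (Fm.all σ φ).neg) :
    PL S (Fm.ex σ φ.neg) := by
  refine .raa (.impE h.weaken (.allI (.raa ?_)))
  refine .impE (φ := (Fm.ex σ φ.neg).wk) ?_ (.exI v0 ?_)
  · rw [Set.image_insert_eq]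
    exact (insert_hyp _ _).weaken
  · rw [Fm.subst_lift_inst_v0]
    exact insert_hyp _ _

end PL

/-! ### Derivability from lists of assumptions -/

section Lists

variable {T : Theory} {Γ : List Ty}

theorem Derives.weaken {H H' : List (Fm Γ)} {φ : Fm Γ} (h : Derives T H φ) (hH : H ⊆ H') :
    Derives T H' φ := by
  induction h with
  | ax h => exact .ax h
  | hyp h => exact .hyp (hH h)
  | andI _ _ h₁ h₂ => exact .andI (h₁ hH) (h₂ hH)
  | andL _ h => exact .andL (h hH)
  | andR _ h => exact .andR (h hH)
  | orL _ h => exact .orL (h hH)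
  | orR _ h => exact .orR (h hH)
  | orE _ _ _ h h₁ h₂ =>
      exact .orE (h hH) (h₁ (List.cons_subset_cons _ hH)) (h₂ (List.cons_subset_cons _ hH))
  | impI _ h => exact .impI (h (List.cons_subset_cons _ hH))
  | impE _ _ h₁ h₂ => exact .impE (h₁ hH) (h₂ hH)
  | raa _ h => exact .raa (h (List.cons_subset_cons _ hH))
  | allI _ h => exact .allI (h (List.map_subset _ hH))
  | allE t _ h => exact .allE t (h hH)
  | exI t _ h => exact .exI t (h hH)
  | exE _ _ h₁ h₂ => exact .exE (h₁ hH) (h₂ (List.cons_subset_cons _ (List.map_subset _ hH)))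
  -- The premise of the extensionality rule carries no assumptions, so it is reused unchanged.
  | qfer r hφ h _ => exact .qfer r hφ h

theorem Derives.cuts {H : List (Fm Γ)} : ∀ (L : List (Fm Γ)) {φ : Fm Γ}, Derives T L φ →
    (∀ χ ∈ L, Derives T H χ) → Derives T H φ
  | [], _, h, _ => h.weaken (List.nil_subset _)
  | χ :: L, _, h, hL =>
      .impE (Derives.cuts L (.impI h) fun χ' h' => hL χ' (List.mem_cons_of_mem _ h'))
        (hL χ List.mem_cons_self)

theorem exists_list_of_subset_insert {S : Set (Fm Γ)} {φ : Fm Γ} {L : List (Fm Γ)}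
    (h : ∀ χ ∈ L, χ ∈ insert φ S) : ∃ L' : List (Fm Γ), (∀ χ ∈ L', χ ∈ S) ∧ L ⊆ φ :: L' := by
  classical
  refine ⟨L.filter fun χ => χ ∈ S, fun χ hχ => by simpa using (List.mem_filter.1 hχ).2, ?_⟩
  intro χ hχ
  rcases h χ hχ with rfl | h'
  · exact List.mem_cons_self
  · exact List.mem_cons_of_mem _ (List.mem_filter.2 ⟨hχ, by simpa using h'⟩)

theorem exists_list_of_subset_image {Δ : List Ty} {S : Set (Fm Γ)} {f : Fm Γ → Fm Δ}
    {L : List (Fm Δ)} (h : ∀ χ ∈ L, χ ∈ f '' S) :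
    ∃ L' : List (Fm Γ), (∀ χ ∈ L', χ ∈ S) ∧ L = L'.map f := by
  induction L with
  | nil => exact ⟨[], by simp, rfl⟩
  | cons χ L ih =>
      obtain ⟨L', h₁, rfl⟩ := ih fun χ' h' => h χ' (List.mem_cons_of_mem _ h')
      obtain ⟨χ₀, h₂, rfl⟩ := h _ List.mem_cons_self
      exact ⟨χ₀ :: L', by simpa using ⟨h₂, h₁⟩, rfl⟩

/-- Derivations are finite. Where a rule discharges an assumption or weakens all of them, the finite
list found for the premise is split or pulled back accordingly. -/
theorem PL.exists_derives {S : Set (Fm Γ)} {φ : Fm Γ} (h : PL S φ) :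
    ∃ L : List (Fm Γ), (∀ χ ∈ L, χ ∈ S) ∧ Derives T L φ := by
  induction h with
  | @hyp _ _ φ h => exact ⟨[φ], by simpa using h, .hyp List.mem_cons_self⟩
  | andI _ _ h₁ h₂ =>
      obtain ⟨L₁, h₁, d₁⟩ := h₁
      obtain ⟨L₂, h₂, d₂⟩ := h₂
      exact ⟨L₁ ++ L₂, by simpa [or_imp, forall_and] using ⟨h₁, h₂⟩,
        .andI (d₁.weaken (List.subset_append_left _ _)) (d₂.weaken (List.subset_append_right _ _))⟩
  | andL _ h => exact h.imp fun _ h => ⟨h.1, .andL h.2⟩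
  | andR _ h => exact h.imp fun _ h => ⟨h.1, .andR h.2⟩
  | orL _ h => exact h.imp fun _ h => ⟨h.1, .orL h.2⟩
  | orR _ h => exact h.imp fun _ h => ⟨h.1, .orR h.2⟩
  | orE _ _ _ h h₁ h₂ =>
      obtain ⟨L, h, d⟩ := h
      obtain ⟨L₁, h₁, d₁⟩ := h₁
      obtain ⟨L₂, h₂, d₂⟩ := h₂
      obtain ⟨L₁, h₁, s₁⟩ := exists_list_of_subset_insert h₁
      obtain ⟨L₂, h₂, s₂⟩ := exists_list_of_subset_insert h₂
      refine ⟨L ++ (L₁ ++ L₂), by simpa [or_imp, forall_and] using ⟨h, h₁, h₂⟩,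
        .orE (d.weaken (List.subset_append_left _ _)) (d₁.weaken ?_) (d₂.weaken ?_)⟩
      · exact List.Subset.trans s₁ (List.cons_subset_cons _ (by simp))
      · exact List.Subset.trans s₂ (List.cons_subset_cons _ (by simp))
  | impI _ h =>
      obtain ⟨L, h, d⟩ := h
      obtain ⟨L, h, s⟩ := exists_list_of_subset_insert h
      exact ⟨L, h, .impI (d.weaken s)⟩
  | impE _ _ h₁ h₂ =>
      obtain ⟨L₁, h₁, d₁⟩ := h₁
      obtain ⟨L₂, h₂, d₂⟩ := h₂
      exact ⟨L₁ ++ L₂, by simpa [or_imp, forall_and] using ⟨h₁, h₂⟩,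
        .impE (d₁.weaken (List.subset_append_left _ _)) (d₂.weaken (List.subset_append_right _ _))⟩
  | raa _ h =>
      obtain ⟨L, h, d⟩ := h
      obtain ⟨L, h, s⟩ := exists_list_of_subset_insert h
      exact ⟨L, h, .raa (d.weaken s)⟩
  | allI _ h =>
      obtain ⟨L, h, d⟩ := h
      obtain ⟨L', h', rfl⟩ := exists_list_of_subset_image h
      exact ⟨L', h', .allI d⟩
  | allE t _ h => exact h.imp fun _ h => ⟨h.1, .allE t h.2⟩
  | exI t _ h => exact h.imp fun _ h => ⟨h.1, .exI t h.2⟩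
  | exE _ _ h h₁ =>
      obtain ⟨L, h, d⟩ := h
      obtain ⟨L₁, h₁, d₁⟩ := h₁
      obtain ⟨L₁, h₁, s₁⟩ := exists_list_of_subset_insert h₁
      obtain ⟨L₂, h₂, rfl⟩ := exists_list_of_subset_image h₁
      refine ⟨L ++ L₂, by simpa [or_imp, forall_and] using ⟨h, h₂⟩,
        .exE (d.weaken (List.subset_append_left _ _)) (d₁.weaken (List.Subset.trans s₁ ?_))⟩
      exact List.cons_subset_cons _ (List.map_subset _ (List.subset_append_right _ _))

end Lists

end FinType

namespace FinType

/-! ### Countability of the language -/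

open Nat (pair pair_eq_pair)

/-- Codes in `ℕ` show that the language is countable, so that the Henkin construction can treat all
formulas in one sequence of stages. -/
def Ty.code : Ty → ℕ
  | Ty.nat => pair 0 0
  | Ty.Om => pair 1 0
  | Ty.Ev => pair 2 0
  | Ty.fn ρ τ => pair 3 (pair ρ.code τ.code)

theorem Ty.code_injective : ∀ {σ τ : Ty}, σ.code = τ.code → σ = τ := by
  intro σ
  induction σ with
  | fn ρ τ h₁ h₂ =>
      intro τ' h
      cases τ' <;> simp only [Ty.code, pair_eq_pair] at h <;> try omega
      rw [h₁ h.2.1, h₂ h.2.2]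
  | _ =>
      intro τ' h
      cases τ' <;> simp only [Ty.code, pair_eq_pair] at h <;> first | rfl | omega

def Ty.codes : List Ty → ℕ
  | [] => 0
  | σ :: Γ => pair σ.code (Ty.codes Γ) + 1

theorem Ty.codes_injective : ∀ {Γ Δ : List Ty}, Ty.codes Γ = Ty.codes Δ → Γ = Δ
  | [], [], _ => rfl
  | [], _ :: _, h => by simp [Ty.codes] at h
  | _ :: _, [], h => by simp [Ty.codes] at h
  | _ :: _, _ :: _, h => by
      simp only [Ty.codes, Nat.add_right_cancel_iff, pair_eq_pair] at h
      rw [Ty.code_injective h.1, Ty.codes_injective h.2]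

def Var.code : {Γ : List Ty} → {σ : Ty} → Var Γ σ → ℕ
  | _, _, Var.z => 0
  | _, _, Var.s v => v.code + 1

theorem Var.code_injective {Γ : List Ty} {σ : Ty} (v : Var Γ σ) : ∀ {σ' : Ty} (v' : Var Γ σ'),
    v.code = v'.code → σ = σ' ∧ HEq v v' := by
  induction v with
  | z =>
      intro σ' v' h
      cases v' with
      | z => exact ⟨rfl, HEq.rfl⟩
      | s v' => simp [Var.code] at h
  | s v ih =>
      intro σ' v' h
      cases v' with
      | z => simp [Var.code] at h
      | s v' =>
          obtain ⟨rfl, h⟩ := ih v' (by simpa [Var.code] using h)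
          cases h
          exact ⟨rfl, HEq.rfl⟩

def Con.code : {σ : Ty} → Con σ → ℕ
  | _, Con.zero => pair 0 0
  | _, Con.succ => pair 1 0
  | _, Con.proj ρ τ => pair 2 (pair ρ.code τ.code)
  | _, Con.comb δ ρ τ => pair 3 (pair δ.code (pair ρ.code τ.code))
  | _, Con.recursor ρs i => pair 4 (pair (Ty.codes ρs) i.code)
  | _, Con.eqOm => pair 5 0
  | _, Con.mem => pair 6 0
  | _, Con.union => pair 7 0
  | _, Con.compl => pair 8 0
  | _, Con.empty => pair 9 0
  | _, Con.prob => pair 10 0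
  | _, Con.pt => pair 11 0

theorem Con.code_injective {σ : Ty} (c : Con σ) {σ' : Ty} (c' : Con σ')
    (h : c.code = c'.code) : σ = σ' ∧ HEq c c' := by
  have h₀ : (Nat.unpair c.code).1 = (Nat.unpair c'.code).1 := by rw [h]
  cases c <;> cases c' <;> simp only [Con.code, Nat.unpair_pair] at h₀ <;> try omega
  all_goals try exact ⟨rfl, HEq.rfl⟩
  · simp only [Con.code, pair_eq_pair] at h
    cases Ty.code_injective h.2.1
    cases Ty.code_injective h.2.2
    exact ⟨rfl, HEq.rfl⟩
  · simp only [Con.code, pair_eq_pair] at h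
    cases Ty.code_injective h.2.1
    cases Ty.code_injective h.2.2.1
    cases Ty.code_injective h.2.2.2
    exact ⟨rfl, HEq.rfl⟩
  · simp only [Con.code, pair_eq_pair] at h
    cases Ty.codes_injective h.2.1
    obtain ⟨rfl, h⟩ := Var.code_injective _ _ h.2.2
    cases h
    exact ⟨rfl, HEq.rfl⟩

def Tm.code : {Γ : List Ty} → {σ : Ty} → Tm Γ σ → ℕ
  | _, _, Tm.var v => pair 0 v.code
  | _, _, Tm.con c => pair 1 c.code
  | _, _, Tm.app t u => pair 2 (pair t.code u.code)

/-- The type is recovered together with the term, because the argument type of an application is not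
visible in the type of its result. -/
theorem Tm.code_injective {Γ : List Ty} {σ : Ty} (t : Tm Γ σ) : ∀ {σ' : Ty} (t' : Tm Γ σ'),
    t.code = t'.code → σ = σ' ∧ HEq t t' := by
  induction t with
  | var v =>
      intro σ' t' h
      cases t' <;> simp only [Tm.code, pair_eq_pair] at h <;> try omega
      obtain ⟨rfl, h⟩ := Var.code_injective _ _ h.2
      cases h
      exact ⟨rfl, HEq.rfl⟩
  | con c =>
      intro σ' t' h
      cases t' <;> simp only [Tm.code, pair_eq_pair] at h <;> try omega
      obtain ⟨rfl, h⟩ := Con.code_injective _ _ h.2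
      cases h
      exact ⟨rfl, HEq.rfl⟩
  | app t u iht ihu =>
      intro σ' t' h
      cases t' <;> simp only [Tm.code, pair_eq_pair] at h <;> try omega
      obtain ⟨h₁, h₁'⟩ := iht _ h.2.1
      cases h₁
      cases h₁'
      obtain ⟨_, h₂'⟩ := ihu _ h.2.2
      cases h₂'
      exact ⟨rfl, HEq.rfl⟩

def Fm.code : {Γ : List Ty} → Fm Γ → ℕ
  | _, Fm.eq t u => pair 0 (pair t.code u.code)
  | _, Fm.and φ ψ => pair 1 (pair φ.code ψ.code)
  | _, Fm.or φ ψ => pair 2 (pair φ.code ψ.code)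
  | _, Fm.imp φ ψ => pair 3 (pair φ.code ψ.code)
  | _, Fm.all σ φ => pair 4 (pair σ.code φ.code)
  | _, Fm.ex σ φ => pair 5 (pair σ.code φ.code)

theorem Fm.code_injective {Γ : List Ty} (φ : Fm Γ) : ∀ φ' : Fm Γ, φ.code = φ'.code → φ = φ' := by
  induction φ with
  | eq t u =>
      intro φ' h
      cases φ' <;> simp only [Fm.code, pair_eq_pair] at h <;> try omega
      obtain ⟨_, h₁⟩ := Tm.code_injective _ _ h.2.1
      obtain ⟨_, h₂⟩ := Tm.code_injective _ _ h.2.2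
      cases h₁
      cases h₂
      rfl
  | all σ φ ih =>
      intro φ' h
      cases φ' <;> simp only [Fm.code, pair_eq_pair] at h <;> try omega
      cases Ty.code_injective h.2.1
      rw [ih _ h.2.2]
  | ex σ φ ih =>
      intro φ' h
      cases φ' <;> simp only [Fm.code, pair_eq_pair] at h <;> try omega
      cases Ty.code_injective h.2.1
      rw [ih _ h.2.2]
  | _ φ ψ ih₁ ih₂ =>
      intro φ' h
      cases φ' <;> simp only [Fm.code, pair_eq_pair] at h <;> try omega
      rw [ih₁ _ h.2.1, ih₂ _ h.2.2]

instance : Countable Ty := ⟨⟨Ty.code, fun _ _ => Ty.code_injective⟩⟩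

instance {Γ : List Ty} : Countable (Fm Γ) := ⟨⟨Fm.code, fun _ _ => Fm.code_injective _ _⟩⟩

/-! ### Models -/

/-- A many-sorted structure for the language. -/
structure Model where
  D : Ty → Type
  app : {σ τ : Ty} → D (Ty.fn σ τ) → D σ → D τ
  con : {σ : Ty} → Con σ → D σ
  eq : D Ty.nat → D Ty.nat → Prop

/-- Assignments of values to the variables of a context. -/
abbrev Env (M : Model) (Γ : List Ty) : Type := ∀ σ : Ty, Var Γ σ → M.D σ

def Env.cons {M : Model} {Γ : List Ty} {τ : Ty} (a : M.D τ) (ρ : Env M Γ) : Env M (τ :: Γ)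
  | _, Var.z => a
  | _, Var.s v => ρ _ v

def Tm.eval {M : Model} {Γ : List Ty} (ρ : Env M Γ) : {σ : Ty} → Tm Γ σ → M.D σ
  | _, Tm.var v => ρ _ v
  | _, Tm.con c => M.con c
  | _, Tm.app t u => M.app (t.eval ρ) (u.eval ρ)

/-- The value of a substitution. -/
def Sub.eval {M : Model} {Γ Δ : List Ty} (ρ : Env M Δ) (s : Sub Γ Δ) : Env M Γ :=
  fun _ v => (s _ v).eval ρ

/-- Satisfaction. -/
def Sat {M : Model} : {Γ : List Ty} → Env M Γ → Fm Γ → Prop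
  | _, ρ, Fm.eq t u => M.eq (t.eval ρ) (u.eval ρ)
  | _, ρ, Fm.and φ ψ => Sat ρ φ ∧ Sat ρ ψ
  | _, ρ, Fm.or φ ψ => Sat ρ φ ∨ Sat ρ ψ
  | _, ρ, Fm.imp φ ψ => Sat ρ φ → Sat ρ ψ
  | _, ρ, Fm.all σ φ => ∀ a : M.D σ, Sat (Env.cons a ρ) φ
  | _, ρ, Fm.ex σ φ => ∃ a : M.D σ, Sat (Env.cons a ρ) φ

section Evaluation

variable {M : Model} {Γ Δ : List Ty}

theorem Tm.eval_subst (ρ : Env M Δ) (s : Sub Γ Δ) {σ : Ty} (t : Tm Γ σ) :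
    (t.subst s).eval ρ = t.eval (s.eval ρ) := by
  induction t with
  | var v => rfl
  | con c => rfl
  | app t u iht ihu => simp only [Tm.subst, Tm.eval, iht, ihu]

theorem Tm.eval_wk (ρ : Env M Γ) {τ σ : Ty} (a : M.D τ) (t : Tm Γ σ) :
    (t.wk).eval (Env.cons a ρ) = t.eval ρ := by
  rw [Tm.wk_eq_subst, Tm.eval_subst]
  rfl

theorem Sub.eval_lift (ρ : Env M Δ) (s : Sub Γ Δ) {τ : Ty} (a : M.D τ) :
    (s.lift τ).eval (Env.cons a ρ) = Env.cons a (s.eval ρ) := by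
  funext σ v
  cases v with
  | z => rfl
  | s v => exact Tm.eval_wk _ _ _

theorem Sub.eval_cons (ρ : Env M Δ) (s : Sub Γ Δ) {τ : Ty} (t : Tm Δ τ) :
    (Sub.cons t s).eval ρ = Env.cons (t.eval ρ) (s.eval ρ) := by
  funext σ v
  cases v <;> rfl

theorem Sub.eval_id (ρ : Env M Γ) : Sub.id.eval ρ = ρ := rfl

theorem Sat_subst (ρ : Env M Δ) (s : Sub Γ Δ) (φ : Fm Γ) :
    Sat ρ (φ.subst s) ↔ Sat (s.eval ρ) φ := by
  induction φ generalizing Δ with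
  | eq t u => simp only [Fm.subst, Sat, Tm.eval_subst]
  | and φ ψ h₁ h₂ => simp only [Fm.subst, Sat, h₁, h₂]
  | or φ ψ h₁ h₂ => simp only [Fm.subst, Sat, h₁, h₂]
  | imp φ ψ h₁ h₂ => simp only [Fm.subst, Sat, h₁, h₂]
  | all σ φ h => simp only [Fm.subst, Sat, h, Sub.eval_lift]
  | ex σ φ h => simp only [Fm.subst, Sat, h, Sub.eval_lift]

theorem Sat_inst (ρ : Env M Γ) {τ : Ty} (t : Tm Γ τ) (φ : Fm (τ :: Γ)) :
    Sat ρ (φ.inst t) ↔ Sat (Env.cons (t.eval ρ) ρ) φ := by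
  rw [Fm.inst, Sat_subst, Sub.eval_cons, Sub.eval_id]

theorem Sat_wk (ρ : Env M Γ) {τ : Ty} (a : M.D τ) (φ : Fm Γ) :
    Sat (Env.cons a ρ) φ.wk ↔ Sat ρ φ := by
  rw [Fm.wk, Sat_subst]
  rfl

end Evaluation

end FinType

namespace FinType

/-! ### The completeness theorem -/

open Filter

/-! ### The Henkin construction -/

section Henkin

variable {Γ : List Ty}

/-- The contexts obtained from `Γ` by adding variables of the types `ty 0`, `ty 1`, …. -/
@[reducible] def lev (Γ : List Ty) (ty : ℕ → Ty) : ℕ → List Ty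
  | 0 => Γ
  | n + 1 => ty n :: lev Γ ty n

/-- `S` together with `φ`, if this is consistent. -/
def decideSet (S : Set (Fm Γ)) (φ : Fm Γ) : Set (Fm Γ) :=
  {χ | χ ∈ S ∨ (χ = φ ∧ ¬ PL (insert φ S) Fm.bot)}

theorem decideSet_consistent {S : Set (Fm Γ)} (φ : Fm Γ) (hS : ¬ PL S Fm.bot) :
    ¬ PL (decideSet S φ) Fm.bot := by
  by_cases h : PL (insert φ S) Fm.bot
  · exact fun h' => hS (h'.mono fun χ hχ => hχ.resolve_right fun h₂ => h₂.2 h)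
  · exact fun h' => h (h'.mono fun χ hχ => hχ.elim (Set.mem_insert_of_mem _) fun h₂ =>
      h₂.1 ▸ Set.mem_insert _ _)

/-- One step of the Henkin construction: `φ` is decided, and if it is an existential statement
about objects of type `σ` that is accepted, then the new variable becomes a witness. -/
def henkinStep (σ : Ty) (S : Set (Fm Γ)) (φ : Fm Γ) : Set (Fm (σ :: Γ)) :=
  Fm.wk '' decideSet S φ ∪ {ψ | Fm.ex σ ψ = φ ∧ φ ∈ decideSet S φ}

/-- If a witness is added, the rule `exE` removes it again; if not, the new variable is harmless by
`PL.of_wk_bot`. -/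
theorem henkinStep_consistent (σ : Ty) {S : Set (Fm Γ)} (φ : Fm Γ) (hS : ¬ PL S Fm.bot) :
    ¬ PL (henkinStep σ S φ) Fm.bot := by
  intro h
  refine decideSet_consistent φ hS ?_
  by_cases h' : ∃ ψ, Fm.ex σ ψ = φ ∧ φ ∈ decideSet S φ
  · obtain ⟨ψ, h₁, h₂⟩ := h'
    refine .exE (σ := σ) (φ := ψ) (.hyp (h₁ ▸ h₂)) (h.mono ?_)
    rintro χ (hχ | ⟨h₃, -⟩)
    · exact Set.mem_insert_of_mem _ hχ
    · rw [← h₁] at h₃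
      cases h₃
      exact Set.mem_insert _ _
  · refine PL.of_wk_bot (σ := σ) (h.mono ?_)
    rintro χ (hχ | hχ)
    · exact hχ
    · exact absurd ⟨χ, hχ⟩ h'

variable (ty : ℕ → Ty)

/-- The sets of accepted formulas in the Henkin construction. -/
def henkinSet (S : Set (Fm Γ)) (task : ∀ n, Fm (lev Γ ty n)) : ∀ n, Set (Fm (lev Γ ty n))
  | 0 => S
  | n + 1 => henkinStep (ty n) (henkinSet S task n) (task n)

/-- The weakenings of a formula of level `m`; at lower levels a dummy. -/
def extendFm (m : ℕ) (φ : Fm (lev Γ ty m)) : ∀ n, Fm (lev Γ ty n)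
  | 0 => if h : m = 0 then h ▸ φ else Fm.bot
  | n + 1 => if h : m = n + 1 then h ▸ φ else (extendFm m φ n).wk

theorem extendFm_self (m : ℕ) (φ : Fm (lev Γ ty m)) : extendFm ty m φ m = φ := by
  cases m <;> simp [extendFm]

theorem extendFm_succ {m n : ℕ} (φ : Fm (lev Γ ty m)) (h : m ≤ n) :
    extendFm ty m φ (n + 1) = (extendFm ty m φ n).wk := by
  rw [extendFm, dif_neg (by omega)]

/-- The weakenings of a term of level `m`; at lower levels a dummy. -/
def extendTm (m : ℕ) {σ : Ty} (t : Tm (lev Γ ty m) σ) : ∀ n, Tm (lev Γ ty n) σ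
  | 0 => if h : m = 0 then h ▸ t else Tm.inhabitant σ
  | n + 1 => if h : m = n + 1 then h ▸ t else (extendTm m t n).wk

theorem extendTm_self (m : ℕ) {σ : Ty} (t : Tm (lev Γ ty m) σ) : extendTm ty m t m = t := by
  cases m <;> simp [extendTm]

theorem extendTm_succ {m n : ℕ} {σ : Ty} (t : Tm (lev Γ ty m) σ) (h : m ≤ n) :
    extendTm ty m t (n + 1) = (extendTm ty m t n).wk := by
  rw [extendTm, dif_neg (by omega)]

/-- A sequence of formulas that are eventually the weakenings of each other. -/
def Coherent (F : ∀ n, Fm (lev Γ ty n)) : Prop := ∀ᶠ n in atTop, F (n + 1) = (F n).wk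

/-- Stage `n` is read as a triple: a type for the new variable, a formula of some level to be
decided, and padding that makes every combination recur at arbitrarily late stages. -/
theorem exists_tasks (Γ : List Ty) : ∃ (ty : ℕ → Ty) (task : ∀ n, Fm (lev Γ ty n)),
    ∀ (σ : Ty) (F : ∀ n, Fm (lev Γ ty n)), Coherent ty F →
      ∃ᶠ n in atTop, ty n = σ ∧ task n = F n := by
  have : Nonempty Ty := ⟨Ty.nat⟩
  obtain ⟨g, hg⟩ := exists_surjective_nat Ty
  -- The types of the new variables must be fixed first, because the formulas enumerated below live
  -- in the contexts that they determine.
  let ty : ℕ → Ty := fun n => g n.unpair.1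
  have : Nonempty (Σ m, Fm (lev Γ ty m)) := ⟨⟨0, Fm.bot⟩⟩
  obtain ⟨f, hf⟩ := exists_surjective_nat (Σ m, Fm (lev Γ ty m))
  let task : ∀ n, Fm (lev Γ ty n) := fun n =>
    extendFm ty (f n.unpair.2.unpair.1).1 (f n.unpair.2.unpair.1).2 n
  refine ⟨ty, task, fun σ F hF => ?_⟩
  obtain ⟨N, hN⟩ := eventually_atTop.1 hF
  obtain ⟨a, ha⟩ := hg σ
  obtain ⟨b, hb⟩ := hf ⟨N, F N⟩
  have hext : ∀ n, N ≤ n → extendFm ty N (F N) n = F n := by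
    intro n hn
    induction n, hn using Nat.le_induction with
    | base => exact extendFm_self _ _ _
    | succ n hn ih => rw [extendFm_succ _ _ hn, ih, hN n hn]
  rw [frequently_atTop]
  intro k
  -- The padding `max k N` pushes the stage beyond `k` and beyond the level `N` from which `F`
  -- consists of weakenings.
  refine ⟨Nat.pair a (Nat.pair b (max k N)), ?_, ?_, ?_⟩
  · exact ((le_max_left _ _).trans (Nat.right_le_pair _ _)).trans (Nat.right_le_pair _ _)
  · simp only [ty, Nat.unpair_pair, ha]
  · have hb' : f (Nat.pair a (Nat.pair b (max k N))).unpair.2.unpair.1 = ⟨N, F N⟩ := by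
      rw [Nat.unpair_pair, Nat.unpair_pair, hb]
    simp only [task]
    rw [hb']
    exact hext _ (((le_max_right _ _).trans (Nat.right_le_pair _ _)).trans (Nat.right_le_pair _ _))

variable {ty}
variable {S : Set (Fm Γ)} {task : ∀ n, Fm (lev Γ ty n)}

theorem henkinSet_consistent (hS : ¬ PL S Fm.bot) : ∀ n, ¬ PL (henkinSet ty S task n) Fm.bot
  | 0 => hS
  | n + 1 => henkinStep_consistent _ _ (henkinSet_consistent hS n)

theorem henkinSet_wk {n : ℕ} {φ : Fm (lev Γ ty n)} (h : PL (henkinSet ty S task n) φ) :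
    PL (henkinSet ty S task (n + 1)) φ.wk :=
  h.wk.mono fun _ hχ => Or.inl (Set.image_mono (fun _ => Or.inl) hχ)

/-- A coherent sequence of formulas is eventually accepted. -/
def Accepts (ty : ℕ → Ty) (S : Set (Fm Γ)) (task : ∀ n, Fm (lev Γ ty n))
    (F : ∀ n, Fm (lev Γ ty n)) : Prop :=
  ∀ᶠ n in atTop, PL (henkinSet ty S task n) (F n)

/-- Accepted formulas stay accepted after weakening, so a single acceptance beyond the point of
coherence suffices. -/
theorem accepts_of_frequently {F : ∀ n, Fm (lev Γ ty n)} (hF : Coherent ty F)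
    (h : ∃ᶠ n in atTop, PL (henkinSet ty S task n) (F n)) : Accepts ty S task F := by
  obtain ⟨N, hN⟩ := eventually_atTop.1 hF
  obtain ⟨m, hm, h⟩ := frequently_atTop.1 h N
  refine eventually_atTop.2 ⟨m, fun n hn => ?_⟩
  induction n, hn using Nat.le_induction with
  | base => exact h
  | succ n hn ih => exact hN n (hm.trans hn) ▸ henkinSet_wk ih

theorem Coherent.neg {F : ∀ n, Fm (lev Γ ty n)} (hF : Coherent ty F) :
    Coherent ty fun n => (F n).neg := by
  filter_upwards [hF] with n hn
  rw [hn]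
  rfl

/-- Every coherent sequence of formulas is treated infinitely often, with new variables of every
type. -/
def Exhaustive (ty : ℕ → Ty) (task : ∀ n, Fm (lev Γ ty n)) : Prop :=
  ∀ (σ : Ty) (F : ∀ n, Fm (lev Γ ty n)), Coherent ty F →
    ∃ᶠ n in atTop, ty n = σ ∧ task n = F n

/-- The sequence comes up for decision at arbitrarily late stages. If it is never taken in, adding
it must have been inconsistent there, which derives its negation. -/
theorem accepts_neg (ht : Exhaustive ty task) {F : ∀ n, Fm (lev Γ ty n)} (hF : Coherent ty F)
    (h : ¬ Accepts ty S task F) : Accepts ty S task fun n => (F n).neg := by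
  refine accepts_of_frequently hF.neg (frequently_atTop.2 fun k => ?_)
  obtain ⟨N, hN⟩ := eventually_atTop.1 hF
  by_contra hcon
  refine h (accepts_of_frequently hF (frequently_atTop.2 fun k' => ?_))
  obtain ⟨n, hn, -, htn⟩ := frequently_atTop.1 (ht Ty.nat F hF) (max k (max k' N))
  have hk : k ≤ n := (le_max_left _ _).trans hn
  have hk' : k' ≤ n := ((le_max_left _ _).trans (le_max_right _ _)).trans hn
  have hkN : N ≤ n := ((le_max_right _ _).trans (le_max_right _ _)).trans hn
  refine ⟨n + 1, by omega, ?_⟩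
  rw [hN n hkN]
  refine .hyp (Or.inl (Set.mem_image_of_mem _ (Or.inr ⟨htn.symm, fun hb => ?_⟩)))
  rw [htn] at hb
  exact hcon ⟨n, hk, .impI hb⟩

theorem not_accepts_neg (hS : ¬ PL S Fm.bot) {F : ∀ n, Fm (lev Γ ty n)}
    (h : Accepts ty S task F) : ¬ Accepts ty S task fun n => (F n).neg := by
  intro h'
  obtain ⟨n, h₁, h₂⟩ := (h.and h').exists
  exact henkinSet_consistent hS n (.impE h₂ h₁)

/-- Wait for a stage that decides this existential formula with a new variable of type `σ`. That
variable, weakened through all later levels, is the witness. -/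
theorem accepts_ex (hS : ¬ PL S Fm.bot) (ht : Exhaustive ty task) {σ : Ty}
    {F : ∀ n, Fm (σ :: lev Γ ty n)}
    (hF : ∀ᶠ n in atTop, F (n + 1) = (F n).subst (Sub.lift (fun _ v => Tm.var (Var.s v)) σ))
    (h : Accepts ty S task fun n => Fm.ex σ (F n)) :
    ∃ d : ∀ n, Tm (lev Γ ty n) σ, (∀ᶠ n in atTop, d (n + 1) = (d n).wk) ∧
      Accepts ty S task fun n => (F n).inst (d n) := by
  have hex : Coherent ty fun n => Fm.ex σ (F n) := by
    filter_upwards [hF] with n hn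
    rw [hn]
    rfl
  obtain ⟨N, hN⟩ := eventually_atTop.1 (hF.and h)
  obtain ⟨n, hn, rfl, htn⟩ := frequently_atTop.1 (ht σ _ hex) N
  have hd : ∀ m, n + 1 ≤ m → extendTm (Γ := Γ) ty (n + 1) (σ := ty n) v0 (m + 1) =
    (extendTm ty (n + 1) (σ := ty n) v0 m).wk := fun m hm => extendTm_succ _ _ hm
  refine ⟨extendTm ty (n + 1) v0, eventually_atTop.2 ⟨n + 1, hd⟩, ?_⟩
  refine eventually_atTop.2 ⟨n + 1, fun m hm => ?_⟩
  induction m, hm using Nat.le_induction with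
  | base =>
      beta_reduce
      rw [extendTm_self, (hN n hn).1]
      refine .hyp (Or.inr ?_)
      -- The existential formula is already derivable at stage `n`, hence consistent with it, hence
      -- taken in.
      have hin : task n ∈ decideSet (henkinSet ty S task n) (task n) := by
        refine Or.inr ⟨rfl, fun hb => henkinSet_consistent hS n (PL.cut ?_ hb)⟩
        rw [htn]
        exact (hN n hn).2
      refine ⟨?_, hin⟩
      rw [htn]
      exact congrArg _ (Fm.subst_lift_inst_v0 _)
  | succ m hm ih =>
      have h₁ := henkinSet_wk ih
      rw [Fm.wk, Fm.inst_subst, ← Tm.wk_eq_subst] at h₁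
      beta_reduce
      rw [hd m hm, (hN m (by omega)).1]
      exact h₁

/-! ### The term model and the truth lemma -/

/-- The term model of the Henkin construction: its elements are the sequences of terms that are
eventually the weakenings of each other. -/
def termModel (ty : ℕ → Ty) (S : Set (Fm Γ)) (task : ∀ n, Fm (lev Γ ty n)) : Model where
  D σ := {d : ∀ n, Tm (lev Γ ty n) σ // ∀ᶠ n in atTop, d (n + 1) = (d n).wk}
  app f a := ⟨fun n => Tm.app (f.1 n) (a.1 n), by
    filter_upwards [f.2, a.2] with n h₁ h₂
    rw [h₁, h₂]
    rfl⟩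
  con c := ⟨fun _ => Tm.con c, Eventually.of_forall fun _ => rfl⟩
  eq a b := Accepts ty S task fun n => Fm.eq (a.1 n) (b.1 n)

/-- The substitutions that make up an assignment in the term model. -/
def Env.level {Δ : List Ty} (ρ : Env (termModel ty S task) Δ) (n : ℕ) : Sub Δ (lev Γ ty n) :=
  fun σ v => (ρ σ v).1 n

theorem Env.level_coherent {Δ : List Ty} (ρ : Env (termModel ty S task) Δ) :
    ∀ᶠ n in atTop, ∀ σ v, ρ.level (n + 1) σ v = (ρ.level n σ v).wk := by
  induction Δ with
  | nil => exact Eventually.of_forall fun n σ v => nomatch v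
  | cons τ Δ ih =>
      filter_upwards [ih fun σ v => ρ σ (Var.s v), (ρ τ Var.z).2] with n h₁ h₂ σ v
      cases v with
      | z => exact h₂
      | s v => exact h₁ σ v

theorem Env.level_subst {Δ : List Ty} (ρ : Env (termModel ty S task) Δ) :
    ∀ᶠ n in atTop, ρ.level (n + 1) =
      fun σ v => (ρ.level n σ v).subst fun _ v => Tm.var (Var.s v) := by
  filter_upwards [ρ.level_coherent] with n hn
  funext σ v
  rw [hn, Tm.wk_eq_subst]

theorem coherent_subst {Δ : List Ty} (ρ : Env (termModel ty S task) Δ) (φ : Fm Δ) :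
    Coherent ty fun n => φ.subst (ρ.level n) := by
  filter_upwards [ρ.level_subst] with n hn
  rw [hn, Fm.wk, Fm.subst_subst]

theorem termModel_eval {Δ : List Ty} (ρ : Env (termModel ty S task) Δ) {σ : Ty} (t : Tm Δ σ)
    (n : ℕ) : (t.eval ρ).1 n = t.subst (ρ.level n) := by
  induction t with
  | var v => rfl
  | con c => rfl
  | app t u iht ihu =>
      rw [Tm.subst, ← iht, ← ihu]
      rfl

theorem Env.level_cons {Δ : List Ty} (ρ : Env (termModel ty S task) Δ) {σ : Ty}
    (d : (termModel ty S task).D σ) (n : ℕ) :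
    (Env.cons d ρ).level n = Sub.cons (d.1 n) (ρ.level n) := by
  funext τ v
  cases v <;> rfl

theorem accepts_congr {F G : ∀ n, Fm (lev Γ ty n)}
    (h : ∀ n, PL (henkinSet ty S task n) (F n) → PL (henkinSet ty S task n) (G n))
    (hF : Accepts ty S task F) : Accepts ty S task G :=
  hF.mono h

/-- The truth lemma. Disjunction and implication use that every coherent sequence or its negation is
accepted; the existential case uses the witnesses, and the universal case reduces to it by
`PL.neg_all`. -/
theorem termModel_sat (hS : ¬ PL S Fm.bot) (ht : Exhaustive ty task) {Δ : List Ty}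
    (φ : Fm Δ) : ∀ ρ : Env (termModel ty S task) Δ,
      Sat ρ φ ↔ Accepts ty S task fun n => φ.subst (ρ.level n) := by
  induction φ with
  | eq t u =>
      intro ρ
      simp only [Sat, termModel, Fm.subst]
      exact iff_of_eq (congrArg _ (funext fun n => by rw [← termModel_eval, ← termModel_eval]; rfl))
  | and φ ψ h₁ h₂ =>
      intro ρ
      rw [Sat, h₁, h₂]
      exact ⟨fun h => by filter_upwards [h.1, h.2] with n h₁ h₂ using .andI h₁ h₂,
        fun h => ⟨accepts_congr (fun n => .andL) h, accepts_congr (fun n => .andR) h⟩⟩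
  | or φ ψ h₁ h₂ =>
      intro ρ
      rw [Sat, h₁, h₂]
      refine ⟨fun h => h.elim (accepts_congr fun n => .orL) (accepts_congr fun n => .orR),
        fun h => ?_⟩
      by_contra hcon
      rw [not_or] at hcon
      have n₁ := accepts_neg ht (coherent_subst ρ φ) hcon.1
      have n₂ := accepts_neg ht (coherent_subst ρ ψ) hcon.2
      obtain ⟨n, h, n₁, n₂⟩ := (h.and (n₁.and n₂)).exists
      exact henkinSet_consistent hS n (.orE h (.impE n₁.weaken (PL.insert_hyp _ _))
        (.impE n₂.weaken (PL.insert_hyp _ _)))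
  | imp φ ψ h₁ h₂ =>
      intro ρ
      rw [Sat, h₁, h₂]
      refine ⟨fun h => ?_, fun h h' => by filter_upwards [h, h'] with n h₁ h₂ using .impE h₁ h₂⟩
      by_cases hφ : Accepts ty S task fun n => φ.subst (ρ.level n)
      · exact accepts_congr (fun n h => .impI h.weaken) (h hφ)
      · exact accepts_congr (fun n h => .impI (PL.botE (.impE h.weaken (PL.insert_hyp _ _))))
          (accepts_neg ht (coherent_subst ρ φ) hφ)
  | all σ φ ih =>
      intro ρ
      have key : ∀ (n : ℕ) (d : (termModel ty S task).D σ),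
          (φ.subst ((ρ.level n).lift σ)).inst (d.1 n) = φ.subst ((Env.cons d ρ).level n) :=
        fun n d => by rw [Fm.lift_subst_inst, Env.level_cons]
      simp only [Sat, ih, Fm.subst]
      refine ⟨fun h => ?_, fun h d => accepts_congr (fun n h => key n d ▸ .allE (d.1 n) h) h⟩
      by_contra hcon
      have h' := accepts_neg ht (coherent_subst ρ (Fm.all σ φ)) hcon
      obtain ⟨d, hd, h'⟩ := accepts_ex hS ht
        (F := fun n => (φ.subst ((ρ.level n).lift σ)).neg) (by
          filter_upwards [ρ.level_subst] with n hn
          rw [Fm.neg_subst, Fm.subst_subst, Sub.lift_comp, hn]) (accepts_congr (fun n => PL.neg_all) h')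
      refine not_accepts_neg hS (h ⟨d, hd⟩) (accepts_congr (fun n hn => ?_) h')
      exact key n ⟨d, hd⟩ ▸ hn
  | ex σ φ ih =>
      intro ρ
      have key : ∀ (n : ℕ) (d : (termModel ty S task).D σ),
          (φ.subst ((ρ.level n).lift σ)).inst (d.1 n) = φ.subst ((Env.cons d ρ).level n) :=
        fun n d => by rw [Fm.lift_subst_inst, Env.level_cons]
      simp only [Sat, ih, Fm.subst]
      refine ⟨fun ⟨d, h⟩ => accepts_congr (fun n h => .exI (d.1 n) (key n d ▸ h)) h, fun h => ?_⟩
      obtain ⟨d, hd, h'⟩ := accepts_ex hS ht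
        (F := fun n => φ.subst ((ρ.level n).lift σ)) (by
          filter_upwards [ρ.level_subst] with n hn
          rw [Fm.subst_subst, Sub.lift_comp, hn]) h
      exact ⟨⟨d, hd⟩, accepts_congr (fun n hn => key n ⟨d, hd⟩ ▸ hn) h'⟩

end Henkin

/-- Every consistent set of formulas in a context is satisfiable. -/
theorem exists_model {Γ : List Ty} {S : Set (Fm Γ)} (hS : ¬ PL S Fm.bot) :
    ∃ (M : Model) (ρ : Env M Γ), (∀ φ ∈ S, Sat ρ φ) ∧ ¬ Sat ρ Fm.bot := by
  obtain ⟨ty, task, ht⟩ := exists_tasks Γ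
  -- The free variables of `Γ` denote themselves, weakened through all levels.
  let ρ : Env (termModel ty S task) Γ := fun σ v =>
    ⟨extendTm ty 0 (Tm.var v), eventually_atTop.2 ⟨0, fun n hn => extendTm_succ _ _ hn⟩⟩
  refine ⟨termModel ty S task, ρ, fun φ hφ => (termModel_sat hS ht φ ρ).2 ?_, fun h => ?_⟩
  rotate_left
  · obtain ⟨n, hn⟩ := ((termModel_sat hS ht _ ρ).1 h).exists
    exact henkinSet_consistent hS n hn
  have h : ∀ n, φ.subst (ρ.level n) = extendFm ty 0 φ n := by
    intro n
    induction n with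
    | zero => exact (Fm.subst_id φ).trans (extendFm_self ty 0 φ).symm
    | succ n ih =>
        rw [extendFm_succ _ _ (Nat.zero_le n), ← ih, Fm.wk, Fm.subst_subst]
        congr 1
        funext σ v
        exact (extendTm_succ _ _ (Nat.zero_le n)).trans (Tm.wk_eq_subst _)
  simp only [h]
  refine eventually_atTop.2 ⟨0, fun n hn => ?_⟩
  induction n, hn using Nat.le_induction with
  | base => exact .hyp ((extendFm_self ty 0 φ).symm ▸ hφ)
  | succ n hn ih =>
      beta_reduce
      rw [extendFm_succ (m := 0) ty φ hn]
      exact henkinSet_wk ih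

/-- A formula is provable in a theory if it holds in all models of the theorems of the theory
in the same context. -/
theorem proves_of_forall_model {T : Theory} {Γ : List Ty} {φ : Fm Γ}
    (h : ∀ (M : Model) (ρ : Env M Γ), (∀ χ : Fm Γ, Proves T χ → Sat ρ χ) → ¬ Sat ρ Fm.bot →
      Sat ρ φ) :
    Proves T φ := by
  refine .raa ?_
  -- All theorems of `T`, not just its axioms, serve as assumptions: this set already accounts for
  -- the extensionality rule, which `PL` does not have.
  by_cases hS : PL (insert φ.neg {χ : Fm Γ | Proves T χ}) Fm.bot
  · obtain ⟨L, hL, d⟩ := hS.exists_derives (T := T)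
    refine d.cuts L fun χ hχ => ?_
    rcases hL χ hχ with rfl | h'
    · exact .hyp List.mem_cons_self
    · exact Derives.weaken h' (List.nil_subset _)
  · obtain ⟨M, ρ, hM, hb⟩ := exists_model hS
    have h₁ : Sat ρ φ := h M ρ (fun χ hχ => hM χ (Set.mem_insert_of_mem _ hχ)) hb
    have h₂ : Sat ρ φ.neg := hM _ (Set.mem_insert _ _)
    exact absurd (h₂ h₁) hb

end FinType

namespace FinType

/-! ### Models of the system -/

/-- A theory that contains the axioms for probability contents. -/
def ExtendsFP (T : Theory) : Prop := ∀ (Γ : List Ty) (φ : Fm Γ), FP Γ φ → T Γ φ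

/-- A model of the theorems in the context `Γ` of a theory that extends the basic system, with a
fixed assignment for `Γ`. -/
structure TModel (Γ : List Ty) where
  T : Theory
  extendsFP : ExtendsFP T
  M : Model
  base : Env M Γ
  valid : ∀ χ : Fm Γ, Proves T χ → Sat base χ
  zero_ne_one : ¬ Sat base Fm.bot

/-- The assignments that extend the fixed assignment of a model. -/
class inductive Good {Γ : List Ty} (𝔐 : TModel Γ) : {Δ : List Ty} → Env 𝔐.M Δ → Prop
  | base : Good 𝔐 𝔐.base
  | cons {Δ : List Ty} {ρ : Env 𝔐.M Δ} {σ : Ty} (a : 𝔐.M.D σ) : Good 𝔐 ρ → Good 𝔐 (Env.cons a ρ)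

instance {Γ : List Ty} (𝔐 : TModel Γ) : Good 𝔐 𝔐.base := .base

instance {Γ Δ : List Ty} (𝔐 : TModel Γ) {ρ : Env 𝔐.M Δ} {σ : Ty} (a : 𝔐.M.D σ) [h : Good 𝔐 ρ] :
    Good 𝔐 (Env.cons a ρ) := .cons a h

/-- The interpretation of equality in all types. -/
def EqM {M : Model} : {σ : Ty} → M.D σ → M.D σ → Prop
  | Ty.nat, a, b => M.eq a b
  | Ty.Om, a, b => M.eq (M.app (M.app (M.con Con.eqOm) a) b) (M.con Con.zero)
  | Ty.Ev, a, b => ∀ x : M.D Ty.Om, M.eq (M.app (M.app (M.con Con.mem) x) a) (M.con Con.zero) ↔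
      M.eq (M.app (M.app (M.con Con.mem) x) b) (M.con Con.zero)
  | Ty.fn ρ _, a, b => ∀ d : M.D ρ, EqM (M.app a d) (M.app b d)

theorem Sat_eqF {M : Model} {σ : Ty} : ∀ {Δ : List Ty} (ρ : Env M Δ) (s t : Tm Δ σ),
    Sat ρ (eqF σ s t) ↔ EqM (s.eval ρ) (t.eval ρ) := by
  induction σ with
  | nat => exact fun ρ s t => Iff.rfl
  | Om => exact fun ρ s t => Iff.rfl
  | Ev =>
      intro Δ ρ s t
      simp only [eqF, Sat, Fm.iff, memF, memT, Tm.eval, Tm.eval_wk, EqM]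
      exact forall_congr' fun x => iff_iff_implies_and_implies.symm
  | fn σ τ _ ih =>
      intro Δ ρ s t
      simp only [eqF, Sat, ih, Tm.eval, Tm.eval_wk, EqM]
      rfl

namespace TModel

variable {Γ : List Ty} (𝔐 : TModel Γ)

/-- A model is only required to satisfy theorems in the context `Γ` at `base`. Theorems without
assumptions can be generalised over the added variables, and so hold at every extension of `base`.
-/
theorem sat_of_proves {Δ : List Ty} (ρ : Env 𝔐.M Δ) [h : Good 𝔐 ρ] :
    ∀ {φ : Fm Δ}, Proves 𝔐.T φ → Sat ρ φ := by
  induction h with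
  | base => exact fun h => 𝔐.valid _ h
  | cons a _ ih => exact fun h => ih (.allI h) a

theorem sat_arith {Δ : List Ty} (ρ : Env 𝔐.M Δ) [Good 𝔐 ρ] {φ : Fm Δ} (h : Arith Δ φ) :
    Sat ρ φ :=
  𝔐.sat_of_proves ρ (.ax (𝔐.extendsFP _ _ (Or.inl (Or.inl h))))

theorem sat_content {Δ : List Ty} (ρ : Env 𝔐.M Δ) [Good 𝔐 ρ] {φ : Fm Δ} (h : Content Δ φ) :
    Sat ρ φ :=
  𝔐.sat_of_proves ρ (.ax (𝔐.extendsFP _ _ (Or.inr h)))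

theorem eq_refl (a : 𝔐.M.D Ty.nat) : 𝔐.M.eq a a :=
  𝔐.sat_arith (Env.cons a 𝔐.base) (.eqRefl v0)

theorem eq_symm {a b : 𝔐.M.D Ty.nat} : 𝔐.M.eq a b → 𝔐.M.eq b a :=
  𝔐.sat_arith (Env.cons b (Env.cons a 𝔐.base)) (.eqSymm v1 v0)

theorem eq_trans {a b c : 𝔐.M.D Ty.nat} (h₁ : 𝔐.M.eq a b) (h₂ : 𝔐.M.eq b c) : 𝔐.M.eq a c :=
  𝔐.sat_arith (Env.cons c (Env.cons b (Env.cons a 𝔐.base))) (.eqTrans v2 v1 v0) ⟨h₁, h₂⟩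

theorem eqM_trans : ∀ {σ : Ty} {a b c : 𝔐.M.D σ}, EqM a b → EqM b c → EqM a c
  | Ty.nat, _, _, _, h, h' => 𝔐.eq_trans h h'
  | Ty.Om, a, b, c, h, h' =>
      𝔐.sat_content (Env.cons c (Env.cons b (Env.cons a 𝔐.base))) (.omTrans v2 v1 v0) ⟨h, h'⟩
  | Ty.Ev, _, _, _, h, h' => fun x => (h x).trans (h' x)
  | Ty.fn _ _, _, _, _, h, h' => fun d => eqM_trans (h d) (h' d)

theorem comb_eq {δ ρ τ : Ty} (s : 𝔐.M.D (Ty.fn δ (Ty.fn ρ τ))) (t : 𝔐.M.D (Ty.fn δ ρ))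
    (u : 𝔐.M.D δ) :
    EqM (𝔐.M.app (𝔐.M.app (𝔐.M.app (𝔐.M.con (Con.comb δ ρ τ)) s) t) u)
      (𝔐.M.app (𝔐.M.app s u) (𝔐.M.app t u)) :=
  (Sat_eqF _ _ _).1
    (𝔐.sat_arith (Env.cons u (Env.cons t (Env.cons s 𝔐.base))) (.comb v2 v1 v0))

theorem proj_eq {ρ τ : Ty} (s : 𝔐.M.D ρ) (t : 𝔐.M.D τ) :
    EqM (𝔐.M.app (𝔐.M.app (𝔐.M.con (Con.proj ρ τ)) s) t) s :=
  (Sat_eqF _ _ _).1 (𝔐.sat_arith (Env.cons t (Env.cons s 𝔐.base)) (.proj v1 v0))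

/-- Extensionality for provably equal terms. -/
theorem congr_of_proves {Δ : List Ty} (ρ : Env 𝔐.M Δ) [Good 𝔐 ρ] {σ τ : Ty} {s t : Tm Δ σ}
    (h : Proves 𝔐.T (eqF σ s t)) (r : Tm (σ :: Δ) τ) :
    EqM (r.eval (Env.cons (s.eval ρ) ρ)) (r.eval (Env.cons (t.eval ρ) ρ)) := by
  -- The rule needs a quantifier-free premise; the trivial equation `0 = 0` serves as a dummy.
  have h₁ : Derives 𝔐.T [] (Fm.imp (Fm.eq zro zro) (eqF σ s t)) :=
    .impI (h.weaken (List.nil_subset _))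
  have h₂ := 𝔐.sat_of_proves ρ (.qfer (φ := Fm.eq zro zro) r trivial h₁) (𝔐.eq_refl _)
  rw [Sat_eqF, Tm.eval_subst, Tm.eval_subst, Sub.eval_cons, Sub.eval_cons] at h₂
  exact h₂

/-- Extensionality with respect to equality of numbers. -/
theorem congr_nat {Δ : List Ty} (ρ : Env 𝔐.M Δ) [Good 𝔐 ρ] {τ : Ty} (r : Tm (Ty.nat :: Δ) τ)
    {a b : 𝔐.M.D Ty.nat} (h : 𝔐.M.eq a b) :
    EqM (r.eval (Env.cons a ρ)) (r.eval (Env.cons b ρ)) := by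
  -- In type `0` the equation is itself quantifier-free and can be the premise of the rule, so it
  -- need only be true in the model, not provable.
  have h₁ : Derives 𝔐.T [] (Fm.imp (Fm.eq (Γ := Ty.nat :: Ty.nat :: Δ) v1 v0) (eqF Ty.nat v1 v0)) :=
    .impI (.hyp List.mem_cons_self)
  have h₂ := 𝔐.sat_of_proves (Env.cons b (Env.cons a ρ))
    (.qfer (φ := Fm.eq v1 v0) (r.subst (Sub.cons v0 fun _ v => Tm.var (Var.s (Var.s (Var.s v))))) trivial h₁) h
  simp only [Sat_eqF, Tm.eval_subst, Sub.eval_cons] at h₂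
  exact h₂

end TModel

theorem proves_of_forall_tmodel {T : Theory} (hT : ExtendsFP T) {Γ : List Ty} {φ : Fm Γ}
    (h : ∀ 𝔐 : TModel Γ, 𝔐.T = T → Sat 𝔐.base φ) : Proves T φ :=
  proves_of_forall_model fun M ρ hM hb => h ⟨T, hT, M, ρ, hM, hb⟩ rfl

/-- In an application, the argument is replaced inside a term, and weak extensionality allows this
only for provable equations. The induction hypothesis is therefore provability, although each step
is verified in models. -/
theorem proves_beta {T : Theory} (hT : ExtendsFP T) {Δ : List Ty} {σ τ : Ty} (t : Tm (σ :: Δ) τ) :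
    Proves T (eqF τ (Tm.app t.lam.wk v0) t) := by
  -- The context is freed from its form `σ :: Δ` so that induction on the term is possible.
  suffices h : ∀ (Ξ : List Ty) (t : Tm Ξ τ) (e : Ξ = σ :: Δ),
      Proves T (eqF τ (Tm.app (e ▸ t).lam.wk v0) (e ▸ t)) from h _ t rfl
  clear t
  intro Ξ t
  induction t with
  | var v =>
      rintro rfl
      refine proves_of_forall_tmodel hT fun 𝔐 h𝔐 => ?_
      subst h𝔐
      rw [Sat_eqF]
      cases v with
      | z => exact 𝔐.eqM_trans (𝔐.comb_eq _ _ _) (𝔐.proj_eq _ _)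
      | s v => exact 𝔐.proj_eq (τ := σ) (𝔐.base _ (Var.s v)) _
  | con c =>
      rintro rfl
      refine proves_of_forall_tmodel hT fun 𝔐 h𝔐 => ?_
      subst h𝔐
      rw [Sat_eqF]
      exact 𝔐.proj_eq _ _
  | app t u iht ihu =>
      rintro rfl
      refine proves_of_forall_tmodel hT fun 𝔐 h𝔐 => ?_
      subst h𝔐
      rw [Sat_eqF]
      have h₁ := (Sat_eqF _ _ _).1 (𝔐.valid _ (iht rfl))
      have h₂ := 𝔐.congr_of_proves 𝔐.base (ihu rfl) (Tm.app t.wk v0)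
      simp only [Tm.eval, Tm.eval_wk] at h₂
      exact 𝔐.eqM_trans (𝔐.comb_eq _ _ _) (𝔐.eqM_trans (h₁ _) h₂)

theorem TModel.eval_lam {Γ : List Ty} (𝔐 : TModel Γ) {Δ : List Ty} (ρ : Env 𝔐.M Δ) [Good 𝔐 ρ]
    {σ τ : Ty} (t : Tm (σ :: Δ) τ) (a : 𝔐.M.D σ) :
    EqM (𝔐.M.app (t.lam.eval ρ) a) (t.eval (Env.cons a ρ)) := by
  have h := (Sat_eqF _ _ _).1
    (𝔐.sat_of_proves (Env.cons a ρ) (proves_beta 𝔐.extendsFP t))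
  rw [Tm.eval, Tm.eval_wk] at h
  exact h

end FinType

namespace FinType

/-! ### The numbers of a model -/

infixr:67 "▹" => Env.cons

namespace TModel

variable {Γ : List Ty} (𝔐 : TModel Γ)

/-- The model interprets equations by an equivalence relation rather than by identity, so the
numbers have to be taken modulo it. -/
instance numSetoid : Setoid (𝔐.M.D Ty.nat) where
  r := 𝔐.M.eq
  iseqv := ⟨𝔐.eq_refl, 𝔐.eq_symm, 𝔐.eq_trans⟩

/-- The numbers of a model, up to equality in the sense of the model. -/
def Num : Type := Quotient 𝔐.numSetoid

def num (a : 𝔐.M.D Ty.nat) : 𝔐.Num := Quotient.mk _ a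

variable {𝔐}

theorem num_eq {a b : 𝔐.M.D Ty.nat} : 𝔐.num a = 𝔐.num b ↔ 𝔐.M.eq a b := Quotient.eq

theorem exists_num (n : 𝔐.Num) : ∃ a, 𝔐.num a = n := Quotient.exists_rep n

theorem num_out (n : 𝔐.Num) : 𝔐.num (Quotient.out n) = n := Quotient.out_eq n

variable {Δ Δ' : List Ty}

/-- The number denoted by a term. -/
def nev (ρ : Env 𝔐.M Δ) (t : Tm Δ Ty.nat) : 𝔐.Num := 𝔐.num (t.eval ρ)

theorem nev_wk (ρ : Env 𝔐.M Δ) {σ : Ty} (a : 𝔐.M.D σ) (t : Tm Δ Ty.nat) :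
    nev (a ▹ ρ) t.wk = nev ρ t := by
  rw [nev, Tm.eval_wk, nev]

theorem nev_v0 (ρ : Env 𝔐.M Δ) (a : 𝔐.M.D Ty.nat) : nev (a ▹ ρ) v0 = 𝔐.num a := rfl

theorem nev_v1 (ρ : Env 𝔐.M Δ) (a : 𝔐.M.D Ty.nat) {σ : Ty} (b : 𝔐.M.D σ) :
    nev (b ▹ a ▹ ρ) v1 = 𝔐.num a := rfl

theorem nev_v2 (ρ : Env 𝔐.M Δ) (a : 𝔐.M.D Ty.nat) {σ τ : Ty} (b : 𝔐.M.D σ) (c : 𝔐.M.D τ) :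
    nev (c ▹ b ▹ a ▹ ρ) v2 = 𝔐.num a := rfl

theorem sat_eq (ρ : Env 𝔐.M Δ) (s t : Tm Δ Ty.nat) : Sat ρ (Fm.eq s t) ↔ nev ρ s = nev ρ t :=
  num_eq.symm

theorem num_app_congr (f : 𝔐.M.D one) {a b : 𝔐.M.D Ty.nat} (h : 𝔐.num a = 𝔐.num b) :
    𝔐.num (𝔐.M.app f a) = 𝔐.num (𝔐.M.app f b) :=
  num_eq.2 (𝔐.congr_nat (f ▹ 𝔐.base) (Tm.app v1 v0) (num_eq.1 h))

instance : Zero 𝔐.Num := ⟨𝔐.num (𝔐.M.con Con.zero)⟩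

noncomputable def succ (n : 𝔐.Num) : 𝔐.Num := 𝔐.num (𝔐.M.app (𝔐.M.con Con.succ) n.out)

theorem nev_zro (ρ : Env 𝔐.M Δ) : nev ρ zro = 0 := rfl

theorem num_succ (a : 𝔐.M.D Ty.nat) : 𝔐.num (𝔐.M.app (𝔐.M.con Con.succ) a) = succ (𝔐.num a) :=
  num_app_congr _ (num_out _).symm

theorem nev_suc (ρ : Env 𝔐.M Δ) (t : Tm Δ Ty.nat) : nev ρ (suc t) = succ (nev ρ t) :=
  num_succ _

theorem succ_ne_zero (n : 𝔐.Num) : succ n ≠ 0 := by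
  obtain ⟨a, rfl⟩ := exists_num n
  rw [← num_succ]
  intro h
  exact 𝔐.zero_ne_one (𝔐.sat_arith (a ▹ 𝔐.base) (.succNe v0) (num_eq.1 h))

theorem succ_injective {m n : 𝔐.Num} (h : succ m = succ n) : m = n := by
  obtain ⟨a, rfl⟩ := exists_num m
  obtain ⟨b, rfl⟩ := exists_num n
  rw [← num_succ, ← num_succ] at h
  exact num_eq.2 (𝔐.sat_arith (b ▹ a ▹ 𝔐.base) (.succInj v1 v0) (num_eq.1 h))

/-- The numbers may be nonstandard, so induction is available only for properties expressed by a
formula, with parameters from the assignment. -/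
theorem sat_induct (ρ : Env 𝔐.M Δ) [Good 𝔐 ρ] (φ : Fm (Ty.nat :: Δ))
    (h0 : Sat (𝔐.M.con Con.zero ▹ ρ) φ)
    (hs : ∀ x, Sat (x ▹ ρ) φ → Sat (𝔐.M.app (𝔐.M.con Con.succ) x ▹ ρ) φ) (x : 𝔐.M.D Ty.nat) :
    Sat (x ▹ ρ) φ := by
  refine 𝔐.sat_arith ρ (.ind φ) ⟨?_, fun x hx => ?_⟩ x
  · rw [Sat_inst]
    exact h0
  · rw [Sat_subst, Sub.eval_cons]
    exact hs x hx

/-- Induction for definable properties of numbers. -/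
theorem num_induct (ρ : Env 𝔐.M Δ) [Good 𝔐 ρ] (φ : Fm (Ty.nat :: Δ)) {P : 𝔐.Num → Prop}
    (hP : ∀ x, Sat (x ▹ ρ) φ ↔ P (𝔐.num x)) (h0 : P 0) (hs : ∀ n, P n → P (succ n)) (n : 𝔐.Num) :
    P n := by
  obtain ⟨a, rfl⟩ := exists_num n
  refine (hP a).1 (sat_induct ρ φ ((hP _).2 h0) (fun x hx => (hP _).2 ?_) a)
  rw [num_succ]
  exact hs _ ((hP x).1 hx)

/-! ### Primitive recursion -/

theorem num_lam (ρ : Env 𝔐.M Δ) [Good 𝔐 ρ] (t : Tm (Ty.nat :: Δ) Ty.nat) (a : 𝔐.M.D Ty.nat) :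
    𝔐.num (𝔐.M.app (t.lam.eval ρ) a) = nev (a ▹ ρ) t :=
  num_eq.2 (𝔐.eval_lam ρ t a)

theorem num_lam_lam (ρ : Env 𝔐.M Δ) [Good 𝔐 ρ] (t : Tm (Ty.nat :: Ty.nat :: Δ) Ty.nat)
    (a b : 𝔐.M.D Ty.nat) :
    𝔐.num (𝔐.M.app (𝔐.M.app (t.lam.lam.eval ρ) a) b) = nev (b ▹ a ▹ ρ) t :=
  num_eq.2 (𝔐.eqM_trans (𝔐.eval_lam ρ t.lam a b) (𝔐.eval_lam (a ▹ ρ) t b))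

theorem num_lam_lam_lam (ρ : Env 𝔐.M Δ) [Good 𝔐 ρ]
    (t : Tm (Ty.nat :: Ty.nat :: Ty.nat :: Δ) Ty.nat) (a b c : 𝔐.M.D Ty.nat) :
    𝔐.num (𝔐.M.app (𝔐.M.app (𝔐.M.app (t.lam.lam.lam.eval ρ) a) b) c) =
      nev (c ▹ b ▹ a ▹ ρ) t :=
  num_eq.2 (𝔐.eqM_trans (𝔐.eval_lam ρ t.lam.lam a b c)
    (𝔐.eqM_trans (𝔐.eval_lam (a ▹ ρ) t.lam b c) (𝔐.eval_lam (b ▹ a ▹ ρ) t c)))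

theorem num_rec_zero (a : 𝔐.M.D Ty.nat) (f : 𝔐.M.D (Ty.fn Ty.nat one)) :
    𝔐.num (𝔐.M.app (𝔐.M.app (𝔐.M.app (𝔐.M.con (Con.recursor [Ty.nat] Var.z))
      (𝔐.M.con Con.zero)) a) f) = 𝔐.num a :=
  num_eq.2 ((Sat_eqF _ _ _).1 (𝔐.sat_arith (f ▹ a ▹ 𝔐.base) (.recZero [Ty.nat] Var.z
    (Sub.cons v1 fun _ v => nomatch v) (Sub.cons v0 fun _ v => nomatch v))))

theorem num_rec_succ (a : 𝔐.M.D Ty.nat) (f : 𝔐.M.D (Ty.fn Ty.nat one)) (x : 𝔐.M.D Ty.nat) :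
    𝔐.num (𝔐.M.app (𝔐.M.app (𝔐.M.app (𝔐.M.con (Con.recursor [Ty.nat] Var.z))
      (𝔐.M.app (𝔐.M.con Con.succ) x)) a) f) =
    𝔐.num (𝔐.M.app (𝔐.M.app f (𝔐.M.app (𝔐.M.app (𝔐.M.app
      (𝔐.M.con (Con.recursor [Ty.nat] Var.z)) x) a) f)) x) :=
  num_eq.2 ((Sat_eqF _ _ _).1 (𝔐.sat_arith (x ▹ f ▹ a ▹ 𝔐.base) (.recSucc [Ty.nat] Var.z v0
    (Sub.cons v2 fun _ v => nomatch v) (Sub.cons v1 fun _ v => nomatch v))))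

theorem natRec_zro (ρ : Env 𝔐.M Δ) (a : Tm Δ Ty.nat)
    (b : Tm (Ty.nat :: Ty.nat :: Δ) Ty.nat) : nev ρ (natRec a b zro) = nev ρ a :=
  num_rec_zero _ _

theorem natRec_suc (ρ : Env 𝔐.M Δ) [Good 𝔐 ρ] (a : Tm Δ Ty.nat)
    (b : Tm (Ty.nat :: Ty.nat :: Δ) Ty.nat) (n : Tm Δ Ty.nat) :
    nev ρ (natRec a b (suc n)) = nev (n.eval ρ ▹ (natRec a b n).eval ρ ▹ ρ) b :=
  (num_rec_succ _ _ _).trans (num_lam_lam _ _ _ _)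

/-- The value of a primitive recursion depends only on the values of its data. -/
theorem natRec_congr {ρ : Env 𝔐.M Δ} [Good 𝔐 ρ] {ρ' : Env 𝔐.M Δ'} [Good 𝔐 ρ']
    {a : Tm Δ Ty.nat} {a' : Tm Δ' Ty.nat} {b : Tm (Ty.nat :: Ty.nat :: Δ) Ty.nat}
    {b' : Tm (Ty.nat :: Ty.nat :: Δ') Ty.nat} {n : Tm Δ Ty.nat} {n' : Tm Δ' Ty.nat}
    (ha : nev ρ a = nev ρ' a')
    (hb : ∀ x x' y y', 𝔐.num x = 𝔐.num x' → 𝔐.num y = 𝔐.num y' →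
      nev (y ▹ x ▹ ρ) b = nev (y' ▹ x' ▹ ρ') b') (hn : nev ρ n = nev ρ' n') :
    nev ρ (natRec a b n) = nev ρ' (natRec a' b' n') := by
  -- Weak extensionality does not permit exchanging step functions that merely agree in the model.
  -- Both sets of data become parameters, and the agreement of the two recursions is proved by
  -- induction on the counter inside the model.
  let E := a.eval ρ ▹ b.lam.lam.eval ρ ▹ a'.eval ρ' ▹ b'.lam.lam.eval ρ' ▹ 𝔐.base
  let G : Tm (Ty.nat :: Ty.nat :: Ty.fn Ty.nat one :: Ty.nat :: Ty.fn Ty.nat one :: Γ) Ty.nat :=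
    Tm.app (Tm.app (Tm.app (Tm.con (Con.recursor [Ty.nat] Var.z)) v0) v1) v2
  let G' : Tm (Ty.nat :: Ty.nat :: Ty.fn Ty.nat one :: Ty.nat :: Ty.fn Ty.nat one :: Γ) Ty.nat :=
    Tm.app (Tm.app (Tm.app (Tm.con (Con.recursor [Ty.nat] Var.z)) v0)
      (Tm.var (Var.s (Var.s (Var.s Var.z))))) (Tm.var (Var.s (Var.s (Var.s (Var.s Var.z)))))
  have key : ∀ x, Sat (x ▹ E) (Fm.eq G G') := by
    refine sat_induct E _ ?_ fun x hx => ?_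
    · exact num_eq.1 ((num_rec_zero _ _).trans (ha.trans (num_rec_zero _ _).symm))
    · refine num_eq.1 ((num_rec_succ _ _ _).trans (Eq.trans ?_ (num_rec_succ _ _ _).symm))
      exact (num_lam_lam _ _ _ _).trans
        ((hb _ _ _ _ (num_eq.2 hx) rfl).trans (num_lam_lam _ _ _ _).symm)
  exact (num_eq.2 (key (n.eval ρ))).trans (num_eq.2 (𝔐.congr_nat E G' (num_eq.1 hn)))

/-! ### The arithmetical operations -/

/-- This operation, like those that follow, evaluates its term at chosen representatives. The
accompanying `nev_` lemma, through `natRec_congr`, makes the result independent of the choice and of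
the assignment. -/
noncomputable def pred (n : 𝔐.Num) : 𝔐.Num := nev (n.out ▹ 𝔐.base) (predT v0)

theorem nev_predT (ρ : Env 𝔐.M Δ) [Good 𝔐 ρ] (n : Tm Δ Ty.nat) :
    nev ρ (predT n) = pred (nev ρ n) :=
  natRec_congr rfl (fun _ _ _ _ _ h => h) (num_out _).symm

noncomputable instance : Add 𝔐.Num := ⟨fun m n => nev (m.out ▹ n.out ▹ 𝔐.base) (addT v0 v1)⟩

theorem nev_addT (ρ : Env 𝔐.M Δ) [Good 𝔐 ρ] (m n : Tm Δ Ty.nat) :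
    nev ρ (addT m n) = nev ρ m + nev ρ n :=
  natRec_congr (num_out _).symm
    (fun _ _ _ _ h _ => by rw [nev_suc, nev_suc, nev_v1, nev_v1, h]) (num_out _).symm

noncomputable instance : _root_.Sub 𝔐.Num := ⟨fun m n => nev (m.out ▹ n.out ▹ 𝔐.base) (subT v0 v1)⟩

theorem nev_subT (ρ : Env 𝔐.M Δ) [Good 𝔐 ρ] (m n : Tm Δ Ty.nat) :
    nev ρ (subT m n) = nev ρ m - nev ρ n :=
  natRec_congr (num_out _).symm
    (fun _ _ _ _ h _ => by rw [nev_predT, nev_predT, nev_v1, nev_v1, h]) (num_out _).symm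

noncomputable instance : Mul 𝔐.Num := ⟨fun m n => nev (m.out ▹ n.out ▹ 𝔐.base) (mulT v0 v1)⟩

theorem nev_mulT (ρ : Env 𝔐.M Δ) [Good 𝔐 ρ] (m n : Tm Δ Ty.nat) :
    nev ρ (mulT m n) = nev ρ m * nev ρ n :=
  natRec_congr rfl
    (fun _ _ _ _ h _ => by
      rw [nev_addT, nev_addT, nev_v1, nev_v1, h, nev_wk, nev_wk, nev_wk, nev_wk, nev_v0, num_out])
    (num_out _).symm

noncomputable def pow2 (n : 𝔐.Num) : 𝔐.Num := nev (n.out ▹ 𝔐.base) (powT v0)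

theorem nev_powT (ρ : Env 𝔐.M Δ) [Good 𝔐 ρ] (n : Tm Δ Ty.nat) :
    nev ρ (powT n) = pow2 (nev ρ n) :=
  natRec_congr rfl (fun _ _ _ _ h _ => by rw [nev_addT, nev_addT, nev_v1, nev_v1, h])
    (num_out _).symm

noncomputable def tri (n : 𝔐.Num) : 𝔐.Num := nev (n.out ▹ 𝔐.base) (triT v0)

theorem nev_triT (ρ : Env 𝔐.M Δ) [Good 𝔐 ρ] (n : Tm Δ Ty.nat) :
    nev ρ (triT n) = tri (nev ρ n) :=
  natRec_congr rfl
    (fun _ _ _ _ h h' => by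
      rw [nev_addT, nev_addT, nev_v1, nev_v1, h, nev_suc, nev_suc, nev_v0, nev_v0, h'])
    (num_out _).symm

noncomputable def cond (c a b : 𝔐.Num) : 𝔐.Num :=
  nev (c.out ▹ a.out ▹ b.out ▹ 𝔐.base) (condT v0 v1 v2)

theorem nev_condT (ρ : Env 𝔐.M Δ) [Good 𝔐 ρ] (c a b : Tm Δ Ty.nat) :
    nev ρ (condT c a b) = cond (nev ρ c) (nev ρ a) (nev ρ b) :=
  natRec_congr (num_out _).symm
    (fun _ _ _ _ _ _ => by rw [nev_wk, nev_wk, nev_wk, nev_wk]; exact (num_out _).symm)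
    (num_out _).symm

/-! ### Recursion equations -/

theorem pred_zero : pred (0 : 𝔐.Num) = 0 := by
  rw [← nev_zro 𝔐.base, ← nev_predT]
  exact natRec_zro _ _ _

theorem pred_succ (n : 𝔐.Num) : pred (succ n) = n := by
  obtain ⟨a, rfl⟩ := exists_num n
  rw [← nev_v0 𝔐.base a, ← nev_suc, ← nev_predT]
  exact natRec_suc _ _ _ _

theorem num_add_zero (m : 𝔐.Num) : m + 0 = m := by
  obtain ⟨a, rfl⟩ := exists_num m
  rw [← nev_v0 𝔐.base a, ← nev_zro (a ▹ 𝔐.base), ← nev_addT]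
  exact natRec_zro _ _ _

theorem add_succ (m n : 𝔐.Num) : m + succ n = succ (m + n) := by
  obtain ⟨a, rfl⟩ := exists_num m
  obtain ⟨b, rfl⟩ := exists_num n
  rw [← nev_v0 (b ▹ 𝔐.base) a, ← nev_v1 𝔐.base b a, ← nev_suc, ← nev_addT, ← nev_addT]
  exact (natRec_suc _ _ _ _).trans (nev_suc _ _)

theorem num_sub_zero (m : 𝔐.Num) : m - 0 = m := by
  obtain ⟨a, rfl⟩ := exists_num m
  rw [← nev_v0 𝔐.base a, ← nev_zro (a ▹ 𝔐.base), ← nev_subT]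
  exact natRec_zro _ _ _

theorem sub_succ (m n : 𝔐.Num) : m - succ n = pred (m - n) := by
  obtain ⟨a, rfl⟩ := exists_num m
  obtain ⟨b, rfl⟩ := exists_num n
  rw [← nev_v0 (b ▹ 𝔐.base) a, ← nev_v1 𝔐.base b a, ← nev_suc, ← nev_subT, ← nev_subT]
  exact (natRec_suc _ _ _ _).trans (nev_predT _ _)

theorem num_mul_zero (m : 𝔐.Num) : m * 0 = 0 := by
  obtain ⟨a, rfl⟩ := exists_num m
  rw [← nev_v0 𝔐.base a, ← nev_zro (a ▹ 𝔐.base), ← nev_mulT]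
  exact natRec_zro _ _ _

theorem mul_succ (m n : 𝔐.Num) : m * succ n = m * n + m := by
  obtain ⟨a, rfl⟩ := exists_num m
  obtain ⟨b, rfl⟩ := exists_num n
  rw [← nev_v0 (b ▹ 𝔐.base) a, ← nev_v1 𝔐.base b a, ← nev_suc, ← nev_mulT, ← nev_mulT]
  refine (natRec_suc _ _ _ _).trans ((nev_addT _ _ _).trans ?_)
  rw [nev_wk, nev_wk]
  rfl

theorem pow2_zero : pow2 (0 : 𝔐.Num) = succ 0 := by
  rw [← nev_zro 𝔐.base, ← nev_powT, ← nev_suc]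
  exact natRec_zro _ _ _

theorem pow2_succ (n : 𝔐.Num) : pow2 (succ n) = pow2 n + pow2 n := by
  obtain ⟨a, rfl⟩ := exists_num n
  rw [← nev_v0 𝔐.base a, ← nev_suc, ← nev_powT, ← nev_powT]
  exact (natRec_suc _ _ _ _).trans (nev_addT _ _ _)

theorem tri_zero : tri (0 : 𝔐.Num) = 0 := by
  rw [← nev_zro 𝔐.base, ← nev_triT]
  exact natRec_zro _ _ _

theorem tri_succ (n : 𝔐.Num) : tri (succ n) = tri n + succ n := by
  obtain ⟨a, rfl⟩ := exists_num n
  rw [← nev_v0 𝔐.base a, ← nev_suc, ← nev_triT, ← nev_triT]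
  refine (natRec_suc _ _ _ _).trans ((nev_addT _ _ _).trans ?_)
  rw [nev_suc, nev_suc]
  rfl

theorem cond_zero (a b : 𝔐.Num) : cond 0 a b = a := by
  obtain ⟨a, rfl⟩ := exists_num a
  obtain ⟨b, rfl⟩ := exists_num b
  rw [← nev_v0 (b ▹ 𝔐.base) a, ← nev_v1 𝔐.base b a, ← nev_zro (a ▹ b ▹ 𝔐.base), ← nev_condT]
  exact natRec_zro _ _ _

theorem cond_succ (c a b : 𝔐.Num) : cond (succ c) a b = b := by
  obtain ⟨a, rfl⟩ := exists_num a
  obtain ⟨b, rfl⟩ := exists_num b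
  obtain ⟨c, rfl⟩ := exists_num c
  rw [← nev_v0 (b ▹ c ▹ 𝔐.base) a, ← nev_v1 (c ▹ 𝔐.base) b a, ← nev_v2 𝔐.base c b a, ← nev_suc,
    ← nev_condT]
  refine (natRec_suc _ _ _ _).trans ?_
  rw [nev_wk, nev_wk]

end TModel

end FinType

namespace FinType
namespace TModel

variable {Γ Δ : List Ty} {𝔐 : TModel Γ}

/-! ### The ordered semiring of numbers -/

theorem nev_var_z (ρ : Env 𝔐.M Δ) (a : 𝔐.M.D Ty.nat) : nev (a ▹ ρ) (Tm.var Var.z) = 𝔐.num a := rfl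

theorem nev_var_s (ρ : Env 𝔐.M Δ) {σ : Ty} (a : 𝔐.M.D σ) (v : Var Δ Ty.nat) :
    nev (a ▹ ρ) (Tm.var (Var.s v)) = nev ρ (Tm.var v) := rfl

theorem sat_and (ρ : Env 𝔐.M Δ) (φ ψ : Fm Δ) : Sat ρ (Fm.and φ ψ) ↔ Sat ρ φ ∧ Sat ρ ψ := Iff.rfl

theorem sat_or (ρ : Env 𝔐.M Δ) (φ ψ : Fm Δ) : Sat ρ (Fm.or φ ψ) ↔ Sat ρ φ ∨ Sat ρ ψ := Iff.rfl

theorem sat_imp (ρ : Env 𝔐.M Δ) (φ ψ : Fm Δ) : Sat ρ (Fm.imp φ ψ) ↔ (Sat ρ φ → Sat ρ ψ) := Iff.rfl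

attribute [local simp] sat_eq sat_and sat_or sat_imp nev_var_z nev_var_s nev_wk nev_zro nev_suc nev_addT nev_mulT nev_subT
  nev_predT nev_triT nev_powT nev_condT pred_zero pred_succ num_add_zero add_succ num_sub_zero
  sub_succ num_mul_zero mul_succ succ_ne_zero

noncomputable instance : One 𝔐.Num := ⟨succ 0⟩

theorem succ_zero : succ (0 : 𝔐.Num) = 1 := rfl

theorem num_zero_add (n : 𝔐.Num) : 0 + n = n :=
  num_induct 𝔐.base (Fm.eq (addT zro v0) v0) (P := fun n => 0 + n = n) (fun x => by simp) (by simp)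
    (fun n h => by simp [h]) n

theorem succ_add (m n : 𝔐.Num) : succ m + n = succ (m + n) := by
  obtain ⟨a, rfl⟩ := exists_num m
  exact num_induct (a ▹ 𝔐.base) (Fm.eq (addT (suc v1) v0) (suc (addT v1 v0)))
    (P := fun n => succ (𝔐.num a) + n = succ (𝔐.num a + n)) (fun x => by simp) (by simp)
    (fun n h => by simp [h]) n

theorem num_add_comm (m n : 𝔐.Num) : m + n = n + m := by
  obtain ⟨a, rfl⟩ := exists_num m
  exact num_induct (a ▹ 𝔐.base) (Fm.eq (addT v1 v0) (addT v0 v1))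
    (P := fun n => 𝔐.num a + n = n + 𝔐.num a) (fun x => by simp) (by simp [num_zero_add])
    (fun n h => by simp [h, succ_add]) n

theorem num_add_assoc (k m n : 𝔐.Num) : k + m + n = k + (m + n) := by
  obtain ⟨a, rfl⟩ := exists_num k
  obtain ⟨b, rfl⟩ := exists_num m
  exact num_induct (a ▹ b ▹ 𝔐.base) (Fm.eq (addT (addT v1 v2) v0) (addT v1 (addT v2 v0)))
    (P := fun n => 𝔐.num a + 𝔐.num b + n = 𝔐.num a + (𝔐.num b + n)) (fun x => by simp) (by simp)
    (fun n h => by simp [h]) n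

noncomputable instance : AddCommMonoid 𝔐.Num where
  add_assoc := num_add_assoc
  zero_add := num_zero_add
  add_zero := num_add_zero
  add_comm := num_add_comm
  nsmul := nsmulRec

theorem succ_eq_add_one (n : 𝔐.Num) : succ n = n + 1 := by
  rw [← succ_zero, add_succ, num_add_zero]

theorem num_zero_mul (n : 𝔐.Num) : 0 * n = 0 :=
  num_induct 𝔐.base (Fm.eq (mulT zro v0) zro) (P := fun n => 0 * n = 0) (fun x => by simp)
    (by simp) (fun n h => by simp [h]) n

theorem succ_mul (m n : 𝔐.Num) : succ m * n = m * n + n := by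
  obtain ⟨a, rfl⟩ := exists_num m
  exact num_induct (a ▹ 𝔐.base) (Fm.eq (mulT (suc v1) v0) (addT (mulT v1 v0) v0))
    (P := fun n => succ (𝔐.num a) * n = 𝔐.num a * n + n) (fun x => by simp) (by simp)
    (fun n h => by simp [h, add_right_comm]) n

theorem num_mul_comm (m n : 𝔐.Num) : m * n = n * m := by
  obtain ⟨a, rfl⟩ := exists_num m
  exact num_induct (a ▹ 𝔐.base) (Fm.eq (mulT v1 v0) (mulT v0 v1))
    (P := fun n => 𝔐.num a * n = n * 𝔐.num a) (fun x => by simp) (by simp [num_zero_mul])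
    (fun n h => by simp [h, succ_mul]) n

theorem num_mul_add (k m n : 𝔐.Num) : k * (m + n) = k * m + k * n := by
  obtain ⟨a, rfl⟩ := exists_num k
  obtain ⟨b, rfl⟩ := exists_num m
  exact num_induct (a ▹ b ▹ 𝔐.base)
    (Fm.eq (mulT v1 (addT v2 v0)) (addT (mulT v1 v2) (mulT v1 v0)))
    (P := fun n => 𝔐.num a * (𝔐.num b + n) = 𝔐.num a * 𝔐.num b + 𝔐.num a * n) (fun x => by simp)
    (by simp) (fun n h => by simp [h, add_assoc]) n

theorem num_mul_assoc (k m n : 𝔐.Num) : k * m * n = k * (m * n) := by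
  obtain ⟨a, rfl⟩ := exists_num k
  obtain ⟨b, rfl⟩ := exists_num m
  exact num_induct (a ▹ b ▹ 𝔐.base) (Fm.eq (mulT (mulT v1 v2) v0) (mulT v1 (mulT v2 v0)))
    (P := fun n => 𝔐.num a * 𝔐.num b * n = 𝔐.num a * (𝔐.num b * n)) (fun x => by simp) (by simp)
    (fun n h => by simp [h, num_mul_add]) n

theorem num_one_mul (n : 𝔐.Num) : 1 * n = n := by
  rw [← succ_zero, succ_mul, num_zero_mul, num_zero_add]

noncomputable instance : CommSemiring 𝔐.Num where
  mul_assoc := num_mul_assoc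
  mul_comm := num_mul_comm
  zero_mul := num_zero_mul
  mul_zero := num_mul_zero
  left_distrib := num_mul_add
  right_distrib := fun k m n => by
    rw [num_mul_comm, num_mul_add, num_mul_comm n k, num_mul_comm n m]
  one_mul := num_one_mul
  mul_one := fun n => by rw [num_mul_comm, num_one_mul]

theorem zero_or_succ (n : 𝔐.Num) : n = 0 ∨ ∃ m, n = succ m := by
  have h := num_induct 𝔐.base (Fm.or (Fm.eq v0 zro) (Fm.eq v0 (suc (predT v0))))
    (P := fun n => n = 0 ∨ n = succ (pred n)) (fun x => by simp) (by simp) (by simp) n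
  exact h.imp_right fun h => ⟨_, h⟩

theorem num_add_right_cancel {m n k : 𝔐.Num} : m + k = n + k → m = n := by
  obtain ⟨a, rfl⟩ := exists_num m
  obtain ⟨b, rfl⟩ := exists_num n
  exact num_induct (a ▹ b ▹ 𝔐.base) (Fm.imp (Fm.eq (addT v1 v0) (addT v2 v0)) (Fm.eq v1 v2))
    (P := fun k => 𝔐.num a + k = 𝔐.num b + k → 𝔐.num a = 𝔐.num b) (fun x => by simp)
    (by simp) (fun k h h' => h (succ_injective (by simpa using h'))) k

theorem num_add_left_cancel {m n k : 𝔐.Num} (h : k + m = k + n) : m = n :=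
  num_add_right_cancel (k := k) (by rw [add_comm m, add_comm n, h])

theorem succ_sub_succ (m n : 𝔐.Num) : succ m - succ n = m - n := by
  obtain ⟨a, rfl⟩ := exists_num m
  exact num_induct (a ▹ 𝔐.base) (Fm.eq (subT (suc v1) (suc v0)) (subT v1 v0))
    (P := fun n => succ (𝔐.num a) - succ n = 𝔐.num a - n) (fun x => by simp [-sub_succ])
    (by simp) (fun n h => by rw [sub_succ, h, sub_succ]) n

theorem add_sub_self (m n : 𝔐.Num) : m + n - m = n := by
  obtain ⟨b, rfl⟩ := exists_num n
  exact num_induct (b ▹ 𝔐.base) (Fm.eq (subT (addT v0 v1) v0) v1)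
    (P := fun m => m + 𝔐.num b - m = 𝔐.num b) (fun x => by simp) (by simp)
    (fun m h => by rw [succ_add, succ_sub_succ, h]) m

theorem num_sub_self (m : 𝔐.Num) : m - m = 0 := by simpa using add_sub_self m 0

theorem sub_add_self (m n : 𝔐.Num) : m - (m + n) = 0 := by
  obtain ⟨a, rfl⟩ := exists_num m
  exact num_induct (a ▹ 𝔐.base) (Fm.eq (subT v1 (addT v1 v0)) zro)
    (P := fun n => 𝔐.num a - (𝔐.num a + n) = 0) (fun x => by simp) (by simp [num_sub_self])
    (fun n h => by simp [h]) n

/-- The source of the totality of the order, and of the characterisation of `m ≤ n` by cut-off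
subtraction. In the induction step the first alternative survives unless the difference has reached
zero. -/
theorem add_sub_or (m n : 𝔐.Num) : n + (m - n) = m ∨ m + (n - m) = n := by
  obtain ⟨a, rfl⟩ := exists_num m
  refine num_induct (a ▹ 𝔐.base)
    (Fm.or (Fm.eq (addT v0 (subT v1 v0)) v1) (Fm.eq (addT v1 (subT v0 v1)) v0))
    (P := fun n => n + (𝔐.num a - n) = 𝔐.num a ∨ 𝔐.num a + (n - 𝔐.num a) = n)
    (fun x => by simp) (by simp) (fun n h => ?_) n
  rcases h with h | h
  · rcases zero_or_succ (𝔐.num a - n) with h₁ | ⟨k, h₁⟩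
    · rw [h₁, num_add_zero] at h
      subst h
      right
      rw [succ_eq_add_one, add_sub_self]
    · left
      rw [h₁, add_succ] at h
      rw [← h, ← succ_add, add_sub_self]
  · right
    rw [← h, ← add_succ, add_sub_self]

/-- Defined through differences, the order immediately has the subtraction property that the passage
to fractions needs. -/
instance : LE 𝔐.Num := ⟨fun m n => ∃ k, n = m + k⟩

theorem num_le_iff {m n : 𝔐.Num} : m ≤ n ↔ ∃ k, n = m + k := Iff.rfl

theorem eq_zero_of_add_eq_zero {m n : 𝔐.Num} (h : m + n = 0) : n = 0 := by
  rcases zero_or_succ n with h' | ⟨k, rfl⟩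
  · exact h'
  · exact absurd (add_succ m k ▸ h) (succ_ne_zero _)

theorem num_le_antisymm {m n : 𝔐.Num} (h : m ≤ n) (h' : n ≤ m) : m = n := by
  obtain ⟨k, rfl⟩ := h
  obtain ⟨l, h'⟩ := h'
  have h₁ : k + l = 0 := num_add_left_cancel (k := m) (by rw [← add_assoc, ← h', num_add_zero])
  rw [eq_zero_of_add_eq_zero ((add_comm l k).trans h₁), num_add_zero]

noncomputable instance : LinearOrder 𝔐.Num where
  le_refl n := ⟨0, (num_add_zero n).symm⟩
  le_trans := by
    rintro m _ _ ⟨k, rfl⟩ ⟨l, rfl⟩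
    exact ⟨k + l, add_assoc _ _ _⟩
  le_antisymm _ _ := num_le_antisymm
  le_total m n := (add_sub_or m n).symm.imp (fun h => ⟨_, h.symm⟩) fun h => ⟨_, h.symm⟩
  toDecidableLE := Classical.decRel _

theorem sub_eq_zero_iff {m n : 𝔐.Num} : m - n = 0 ↔ m ≤ n := by
  constructor
  · intro h
    rcases add_sub_or m n with h' | h'
    · rw [h, num_add_zero] at h'
      exact h'.ge
    · exact ⟨_, h'.symm⟩
  · rintro ⟨k, rfl⟩
    exact sub_add_self _ _

theorem succ_le_iff {m n : 𝔐.Num} : succ m ≤ n ↔ m < n := by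
  rw [lt_iff_le_and_ne]
  constructor
  · rintro ⟨k, rfl⟩
    refine ⟨⟨succ k, by rw [succ_add, add_succ]⟩, fun h => succ_ne_zero k ?_⟩
    refine (num_add_left_cancel (k := m) ?_).symm
    rw [num_add_zero, add_succ, ← succ_add]
    exact h
  · rintro ⟨⟨k, rfl⟩, h⟩
    rcases zero_or_succ k with rfl | ⟨k, rfl⟩
    · exact absurd (num_add_zero m).symm h
    · exact ⟨k, by rw [succ_add, add_succ]⟩

instance : Nontrivial 𝔐.Num := ⟨⟨0, 1, (succ_ne_zero 0).symm⟩⟩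

instance : ExistsAddOfLE 𝔐.Num := ⟨fun h => h⟩

theorem num_zero_le (n : 𝔐.Num) : 0 ≤ n := ⟨n, (zero_add n).symm⟩

instance : IsOrderedCancelAddMonoid 𝔐.Num where
  add_le_add_left := by
    rintro m _ ⟨k, rfl⟩ n
    exact ⟨k, by rw [add_right_comm]⟩
  le_of_add_le_add_left := by
    rintro n m l ⟨k, h⟩
    exact ⟨k, num_add_left_cancel (k := n) (by rw [h, add_assoc])⟩

theorem num_mul_pos {m n : 𝔐.Num} (hm : 0 < m) (hn : 0 < n) : 0 < m * n := by
  obtain ⟨k, rfl⟩ := succ_le_iff.2 hm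
  obtain ⟨l, rfl⟩ := succ_le_iff.2 hn
  refine succ_le_iff.1 ⟨k + l + k * l, ?_⟩
  rw [succ_zero]
  ring

theorem num_mul_lt_mul {k m n : 𝔐.Num} (hk : 0 < k) (h : m < n) : k * m < k * n := by
  obtain ⟨l, rfl⟩ := succ_le_iff.2 h
  have hl : 0 < succ l := succ_le_iff.1 ⟨l, by rw [succ_add, zero_add]⟩
  obtain ⟨j, hj⟩ := succ_le_iff.2 (num_mul_pos hk hl)
  refine succ_le_iff.1 ⟨j, ?_⟩
  rw [succ_add, ← add_succ, mul_add, hj, succ_add, zero_add, succ_add, add_succ]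

instance : IsStrictOrderedRing 𝔐.Num where
  zero_le_one := num_zero_le 1
  mul_lt_mul_of_pos_left _ hk _ _ h := num_mul_lt_mul hk h
  mul_lt_mul_of_pos_right k hk m n h := by
    rw [mul_comm m, mul_comm n]
    exact num_mul_lt_mul hk h

end TModel
end FinType

namespace FinType

/-! ### The ordered field of fractions of an ordered semiring -/

section Differences

variable (N : Type*) [CommSemiring N] [LinearOrder N] [IsStrictOrderedRing N]

/-- Since addition is cancellative, transitivity needs no auxiliary summand in the relation. -/
def diffSetoid : Setoid (N × N) where
  r p q := p.1 + q.2 = q.1 + p.2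
  iseqv := by
    refine ⟨fun _ => rfl, fun h => h.symm, fun {p q r} h h' => ?_⟩
    have : (p.1 + r.2) + q.2 = (r.1 + p.2) + q.2 := by
      calc (p.1 + r.2) + q.2 = (p.1 + q.2) + r.2 := by ring
        _ = (q.1 + r.2) + p.2 := by rw [h]; ring
        _ = (r.1 + p.2) + q.2 := by rw [h']; ring
    exact add_right_cancel this

/-- The formal differences of elements of an ordered semiring. -/
def Diff : Type _ := Quotient (diffSetoid N)

variable {N}

def Diff.mk (p : N × N) : Diff N := Quotient.mk (diffSetoid N) p

theorem Diff.mk_eq {p q : N × N} : Diff.mk p = Diff.mk q ↔ p.1 + q.2 = q.1 + p.2 := Quotient.eq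

theorem Diff.exists_mk (x : Diff N) : ∃ p, Diff.mk p = x := Quotient.exists_rep x

namespace Diff

def add : Diff N → Diff N → Diff N :=
  Quotient.map₂ (fun p q => (p.1 + q.1, p.2 + q.2)) fun p p' h q q' h' => by
    change p.1 + p'.2 = p'.1 + p.2 at h
    change q.1 + q'.2 = q'.1 + q.2 at h'
    change p.1 + q.1 + (p'.2 + q'.2) = p'.1 + q'.1 + (p.2 + q.2)
    linear_combination h + h'

def mul : Diff N → Diff N → Diff N :=
  Quotient.map₂ (fun p q => (p.1 * q.1 + p.2 * q.2, p.1 * q.2 + p.2 * q.1)) fun p p' h q q' h' => by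
    change p.1 + p'.2 = p'.1 + p.2 at h
    change q.1 + q'.2 = q'.1 + q.2 at h'
    change p.1 * q.1 + p.2 * q.2 + (p'.1 * q'.2 + p'.2 * q'.1) =
      p'.1 * q'.1 + p'.2 * q'.2 + (p.1 * q.2 + p.2 * q.1)
    -- The added terms are the mixed products of `p'` with `q`: they let one factor be exchanged at
    -- a time, and cancel afterwards.
    refine add_right_cancel
      (b := (p'.1 * q.1 + p'.2 * q.2) + (p'.1 * q.2 + p'.2 * q.1)) ?_
    linear_combination q.1 * h + q.2 * h.symm + p'.1 * h' + p'.2 * h'.symm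

def neg : Diff N → Diff N :=
  Quotient.map (fun p => (p.2, p.1)) fun p p' h => by
    change p.1 + p'.2 = p'.1 + p.2 at h
    change p.2 + p'.1 = p'.2 + p.1
    linear_combination h.symm

instance : Zero (Diff N) := ⟨mk (0, 0)⟩

instance : One (Diff N) := ⟨mk (1, 0)⟩

instance : Add (Diff N) := ⟨add⟩

instance : Mul (Diff N) := ⟨mul⟩

instance : Neg (Diff N) := ⟨neg⟩

instance : CommRing (Diff N) where
  add_assoc := by
    rintro ⟨a⟩ ⟨b⟩ ⟨c⟩
    exact mk_eq.2 (by dsimp only; ring)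
  zero_add := by
    rintro ⟨a⟩
    exact mk_eq.2 (by dsimp only; ring)
  add_zero := by
    rintro ⟨a⟩
    exact mk_eq.2 (by dsimp only; ring)
  add_comm := by
    rintro ⟨a⟩ ⟨b⟩
    exact mk_eq.2 (by dsimp only; ring)
  neg_add_cancel := by
    rintro ⟨a⟩
    exact mk_eq.2 (by dsimp only; ring)
  mul_assoc := by
    rintro ⟨a⟩ ⟨b⟩ ⟨c⟩
    exact mk_eq.2 (by dsimp only; ring)
  mul_comm := by
    rintro ⟨a⟩ ⟨b⟩
    exact mk_eq.2 (by dsimp only; ring)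
  one_mul := by
    rintro ⟨a⟩
    exact mk_eq.2 (by dsimp only; ring)
  mul_one := by
    rintro ⟨a⟩
    exact mk_eq.2 (by dsimp only; ring)
  zero_mul := by
    rintro ⟨a⟩
    exact mk_eq.2 (by dsimp only; ring)
  mul_zero := by
    rintro ⟨a⟩
    exact mk_eq.2 (by dsimp only; ring)
  left_distrib := by
    rintro ⟨a⟩ ⟨b⟩ ⟨c⟩
    exact mk_eq.2 (by dsimp only; ring)
  right_distrib := by
    rintro ⟨a⟩ ⟨b⟩ ⟨c⟩
    exact mk_eq.2 (by dsimp only; ring)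
  nsmul := nsmulRec
  zsmul := zsmulRec

variable (N) in
/-- The inclusion of an ordered semiring into its ring of differences. -/
def of : N →+* Diff N where
  toFun a := mk (a, 0)
  map_one' := rfl
  map_zero' := rfl
  map_mul' a b := mk_eq.2 (by dsimp only; ring)
  map_add' a b := mk_eq.2 (by dsimp only; ring)

theorem of_injective : Function.Injective (of N) := fun a b h => by
  simpa using mk_eq.1 h

/-- One component of the difference is at most the other and can be subtracted from it, so every
formal difference is a semiring element up to sign. -/
theorem exists_of [ExistsAddOfLE N] (x : Diff N) :
    ∃ a : N, 0 ≤ a ∧ (x = of N a ∨ x = -of N a) := by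
  obtain ⟨p, rfl⟩ := x.exists_mk
  rcases le_total p.1 p.2 with h | h
  · obtain ⟨a, ha⟩ := exists_add_of_le h
    refine ⟨a, by simpa [ha] using h, .inr (mk_eq.2 ?_)⟩
    rw [ha]
    dsimp only
    ring
  · obtain ⟨a, ha⟩ := exists_add_of_le h
    refine ⟨a, by simpa [ha] using h, .inl (mk_eq.2 ?_)⟩
    rw [ha]
    dsimp only
    ring

instance : Nontrivial (Diff N) := of_injective.nontrivial

theorem isDomain [ExistsAddOfLE N] : IsDomain (Diff N) := by
  have : NoZeroDivisors (Diff N) := ⟨fun {x y} h => by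
    obtain ⟨a, ha, hx⟩ := exists_of x
    obtain ⟨b, hb, hy⟩ := exists_of y
    have h₁ : of N a * of N b = 0 := by rcases hx with rfl | rfl <;> rcases hy with rfl | rfl <;> simpa using h
    rw [← map_mul, map_eq_zero_iff _ of_injective] at h₁
    have : a = 0 ∨ b = 0 := by
      by_contra hcon
      rw [not_or] at hcon
      exact (mul_pos (lt_of_le_of_ne ha (Ne.symm hcon.1))
        (lt_of_le_of_ne hb (Ne.symm hcon.2))).ne' h₁
    rcases this with rfl | rfl
    · left; simpa using hx
    · right; simpa using hy⟩
  exact NoZeroDivisors.to_isDomain _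

end Diff

/-- A field whose elements are up to sign the quotients of elements of an ordered semiring. -/
theorem exists_order_of_fractions [ExistsAddOfLE N] {K : Type*} [Field K] (f : N →+* K)
    (hf : Function.Injective f)
    (hK : ∀ x : K, ∃ a b : N, 0 ≤ a ∧ 0 < b ∧ (x = f a / f b ∨ x = -(f a / f b))) :
    ∃ _ : LinearOrder K, IsStrictOrderedRing K ∧ StrictMono f := by
  classical
  have h0 : ∀ {b : N}, 0 < b → f b ≠ 0 := fun hb h =>
    hb.ne' ((map_eq_zero_iff f hf).1 h)
  -- The nonnegative elements are the quotients of nonnegative by positive semiring elements; by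
  -- `hK` every element or its negative is of this kind.
  let C : RingCone K :=
    { carrier := {x | ∃ a b : N, 0 ≤ a ∧ 0 < b ∧ x = f a / f b}
      mul_mem' := by
        rintro _ _ ⟨a, b, ha, hb, rfl⟩ ⟨c, d, hc, hd, rfl⟩
        exact ⟨a * c, b * d, mul_nonneg ha hc, mul_pos hb hd, by
          rw [map_mul, map_mul, div_mul_div_comm]⟩
      one_mem' := ⟨1, 1, zero_le_one, zero_lt_one, by simp⟩
      add_mem' := by
        rintro _ _ ⟨a, b, ha, hb, rfl⟩ ⟨c, d, hc, hd, rfl⟩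
        refine ⟨a * d + b * c, b * d, add_nonneg (mul_nonneg ha hd.le) (mul_nonneg hb.le hc),
          mul_pos hb hd, ?_⟩
        rw [div_add_div _ _ (h0 hb) (h0 hd)]
        simp only [map_add, map_mul]
      zero_mem' := ⟨0, 1, le_rfl, zero_lt_one, by simp⟩
      eq_zero_of_mem_of_neg_mem' := by
        rintro _ ⟨a, b, ha, hb, rfl⟩ ⟨c, d, hc, hd, h⟩
        have h₁ : f (a * d + b * c) = 0 := by
          have := h0 hb
          have := h0 hd
          field_simp at h
          rw [map_add, map_mul, map_mul]
          linear_combination -h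
        rw [map_eq_zero_iff f hf] at h₁
        -- If a quotient and its negative both lie in the cone, two nonnegative products add up to
        -- zero, so both vanish.
        have h₂ : a * d = 0 := by
          refine le_antisymm ?_ (mul_nonneg ha hd.le)
          rw [← h₁]
          exact le_add_of_nonneg_right (mul_nonneg hb.le hc)
        rcases ha.eq_or_lt with rfl | ha
        · simp
        · exact absurd h₂ (mul_pos ha hd).ne' }
  have : HasMemOrNegMem C := ⟨fun x => by
    obtain ⟨a, b, ha, hb, h | h⟩ := hK x
    · exact .inl ⟨a, b, ha, hb, h⟩
    · exact .inr ⟨a, b, ha, hb, by rw [h, neg_neg]⟩⟩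
  let _ : LinearOrder K := LinearOrder.mkOfAddGroupCone C
  have : IsOrderedRing K := IsOrderedRing.mkOfCone C
  have : IsStrictOrderedRing K := IsOrderedRing.toIsStrictOrderedRing K
  refine ⟨inferInstance, inferInstance, fun a b hab => ?_⟩
  refine lt_of_le_of_ne ?_ (hf.ne hab.ne)
  obtain ⟨c, rfl⟩ := exists_add_of_le hab.le
  refine (show f (a + c) - f a ∈ C from ⟨c, 1, ?_, zero_lt_one, by simp⟩)
  exact (le_add_iff_nonneg_right a).1 hab.le

/-- An ordered semiring with differences embeds into an ordered field. -/
theorem exists_ordered_field (N : Type) [CommSemiring N] [LinearOrder N] [IsStrictOrderedRing N]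
    [ExistsAddOfLE N] :
    ∃ (K : Type) (_ : Field K) (_ : LinearOrder K) (_ : IsStrictOrderedRing K) (f : N →+* K),
      StrictMono f := by
  have : IsDomain (Diff N) := Diff.isDomain
  let f : N →+* FractionRing (Diff N) := (algebraMap (Diff N) (FractionRing (Diff N))).comp (Diff.of N)
  have hf : Function.Injective f :=
    (IsFractionRing.injective (Diff N) (FractionRing (Diff N))).comp Diff.of_injective
  obtain ⟨h₁, h₂, h₃⟩ := exists_order_of_fractions f hf fun x => by
    obtain ⟨y, z, hz, rfl⟩ := IsFractionRing.div_surjective (A := Diff N) x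
    obtain ⟨a, ha, hy⟩ := y.exists_of
    obtain ⟨b, hb, hz'⟩ := z.exists_of
    have hb0 : b ≠ 0 := by
      rintro rfl
      exact nonZeroDivisors.ne_zero hz (by simpa using hz')
    refine ⟨a, b, ha, lt_of_le_of_ne hb hb0.symm, ?_⟩
    rcases hy with rfl | rfl <;> rcases hz' with rfl | rfl <;>
      simp [f, div_neg, neg_div]
  exact ⟨FractionRing (Diff N), inferInstance, h₁, h₂, f, h₃⟩

end Differences
end FinType

namespace FinType
namespace TModel

variable {Γ Δ Δ' : List Ty} {𝔐 : TModel Γ}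

/-! ### Pairs of numbers -/

/-- The step function for the first projection of pairs. -/
def unpairStepFst : Tm Δ (Ty.fn Ty.nat (Ty.fn Ty.nat one)) :=
  Tm.lam (Tm.lam (Tm.lam (condT v2 (suc v1) (predT v2))))

/-- The step function for the second projection of pairs. -/
def unpairStepSnd : Tm Δ (Ty.fn Ty.nat (Ty.fn Ty.nat one)) :=
  Tm.lam (Tm.lam (Tm.lam (condT v2 zro (suc v1))))

theorem num_unpairStepFst (ρ : Env 𝔐.M Δ) [Good 𝔐 ρ] (a b c : 𝔐.M.D Ty.nat) :
    𝔐.num (𝔐.M.app (𝔐.M.app (𝔐.M.app (unpairStepFst.eval ρ) a) b) c) =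
      cond (𝔐.num a) (succ (𝔐.num b)) (pred (𝔐.num a)) := by
  rw [unpairStepFst, num_lam_lam_lam, nev_condT, nev_suc, nev_predT]
  rfl

theorem num_unpairStepSnd (ρ : Env 𝔐.M Δ) [Good 𝔐 ρ] (a b c : 𝔐.M.D Ty.nat) :
    𝔐.num (𝔐.M.app (𝔐.M.app (𝔐.M.app (unpairStepSnd.eval ρ) a) b) c) =
      cond (𝔐.num a) 0 (succ (𝔐.num b)) := by
  rw [unpairStepSnd, num_lam_lam_lam, nev_condT, nev_suc]
  rfl

/-- The value of a simultaneous recursion for two sequences of numbers that starts with zeros. -/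
def rec₂ (i : Var [Ty.nat, Ty.nat] Ty.nat) (f g : 𝔐.M.D (Ty.fn Ty.nat (Ty.fn Ty.nat one)))
    (x : 𝔐.M.D Ty.nat) : 𝔐.M.D Ty.nat :=
  𝔐.M.app (𝔐.M.app (𝔐.M.app (𝔐.M.app (𝔐.M.app (𝔐.M.con (Con.recursor [Ty.nat, Ty.nat] i)) x)
    (𝔐.M.con Con.zero)) (𝔐.M.con Con.zero)) f) g

theorem rec₂_zero (i : Var [Ty.nat, Ty.nat] Ty.nat)
    (f g : 𝔐.M.D (Ty.fn Ty.nat (Ty.fn Ty.nat one))) :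
    𝔐.num (rec₂ i f g (𝔐.M.con Con.zero)) = 0 := by
  have h := (Sat_eqF _ _ _).1 (𝔐.sat_arith (f ▹ g ▹ 𝔐.base) (.recZero [Ty.nat, Ty.nat] i
    (Sub.cons zro (Sub.cons zro fun _ v => nomatch v))
    (Sub.cons v0 (Sub.cons v1 fun _ v => nomatch v))))
  match i, h with
  | Var.z, h => exact num_eq.2 h
  | Var.s Var.z, h => exact num_eq.2 h

theorem rec₂_succ_fst (f g : 𝔐.M.D (Ty.fn Ty.nat (Ty.fn Ty.nat one))) (x : 𝔐.M.D Ty.nat) :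
    𝔐.num (rec₂ Var.z f g (𝔐.M.app (𝔐.M.con Con.succ) x)) =
      𝔐.num (𝔐.M.app (𝔐.M.app (𝔐.M.app f (rec₂ Var.z f g x)) (rec₂ (Var.s Var.z) f g x)) x) :=
  num_eq.2 ((Sat_eqF _ _ _).1 (𝔐.sat_arith (f ▹ g ▹ x ▹ 𝔐.base)
    (.recSucc [Ty.nat, Ty.nat] Var.z v2 (Sub.cons zro (Sub.cons zro fun _ v => nomatch v))
      (Sub.cons v0 (Sub.cons v1 fun _ v => nomatch v)))))

theorem rec₂_succ_snd (f g : 𝔐.M.D (Ty.fn Ty.nat (Ty.fn Ty.nat one))) (x : 𝔐.M.D Ty.nat) :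
    𝔐.num (rec₂ (Var.s Var.z) f g (𝔐.M.app (𝔐.M.con Con.succ) x)) =
      𝔐.num (𝔐.M.app (𝔐.M.app (𝔐.M.app g (rec₂ Var.z f g x)) (rec₂ (Var.s Var.z) f g x)) x) :=
  num_eq.2 ((Sat_eqF _ _ _).1 (𝔐.sat_arith (f ▹ g ▹ x ▹ 𝔐.base)
    (.recSucc [Ty.nat, Ty.nat] (Var.s Var.z) v2 (Sub.cons zro (Sub.cons zro fun _ v => nomatch v))
      (Sub.cons v0 (Sub.cons v1 fun _ v => nomatch v)))))

/-- The same argument as for `natRec_congr`, with both components in one induction because each step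
uses both previous values. -/
theorem nev_unpairT_congr {ρ : Env 𝔐.M Δ} [Good 𝔐 ρ] {ρ' : Env 𝔐.M Δ'} [Good 𝔐 ρ']
    (i : Var [Ty.nat, Ty.nat] Ty.nat) {n : Tm Δ Ty.nat} {n' : Tm Δ' Ty.nat}
    (hn : nev ρ n = nev ρ' n') : nev ρ (unpairT i n) = nev ρ' (unpairT i n') := by
  let σ : Ty := Ty.fn Ty.nat (Ty.fn Ty.nat one)
  let E := (unpairStepFst.eval ρ : 𝔐.M.D σ) ▹ (unpairStepSnd.eval ρ : 𝔐.M.D σ) ▹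
    (unpairStepFst.eval ρ' : 𝔐.M.D σ) ▹ (unpairStepSnd.eval ρ' : 𝔐.M.D σ) ▹ 𝔐.base
  let G : Var [Ty.nat, Ty.nat] Ty.nat → Tm (Ty.nat :: σ :: σ :: σ :: σ :: Γ) Ty.nat := fun i =>
    Tm.app (Tm.app (Tm.app (Tm.app (Tm.app (Tm.con (Con.recursor [Ty.nat, Ty.nat] i)) v0) zro) zro)
      v1) v2
  let G' : Var [Ty.nat, Ty.nat] Ty.nat → Tm (Ty.nat :: σ :: σ :: σ :: σ :: Γ) Ty.nat := fun i =>
    Tm.app (Tm.app (Tm.app (Tm.app (Tm.app (Tm.con (Con.recursor [Ty.nat, Ty.nat] i)) v0) zro) zro)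
      (Tm.var (Var.s (Var.s (Var.s Var.z))))) (Tm.var (Var.s (Var.s (Var.s (Var.s Var.z)))))
  have key : ∀ x, Sat (x ▹ E) (Fm.and (Fm.eq (G Var.z) (G' Var.z))
      (Fm.eq (G (Var.s Var.z)) (G' (Var.s Var.z)))) := by
    refine sat_induct E _ ?_ fun x hx => ?_
    · exact ⟨num_eq.1 ((rec₂_zero _ _ _).trans (rec₂_zero _ _ _).symm),
        num_eq.1 ((rec₂_zero _ _ _).trans (rec₂_zero _ _ _).symm)⟩
    · have h₁ : 𝔐.num (rec₂ Var.z (unpairStepFst.eval ρ) (unpairStepSnd.eval ρ) x) =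
          𝔐.num (rec₂ Var.z (unpairStepFst.eval ρ') (unpairStepSnd.eval ρ') x) := num_eq.2 hx.1
      have h₂ : 𝔐.num (rec₂ (Var.s Var.z) (unpairStepFst.eval ρ) (unpairStepSnd.eval ρ) x) =
          𝔐.num (rec₂ (Var.s Var.z) (unpairStepFst.eval ρ') (unpairStepSnd.eval ρ') x) :=
        num_eq.2 hx.2
      have h₃ := (num_unpairStepFst ρ (rec₂ Var.z (unpairStepFst.eval ρ) (unpairStepSnd.eval ρ) x)
        (rec₂ (Var.s Var.z) (unpairStepFst.eval ρ) (unpairStepSnd.eval ρ) x) x)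
      have h₄ := (num_unpairStepSnd ρ (rec₂ Var.z (unpairStepFst.eval ρ) (unpairStepSnd.eval ρ) x)
        (rec₂ (Var.s Var.z) (unpairStepFst.eval ρ) (unpairStepSnd.eval ρ) x) x)
      rw [h₁, h₂, ← num_unpairStepFst ρ' _ _ x] at h₃
      rw [h₁, h₂, ← num_unpairStepSnd ρ' _ _ x] at h₄
      exact ⟨num_eq.1 ((rec₂_succ_fst _ _ _).trans (h₃.trans (rec₂_succ_fst _ _ _).symm)),
        num_eq.1 ((rec₂_succ_snd _ _ _).trans (h₄.trans (rec₂_succ_snd _ _ _).symm))⟩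
  have h : 𝔐.num (rec₂ i (unpairStepFst.eval ρ) (unpairStepSnd.eval ρ) (n.eval ρ)) =
      𝔐.num (rec₂ i (unpairStepFst.eval ρ') (unpairStepSnd.eval ρ') (n.eval ρ)) := by
    match i with
    | Var.z => exact num_eq.2 (key (n.eval ρ)).1
    | Var.s Var.z => exact num_eq.2 (key (n.eval ρ)).2
  exact h.trans (num_eq.2 (𝔐.congr_nat E (G' i) (num_eq.1 hn)))

noncomputable def fst (n : 𝔐.Num) : 𝔐.Num := nev (n.out ▹ 𝔐.base) (fstT v0)

noncomputable def snd (n : 𝔐.Num) : 𝔐.Num := nev (n.out ▹ 𝔐.base) (sndT v0)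

theorem nev_fstT (ρ : Env 𝔐.M Δ) [Good 𝔐 ρ] (n : Tm Δ Ty.nat) :
    nev ρ (fstT n) = fst (nev ρ n) :=
  nev_unpairT_congr _ (num_out _).symm

theorem nev_sndT (ρ : Env 𝔐.M Δ) [Good 𝔐 ρ] (n : Tm Δ Ty.nat) :
    nev ρ (sndT n) = snd (nev ρ n) :=
  nev_unpairT_congr _ (num_out _).symm

theorem fst_zero : fst (0 : 𝔐.Num) = 0 := by
  rw [← nev_zro 𝔐.base, ← nev_fstT]
  exact rec₂_zero _ _ _

theorem snd_zero : snd (0 : 𝔐.Num) = 0 := by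
  rw [← nev_zro 𝔐.base, ← nev_sndT]
  exact rec₂_zero _ _ _

theorem fst_succ (n : 𝔐.Num) : fst (succ n) = cond (fst n) (succ (snd n)) (pred (fst n)) := by
  obtain ⟨a, rfl⟩ := exists_num n
  rw [← nev_v0 𝔐.base a, ← nev_suc, ← nev_fstT, ← nev_fstT, ← nev_sndT]
  exact (rec₂_succ_fst _ _ _).trans (num_unpairStepFst _ _ _ _)

theorem snd_succ (n : 𝔐.Num) : snd (succ n) = cond (fst n) 0 (succ (snd n)) := by
  obtain ⟨a, rfl⟩ := exists_num n
  rw [← nev_v0 𝔐.base a, ← nev_suc, ← nev_sndT, ← nev_fstT, ← nev_sndT]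
  exact (rec₂_succ_snd _ _ _).trans (num_unpairStepSnd _ _ _ _)

/-- Along the diagonal that starts at `(s, 0)`, each step lowers the first component by one and
raises the second by one, until `(0, s)` is reached. -/
theorem unpair_tri_add_of (s : 𝔐.Num) (h : fst (tri s) = s ∧ snd (tri s) = 0) (n : 𝔐.Num) :
    n ≤ s → fst (tri s + n) + n = s ∧ snd (tri s + n) = n := by
  obtain ⟨a, rfl⟩ := exists_num s
  refine num_induct (a ▹ 𝔐.base) (Fm.imp (Fm.eq (subT v0 v1) zro)
    (Fm.and (Fm.eq (addT (fstT (addT (triT v1) v0)) v0) v1)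
      (Fm.eq (sndT (addT (triT v1) v0)) v0)))
    (P := fun n => n ≤ 𝔐.num a → fst (tri (𝔐.num a) + n) + n = 𝔐.num a ∧
      snd (tri (𝔐.num a) + n) = n) (fun x => ?_) (fun _ => ?_) (fun n ih hn => ?_) n
  · simp only [sat_imp, sat_and, sat_eq, nev_addT, nev_fstT, nev_sndT, nev_triT, nev_subT, nev_zro,
      nev_var_z, nev_var_s, sub_eq_zero_iff]
  · simpa only [num_add_zero] using h
  · rw [succ_le_iff] at hn
    obtain ⟨h₁, h₂⟩ := ih hn.le
    rw [add_succ (tri (𝔐.num a)) n, fst_succ, snd_succ, h₂]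
    rcases zero_or_succ (fst (tri (𝔐.num a) + n)) with h₃ | ⟨k, h₃⟩
    · rw [h₃, zero_add] at h₁
      exact absurd h₁ hn.ne
    · rw [h₃, cond_succ, cond_succ, pred_succ, add_succ, ← succ_add]
      rw [h₃] at h₁
      exact ⟨h₁, rfl⟩

/-- The last pair `(0, n)` of one diagonal is followed by the first pair `(n + 1, 0)` of the next.
-/
theorem unpair_tri (s : 𝔐.Num) : fst (tri s) = s ∧ snd (tri s) = 0 := by
  refine num_induct 𝔐.base (Fm.and (Fm.eq (fstT (triT v0)) v0) (Fm.eq (sndT (triT v0)) zro))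
    (P := fun s => fst (tri s) = s ∧ snd (tri s) = 0) (fun x => ?_) ?_ (fun n ih => ?_) s
  · simp only [sat_and, sat_eq, nev_fstT, nev_sndT, nev_triT, nev_zro, nev_var_z]
  · rw [tri_zero, fst_zero, snd_zero]
    exact ⟨rfl, rfl⟩
  · obtain ⟨h₁, h₂⟩ := unpair_tri_add_of n ih n le_rfl
    have h₃ : fst (tri n + n) = 0 := num_add_right_cancel (k := n) (by rw [h₁, zero_add])
    rw [tri_succ, add_succ, fst_succ, snd_succ, h₃, h₂, cond_zero, cond_zero]
    exact ⟨rfl, rfl⟩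

theorem nev_fst_pairT (ρ : Env 𝔐.M Δ) [Good 𝔐 ρ] (a b : Tm Δ Ty.nat) :
    fst (nev ρ (pairT a b)) = nev ρ a := by
  rw [pairT, nev_addT, nev_triT, nev_addT]
  exact add_right_cancel
    (unpair_tri_add_of _ (unpair_tri _) _ (le_add_of_nonneg_left (num_zero_le _))).1

theorem nev_snd_pairT (ρ : Env 𝔐.M Δ) [Good 𝔐 ρ] (a b : Tm Δ Ty.nat) :
    snd (nev ρ (pairT a b)) = nev ρ b := by
  rw [pairT, nev_addT, nev_triT, nev_addT]
  exact (unpair_tri_add_of _ (unpair_tri _) _ (le_add_of_nonneg_left (num_zero_le _))).2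

/-! ### Rational numbers -/

section Rationals

set_option linter.unusedSectionVars false

variable {K : Type} [Field K] [LinearOrder K] [IsStrictOrderedRing K]

/-- The rational number with a given code, in an ordered field that contains the numbers. -/
noncomputable def val (f : 𝔐.Num →+* K) (q : 𝔐.Num) : K :=
  (f (fst (fst q)) - f (snd (fst q))) / (f (snd q) + 1)

/-- The rational number `2 ^ (-n)`. -/
noncomputable def half (f : 𝔐.Num →+* K) (n : 𝔐.Num) : K := (f (pow2 n))⁻¹

variable {f : 𝔐.Num →+* K}

theorem map_succ (n : 𝔐.Num) : f (succ n) = f n + 1 := by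
  rw [succ_eq_add_one, map_add, map_one]

theorem map_nonneg (hf : StrictMono f) (n : 𝔐.Num) : 0 ≤ f n := by
  rw [← map_zero f]
  exact hf.monotone (num_zero_le n)

theorem den_pos (hf : StrictMono f) (n : 𝔐.Num) : 0 < f n + 1 :=
  add_pos_of_nonneg_of_pos (map_nonneg hf n) one_pos

theorem succ_pred_of_pos {n : 𝔐.Num} (h : 0 < n) : succ (pred n) = n := by
  rcases zero_or_succ n with rfl | ⟨k, rfl⟩
  · exact absurd h (lt_irrefl _)
  · rw [pred_succ]

theorem succ_pos (n : 𝔐.Num) : 0 < succ n :=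
  lt_of_le_of_ne (num_zero_le _) (succ_ne_zero n).symm

theorem map_pred (n : 𝔐.Num) (h : 0 < n) : f (pred n) + 1 = f n := by
  rw [← map_succ, succ_pred_of_pos h]

theorem pow2_pos (n : 𝔐.Num) : 0 < pow2 n := by
  have h := num_induct 𝔐.base (Fm.eq (subT (suc zro) (powT v0)) zro) (P := fun n => succ 0 ≤ pow2 n)
    (fun x => by
      simp only [sat_eq, nev_subT, nev_suc, nev_zro, nev_powT, nev_var_z, sub_eq_zero_iff])
    (by rw [pow2_zero])
    (fun n h => by
      rw [pow2_succ]
      exact h.trans (le_add_of_nonneg_left (num_zero_le _))) n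
  exact succ_le_iff.1 h

theorem half_pos (hf : StrictMono f) (n : 𝔐.Num) : 0 < half f n := by
  rw [half, inv_pos, ← map_zero f]
  exact hf (pow2_pos n)

theorem half_succ (n : 𝔐.Num) : half f (succ n) = half f n / 2 := by
  rw [half, half, pow2_succ, map_add, ← two_mul, mul_inv, div_eq_inv_mul]

variable (ρ : Env 𝔐.M Δ) [Good 𝔐 ρ]

theorem nev_denT (q : Tm Δ Ty.nat) : nev ρ (denT q) = succ (snd (nev ρ q)) := by
  rw [denT, nev_suc, nev_sndT]

theorem nev_posT (q : Tm Δ Ty.nat) : nev ρ (posT q) = fst (fst (nev ρ q)) := by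
  rw [posT, nev_fstT, nev_fstT]

theorem nev_negT (q : Tm Δ Ty.nat) : nev ρ (negT q) = snd (fst (nev ρ q)) := by
  rw [negT, nev_sndT, nev_fstT]

theorem val_ratT (a b c : Tm Δ Ty.nat) :
    val f (nev ρ (ratT a b c)) = (f (nev ρ a) - f (nev ρ b)) / (f (nev ρ c) + 1) := by
  rw [val, ratT, nev_fst_pairT, nev_snd_pairT, nev_fst_pairT, nev_snd_pairT]

theorem map_crossT (q r : Tm Δ Ty.nat) :
    f (nev ρ (crossT q r)) = f (fst (fst (nev ρ q))) * (f (snd (nev ρ r)) + 1) +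
      f (snd (fst (nev ρ r))) * (f (snd (nev ρ q)) + 1) := by
  rw [crossT, nev_addT, nev_mulT, nev_mulT, nev_denT, nev_denT, nev_posT, nev_negT, map_add,
    map_mul, map_mul, map_succ, map_succ]

/-- As `f` is strictly monotone, the cross-multiplied comparison of numbers can be read in `K`,
where it is the comparison of fractions. -/
theorem crossT_lt (hf : StrictMono f) (q r : Tm Δ Ty.nat) :
    nev ρ (crossT q r) < nev ρ (crossT r q) ↔ val f (nev ρ q) < val f (nev ρ r) := by
  rw [← hf.lt_iff_lt, map_crossT, map_crossT, val, val, div_lt_div_iff₀ (den_pos hf _) (den_pos hf _)]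
  constructor <;> intro h <;> linarith

theorem crossT_le (hf : StrictMono f) (q r : Tm Δ Ty.nat) :
    nev ρ (crossT q r) ≤ nev ρ (crossT r q) ↔ val f (nev ρ q) ≤ val f (nev ρ r) := by
  rw [← hf.le_iff_le, map_crossT, map_crossT, val, val, div_le_div_iff₀ (den_pos hf _) (den_pos hf _)]
  constructor <;> intro h <;> linarith

theorem nev_qltT (hf : StrictMono f) (q r : Tm Δ Ty.nat) :
    nev ρ (qltT q r) = 0 ↔ val f (nev ρ q) < val f (nev ρ r) := by
  rw [qltT, nev_subT, nev_suc, sub_eq_zero_iff, succ_le_iff, crossT_lt ρ hf]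

theorem sat_qltF (hf : StrictMono f) (q r : Tm Δ Ty.nat) :
    Sat ρ (qltF q r) ↔ val f (nev ρ q) < val f (nev ρ r) := by
  rw [qltF, sat_eq, nev_zro, nev_qltT ρ hf]

theorem sat_qleF (hf : StrictMono f) (q r : Tm Δ Ty.nat) :
    Sat ρ (qleF q r) ↔ val f (nev ρ q) ≤ val f (nev ρ r) := by
  rw [qleF, sat_eq, nev_zro, nev_subT, sub_eq_zero_iff, crossT_le ρ hf]

theorem val_qzero : val f (nev ρ qzero) = 0 := by
  rw [qzero, val_ratT, sub_self, zero_div]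

theorem val_qone : val f (nev ρ qone) = 1 := by
  rw [qone, val_ratT, nev_suc, nev_zro, succ_zero, map_one, map_zero, sub_zero, zero_add, div_one]

theorem val_qhalf (n : Tm Δ Ty.nat) : val f (nev ρ (qhalf n)) = half f (nev ρ n) := by
  rw [qhalf, val_ratT, nev_suc, nev_zro, succ_zero, map_one, map_zero, sub_zero, nev_predT,
    nev_powT, map_pred _ (pow2_pos _), one_div, half]

theorem val_qadd (hf : StrictMono f) (q r : Tm Δ Ty.nat) :
    val f (nev ρ (qadd q r)) = val f (nev ρ q) + val f (nev ρ r) := by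
  have hq := den_pos hf (snd (nev ρ q))
  have hr := den_pos hf (snd (nev ρ r))
  rw [qadd, val_ratT, nev_predT, nev_mulT, nev_denT, nev_denT,
    map_pred _ (num_mul_pos (succ_pos _) (succ_pos _)), val, val, div_add_div _ _ hq.ne' hr.ne']
  simp only [nev_addT, nev_mulT, nev_denT, nev_posT, nev_negT, map_add, map_mul, map_succ]
  congr 1
  ring

theorem val_qneg (q : Tm Δ Ty.nat) : val f (nev ρ (qneg q)) = -val f (nev ρ q) := by
  rw [qneg, val_ratT, nev_negT, nev_posT, nev_sndT, val]
  ring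

theorem val_qsub (hf : StrictMono f) (q r : Tm Δ Ty.nat) :
    val f (nev ρ (qsub q r)) = val f (nev ρ q) - val f (nev ρ r) := by
  rw [qsub, val_qadd ρ hf, val_qneg, sub_eq_add_neg]

/-- One of the two cut-off differences is zero and the other is the true distance. -/
theorem map_sub_add_sub (hf : StrictMono f) (m n : 𝔐.Num) :
    f (m - n + (n - m)) = |f m - f n| := by
  rcases le_total m n with h | h
  · rw [sub_eq_zero_iff.2 h, zero_add, abs_of_nonpos (sub_nonpos.2 (hf.monotone h))]
    obtain ⟨k, rfl⟩ := h
    rw [add_sub_self, map_add]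
    ring
  · rw [sub_eq_zero_iff.2 h, add_zero, abs_of_nonneg (sub_nonneg.2 (hf.monotone h))]
    obtain ⟨k, rfl⟩ := h
    rw [add_sub_self, map_add]
    ring

theorem val_qabs (hf : StrictMono f) (q : Tm Δ Ty.nat) :
    val f (nev ρ (qabs q)) = |val f (nev ρ q)| := by
  rw [qabs, val_ratT, nev_addT, nev_subT, nev_subT, nev_zro, map_zero, sub_zero, nev_posT,
    nev_negT, nev_sndT, map_sub_add_sub hf, val, abs_div, abs_of_pos (den_pos hf _)]

end Rationals

end TModel
end FinType

namespace FinType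
namespace TModel

variable {Γ Δ Δ' : List Ty} {𝔐 : TModel Γ}

/-! ### Real numbers -/

/-- Application of an object of type `1` to a number. -/
noncomputable def ap (a : 𝔐.M.D one) (n : 𝔐.Num) : 𝔐.Num := 𝔐.num (𝔐.M.app a n.out)

theorem ap_num (a : 𝔐.M.D one) (x : 𝔐.M.D Ty.nat) : ap a (𝔐.num x) = 𝔐.num (𝔐.M.app a x) :=
  num_app_congr a (num_out _)

theorem nev_app (ρ : Env 𝔐.M Δ) (t : Tm Δ one) (n : Tm Δ Ty.nat) :
    nev ρ (Tm.app t n) = ap (t.eval ρ) (nev ρ n) :=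
  (ap_num _ _).symm

theorem ap_lam (ρ : Env 𝔐.M Δ) [Good 𝔐 ρ] (t : Tm (Ty.nat :: Δ) Ty.nat) (x : 𝔐.M.D Ty.nat) :
    ap (t.lam.eval ρ) (𝔐.num x) = nev (x ▹ ρ) t := by
  rw [ap_num, num_lam]

/-! ### Rational operations depend only on the codes of their arguments -/

section Congruence

variable {ρ : Env 𝔐.M Δ} [Good 𝔐 ρ] {ρ' : Env 𝔐.M Δ'} [Good 𝔐 ρ'] {q r : Tm Δ Ty.nat}
  {q' r' : Tm Δ' Ty.nat}

theorem nev_qltT_congr (hq : nev ρ q = nev ρ' q') (hr : nev ρ r = nev ρ' r') :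
    nev ρ (qltT q r) = nev ρ' (qltT q' r') := by
  simp only [qltT, crossT, nev_subT, nev_suc, nev_addT, nev_mulT, nev_posT, nev_negT, nev_denT,
    hq, hr]

theorem nev_qsub_congr (hq : nev ρ q = nev ρ' q') (hr : nev ρ r = nev ρ' r') :
    nev ρ (qsub q r) = nev ρ' (qsub q' r') := by
  have h : nev ρ (qneg r) = nev ρ' (qneg r') := by
    simp only [qneg, ratT, pairT, nev_addT, nev_triT, nev_posT, nev_negT, nev_sndT, hr]
  simp only [qsub, qadd, ratT, pairT, nev_addT, nev_triT, nev_mulT, nev_predT, nev_posT, nev_negT,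
    nev_denT, hq, h]

theorem nev_qabs_congr (hq : nev ρ q = nev ρ' q') : nev ρ (qabs q) = nev ρ' (qabs q') := by
  simp only [qabs, ratT, pairT, nev_addT, nev_triT, nev_subT, nev_posT, nev_negT, nev_sndT, nev_zro,
    hq]

theorem nev_qhalf_congr (hq : nev ρ q = nev ρ' q') : nev ρ (qhalf q) = nev ρ' (qhalf q') := by
  simp only [qhalf, ratT, pairT, nev_addT, nev_triT, nev_suc, nev_zro, nev_predT, nev_powT, hq]

end Congruence

/-- A term that is `0` exactly if `|t n - t (n + 1)| < 2 ^ (-n - 1)`. -/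
def gapT (t : Tm Δ one) (n : Tm Δ Ty.nat) : Tm Δ Ty.nat :=
  qltT (qabs (qsub (Tm.app t n) (Tm.app t (suc n)))) (qhalf (suc n))

theorem nev_gapT_congr {ρ : Env 𝔐.M Δ} [Good 𝔐 ρ] {ρ' : Env 𝔐.M Δ'} [Good 𝔐 ρ'] {t : Tm Δ one}
    {t' : Tm Δ' one} {n : Tm Δ Ty.nat} {n' : Tm Δ' Ty.nat} (ht : t.eval ρ = t'.eval ρ')
    (hn : nev ρ n = nev ρ' n') : nev ρ (gapT t n) = nev ρ' (gapT t' n') := by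
  have h : nev ρ (suc n) = nev ρ' (suc n') := by rw [nev_suc, nev_suc, hn]
  have h' : ∀ {k k'}, nev ρ k = nev ρ' k' → nev ρ (Tm.app t k) = nev ρ' (Tm.app t' k') :=
    fun hk => by rw [nev_app, nev_app, ht, hk]
  exact nev_qltT_congr (nev_qabs_congr (nev_qsub_congr (h' hn) (h' h))) (nev_qhalf_congr h)

noncomputable def bad (a : 𝔐.M.D one) (n : 𝔐.Num) : 𝔐.Num :=
  nev (n.out ▹ a ▹ 𝔐.base) (badT v1 v0)

theorem nev_badT (ρ : Env 𝔐.M Δ) [Good 𝔐 ρ] (t : Tm Δ one) (n : Tm Δ Ty.nat) :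
    nev ρ (badT t n) = bad (t.eval ρ) (nev ρ n) := by
  refine natRec_congr rfl (fun x x' y y' h h' => ?_) (num_out _).symm
  rw [nev_addT, nev_addT, nev_v1, nev_v1, h]
  congr 1
  exact nev_gapT_congr (t := t.wk.wk) (n := v0) (n' := v0)
    (by rw [Tm.eval_wk, Tm.eval_wk, Tm.eval_wk, Tm.eval_wk]; rfl) h'

noncomputable def hat (a : 𝔐.M.D one) (n : 𝔐.Num) : 𝔐.Num :=
  nev (n.out ▹ a ▹ 𝔐.base) (hatT v1 v0)

theorem nev_hatT (ρ : Env 𝔐.M Δ) [Good 𝔐 ρ] (t : Tm Δ one) (n : Tm Δ Ty.nat) :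
    nev ρ (hatT t n) = hat (t.eval ρ) (nev ρ n) := by
  refine natRec_congr ?_ (fun x x' y y' h h' => ?_) (num_out _).symm
  · rw [nev_app, nev_app]
    rfl
  · simp only [nev_condT, nev_badT, nev_app, Tm.eval_wk, nev_v1, nev_v0, h, h']
    rfl

theorem bad_succ (a : 𝔐.M.D one) (x : 𝔐.M.D Ty.nat) :
    bad a (succ (𝔐.num x)) = bad a (𝔐.num x) + nev (x ▹ a ▹ 𝔐.base) (gapT v1 v0) := by
  have h := nev_badT (x ▹ a ▹ 𝔐.base) v1 (suc v0)
  rw [nev_suc] at h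
  refine h.symm.trans ((natRec_suc _ _ _ _).trans ?_)
  rw [nev_addT]
  refine congrArg₂ _ (nev_badT (x ▹ a ▹ 𝔐.base) v1 v0) ?_
  exact nev_gapT_congr (t := (v1 : Tm (Ty.nat :: one :: Γ) one).wk.wk) (n := v0) rfl rfl

theorem bad_zero (a : 𝔐.M.D one) : bad a 0 = 0 := by
  have h := nev_badT (a ▹ 𝔐.base) v0 zro
  exact h.symm.trans (natRec_zro _ _ _)

theorem hat_zero (a : 𝔐.M.D one) : hat a 0 = ap a 0 := by
  have h := nev_hatT (a ▹ 𝔐.base) v0 zro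
  exact h.symm.trans ((natRec_zro _ _ _).trans (nev_app _ _ _))

theorem hat_succ (a : 𝔐.M.D one) (n : 𝔐.Num) :
    hat a (succ n) = cond (bad a (succ n)) (ap a (succ n)) (hat a n) := by
  obtain ⟨x, rfl⟩ := exists_num n
  have h := nev_hatT (x ▹ a ▹ 𝔐.base) v1 (suc v0)
  rw [nev_suc] at h
  refine h.symm.trans ((natRec_suc _ _ _ _).trans ?_)
  simp only [nev_condT, nev_badT, nev_app, Tm.eval_wk, nev_v1, nev_v0]
  rw [← nev_v0 (a ▹ 𝔐.base) x]
  exact congrArg _ (nev_hatT (x ▹ a ▹ 𝔐.base) v1 v0)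

/-! ### Approximations of reals in the ordered field -/

section Reals

variable {K : Type} [Field K] [LinearOrder K] [IsStrictOrderedRing K] {f : 𝔐.Num →+* K}

theorem nev_gapT (hf : StrictMono f) (a : 𝔐.M.D one) (x : 𝔐.M.D Ty.nat) :
    nev (x ▹ a ▹ 𝔐.base) (gapT v1 v0) = 0 ↔
      |val f (ap a (𝔐.num x)) - val f (ap a (succ (𝔐.num x)))| < half f (succ (𝔐.num x)) := by
  rw [gapT, nev_qltT _ hf, val_qabs _ hf, val_qsub _ hf, val_qhalf, nev_app, nev_app, nev_suc]
  rfl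

theorem bad_succ_eq_zero (hf : StrictMono f) (a : 𝔐.M.D one) (n : 𝔐.Num) :
    bad a (succ n) = 0 ↔
      bad a n = 0 ∧ |val f (ap a n) - val f (ap a (succ n))| < half f (succ n) := by
  obtain ⟨x, rfl⟩ := exists_num n
  rw [bad_succ, ← nev_gapT hf]
  constructor
  · intro h
    have h' := eq_zero_of_add_eq_zero h
    rw [h', add_zero] at h
    exact ⟨h, h'⟩
  · rintro ⟨h₁, h₂⟩
    rw [h₁, h₂, add_zero]

theorem hat_of_bad_eq_zero {a : 𝔐.M.D one} {n : 𝔐.Num} (h : bad a n = 0) : hat a n = ap a n := by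
  rcases zero_or_succ n with rfl | ⟨k, rfl⟩
  · exact hat_zero a
  · rw [hat_succ, h, cond_zero]

/-- The rational approximations of a real number. -/
noncomputable def appr (f : 𝔐.Num →+* K) (a : 𝔐.M.D one) (n : 𝔐.Num) : K := val f (hat a n)

/-- The modulus holds for every object of type `1`: as long as no violation has occurred `hat`
follows the sequence, and from the first violation on it is constant. -/
theorem appr_step (hf : StrictMono f) (a : 𝔐.M.D one) (n : 𝔐.Num) :
    |appr f a n - appr f a (succ n)| < half f (succ n) := by
  by_cases h : bad a (succ n) = 0
  · have h' := (bad_succ_eq_zero hf a n).1 h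
    rw [appr, appr, hat_of_bad_eq_zero h, hat_of_bad_eq_zero h'.1]
    exact h'.2
  · obtain ⟨k, hk⟩ := (zero_or_succ _).resolve_left h
    rw [appr, appr, hat_succ, hk, cond_succ, sub_self, abs_zero]
    exact half_pos hf _

/-- The step bounds telescope as a geometric sum. As `d` may be nonstandard, the summation is an
induction inside the model. -/
theorem appr_dist (hf : StrictMono f) (a : 𝔐.M.D one) (n d : 𝔐.Num) :
    |appr f a n - appr f a (n + d)| ≤ half f n - half f (n + d) := by
  obtain ⟨x, rfl⟩ := exists_num n
  refine num_induct (x ▹ a ▹ 𝔐.base)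
    (qleF (qabs (qsub (hatT v2 v1) (hatT v2 (addT v1 v0)))) (qsub (qhalf v1) (qhalf (addT v1 v0))))
    (P := fun d => |appr f a (𝔐.num x) - appr f a (𝔐.num x + d)| ≤
      half f (𝔐.num x) - half f (𝔐.num x + d)) (fun y => ?_) ?_ (fun d ih => ?_) d
  · rw [sat_qleF _ hf, val_qabs _ hf, val_qsub _ hf, val_qsub _ hf, val_qhalf, val_qhalf, nev_hatT,
      nev_hatT, nev_addT]
    rfl
  · rw [add_zero, sub_self, sub_self, abs_zero]
  · rw [add_succ]
    have h₁ := appr_step hf a (𝔐.num x + d)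
    have h₂ := half_succ (f := f) (𝔐.num x + d)
    have h₃ := abs_sub_le (appr f a (𝔐.num x)) (appr f a (𝔐.num x + d))
      (appr f a (succ (𝔐.num x + d)))
    linarith

theorem appr_of_step (hf : StrictMono f) {a : 𝔐.M.D one}
    (h : ∀ n, |val f (ap a n) - val f (ap a (succ n))| < half f (succ n)) (n : 𝔐.Num) :
    appr f a n = val f (ap a n) := by
  have hb : bad a n = 0 := by
    refine num_induct (a ▹ 𝔐.base) (Fm.eq (badT v1 v0) zro) (P := fun n => bad a n = 0)
      (fun y => ?_) (bad_zero a) (fun n ih => (bad_succ_eq_zero hf a n).2 ⟨ih, h n⟩) n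
    rw [sat_eq, nev_badT, nev_zro]
    rfl
  rw [appr, hat_of_bad_eq_zero hb]

variable (ρ : Env 𝔐.M Δ) [Good 𝔐 ρ]

theorem appr_rrat (hf : StrictMono f) (q : Tm Δ Ty.nat) (n : 𝔐.Num) :
    appr f ((rrat q).eval ρ) n = val f (nev ρ q) := by
  have h : ∀ n, ap ((rrat q).eval ρ) n = nev ρ q := fun n => by
    obtain ⟨x, rfl⟩ := exists_num n
    rw [rrat, ap_lam, nev_wk]
  rw [appr_of_step hf fun n => ?_, h]
  rw [h, h, sub_self, abs_zero]
  exact half_pos hf _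

theorem appr_rone (hf : StrictMono f) (n : 𝔐.Num) : appr f (rone.eval ρ) n = 1 := by
  rw [rone, appr_rrat ρ hf, val_qone]

/-- Reading both summands one index later halves their step errors, so the sum keeps the required
modulus and `hat` leaves it unchanged. -/
theorem appr_radd (hf : StrictMono f) (s t : Tm Δ one) (n : 𝔐.Num) :
    appr f ((radd s t).eval ρ) n = appr f (s.eval ρ) (succ n) + appr f (t.eval ρ) (succ n) := by
  have h : ∀ n, val f (ap ((radd s t).eval ρ) n) =
      appr f (s.eval ρ) (succ n) + appr f (t.eval ρ) (succ n) := fun n => by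
    obtain ⟨x, rfl⟩ := exists_num n
    rw [radd, ap_lam, val_qadd _ hf, nev_hatT, nev_hatT, nev_suc, Tm.eval_wk, Tm.eval_wk]
    rfl
  rw [appr_of_step hf fun n => ?_, h]
  rw [h, h]
  have h₁ := abs_lt.1 (appr_step hf (s.eval ρ) (succ n))
  have h₂ := abs_lt.1 (appr_step hf (t.eval ρ) (succ n))
  rw [half_succ] at h₁ h₂
  rw [abs_lt]
  constructor <;> linarith

theorem appr_rsub (hf : StrictMono f) (s t : Tm Δ one) (n : 𝔐.Num) :
    appr f ((rsub s t).eval ρ) n = appr f (s.eval ρ) (succ n) - appr f (t.eval ρ) (succ n) := by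
  have h : ∀ n, val f (ap ((rsub s t).eval ρ) n) =
      appr f (s.eval ρ) (succ n) - appr f (t.eval ρ) (succ n) := fun n => by
    obtain ⟨x, rfl⟩ := exists_num n
    rw [rsub, ap_lam, val_qsub _ hf, nev_hatT, nev_hatT, nev_suc, Tm.eval_wk, Tm.eval_wk]
    rfl
  rw [appr_of_step hf fun n => ?_, h]
  rw [h, h]
  have h₁ := abs_lt.1 (appr_step hf (s.eval ρ) (succ n))
  have h₂ := abs_lt.1 (appr_step hf (t.eval ρ) (succ n))
  rw [half_succ] at h₁ h₂
  rw [abs_lt]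
  constructor <;> linarith

/-- The inequality `a ≤ b` between real numbers. -/
def RLe (f : 𝔐.Num →+* K) (a b : 𝔐.M.D one) : Prop :=
  ∀ n, appr f a (succ n) - appr f b (succ n) < half f n

/-- The strict inequality `a < b` between real numbers. -/
def RLt (f : 𝔐.Num →+* K) (a b : 𝔐.M.D one) : Prop :=
  ∃ n, half f n ≤ appr f b (succ n) - appr f a (succ n)

theorem forall_num {P : 𝔐.Num → Prop} : (∀ n, P n) ↔ ∀ x, P (𝔐.num x) :=
  ⟨fun h x => h _, fun h n => by
    obtain ⟨x, rfl⟩ := exists_num n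
    exact h x⟩

theorem sat_rleF (hf : StrictMono f) (s t : Tm Δ one) :
    Sat ρ (rleF s t) ↔ RLe f (s.eval ρ) (t.eval ρ) := by
  rw [RLe, forall_num]
  refine forall_congr' fun x => ?_
  rw [sat_qltF _ hf, val_qsub _ hf, val_qhalf, nev_hatT, nev_hatT, nev_suc, Tm.eval_wk, Tm.eval_wk]
  rfl

theorem sat_rltF (hf : StrictMono f) (s t : Tm Δ one) :
    Sat ρ (rltF s t) ↔ RLt f (s.eval ρ) (t.eval ρ) := by
  rw [RLt, ← not_iff_not, not_exists, forall_num, rltF, Sat, not_exists]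
  refine forall_congr' fun x => ?_
  rw [sat_qleF _ hf, val_qsub _ hf, val_qhalf, nev_hatT, nev_hatT, nev_suc, Tm.eval_wk, Tm.eval_wk]
  rfl

/-- A strict inequality leaves room for a positive rational number. -/
theorem exists_pos_of_RLt (hf : StrictMono f) {a b : 𝔐.M.D one} (h : RLt f a b) :
    ∃ m : 𝔐.M.D Ty.nat, 0 < val f (𝔐.num m) ∧ ∀ c : 𝔐.M.D one,
      (∀ n, appr f c n = appr f b (succ n) - val f (𝔐.num m)) → RLe f a c := by
  obtain ⟨k, hk⟩ := h
  obtain ⟨x, rfl⟩ := exists_num k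
  let E := x ▹ b ▹ a ▹ 𝔐.base
  -- With `k` the index witnessing `a < b`, the gap at index `k + 2` exceeds `2 ^ (-k - 1)`. Beyond
  -- that index `a` and `b` together move by at most this amount, so subtracting it leaves a
  -- positive rational that is still below the gap at all later indices.
  let q : Tm (Ty.nat :: one :: one :: Γ) Ty.nat :=
    qsub (qsub (hatT v1 (suc (suc v0))) (hatT v2 (suc (suc v0)))) (qhalf (suc v0))
  have hq : val f (𝔐.num (q.eval E)) = appr f b (succ (succ (𝔐.num x))) -
      appr f a (succ (succ (𝔐.num x))) - half f (succ (𝔐.num x)) := by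
    change val f (nev E q) = _
    rw [val_qsub _ hf, val_qsub _ hf, val_qhalf, nev_hatT, nev_hatT, nev_suc, nev_suc]
    rfl
  have ha := abs_lt.1 (appr_step hf a (succ (𝔐.num x)))
  have hb := abs_lt.1 (appr_step hf b (succ (𝔐.num x)))
  have h₁ := half_succ (f := f) (𝔐.num x)
  have h₂ := half_succ (f := f) (succ (𝔐.num x))
  have h₀ := half_pos hf (𝔐.num x)
  refine ⟨q.eval E, by rw [hq]; linarith, fun c hc n => ?_⟩
  rw [hc, hq]
  have h₃ := half_succ (f := f) n
  have h₄ := half_succ (f := f) (succ n)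
  have h₅ := half_pos hf n
  -- For small `n` the tolerance `half f n` covers the movement up to the index `k + 2`; for large
  -- `n` the amount subtracted in `q` does.
  rcases le_or_gt n (𝔐.num x) with hn | hn
  · obtain ⟨d, hd⟩ := num_le_iff.1 hn
    have ha' := abs_le.1 (appr_dist hf a (succ n) (succ d))
    have hb' := abs_le.1 (appr_dist hf b (succ (succ n)) d)
    rw [add_succ, succ_add, ← hd] at ha'
    rw [succ_add, succ_add, ← hd] at hb'
    linarith
  · obtain ⟨d, hd⟩ := num_le_iff.1 (succ_le_iff.2 hn)
    have ha' := abs_le.1 (appr_dist hf a (succ (succ (𝔐.num x))) d)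
    have hb' := abs_le.1 (appr_dist hf b (succ (succ (𝔐.num x))) (succ d))
    rw [succ_add, ← hd] at ha'
    rw [add_succ, succ_add, ← hd] at hb'
    linarith

theorem succ_le_pow2 (n : 𝔐.Num) : succ n ≤ pow2 n := by
  refine num_induct 𝔐.base (Fm.eq (subT (suc v0) (powT v0)) zro) (P := fun n => succ n ≤ pow2 n)
    (fun x => ?_) (by rw [pow2_zero]) (fun n h => ?_) n
  · rw [sat_eq, nev_subT, nev_suc, nev_powT, nev_zro, sub_eq_zero_iff]
    rfl
  · rw [pow2_succ, succ_eq_add_one]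
    exact add_le_add h (succ_zero (𝔐 := 𝔐) ▸ succ_le_iff.2 (pow2_pos n))

/-- A positive coded rational has numerator at least `1`, hence is at least the reciprocal of its
denominator `d + 1`, and `d + 1 ≤ 2 ^ d`. This replaces the Archimedean property, which `K` may
lack. -/
theorem half_le_of_pos (hf : StrictMono f) {q : 𝔐.Num} (hq : 0 < val f q) :
    half f (snd q) ≤ val f q := by
  have hd := den_pos hf (snd q)
  have h₁ : f (snd (fst q)) < f (fst (fst q)) := by
    rw [val, div_pos_iff_of_pos_right hd] at hq
    exact sub_pos.1 hq
  have h₂ := hf.monotone (succ_le_iff.2 (hf.lt_iff_lt.1 h₁))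
  have h₃ := hf.monotone (succ_le_pow2 (snd q))
  rw [map_succ] at h₂ h₃
  calc half f (snd q) ≤ (f (snd q) + 1)⁻¹ := inv_anti₀ hd h₃
    _ = 1 / (f (snd q) + 1) := (one_div _).symm
    _ ≤ val f q := div_le_div_of_nonneg_right (by linarith) hd.le

/-- Subtracting a positive rational number makes a weak inequality strict. -/
theorem RLt_of_RLe (hf : StrictMono f) {a b c : 𝔐.M.D one} {q : 𝔐.Num} (hq : 0 < val f q)
    (hc : ∀ n, appr f c n = appr f b (succ n) - val f q) (h : RLe f a c) : RLt f a b := by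
  -- At the index `N = snd q + 2` the value of `q` is at least `4 * 2 ^ (-N)`, which pays for the
  -- tolerance in `a ≤ c`, for the shift of index in `b`, and for the required gap.
  refine ⟨succ (succ (snd q)), ?_⟩
  have h₀ := half_le_of_pos hf hq
  have h₁ := half_succ (f := f) (snd q)
  have h₂ := half_succ (f := f) (succ (snd q))
  have h₃ := half_succ (f := f) (succ (succ (snd q)))
  have h₄ := half_succ (f := f) (succ (succ (succ (snd q))))
  have h₅ := half_pos hf (snd q)
  have h₆ := h (succ (succ (snd q)))
  rw [hc] at h₆
  have h₇ := abs_lt.1 (appr_step hf b (succ (succ (succ (snd q)))))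
  linarith

end Reals

end TModel
end FinType

namespace FinType

/-! ### Existential formulas -/

theorem Fm.QF.subst {Δ : List Ty} {φ : Fm Δ} (h : φ.QF) {Δ' : List Ty} (s : Sub Δ Δ') :
    (φ.subst s).QF := by
  induction φ generalizing Δ' with
  | eq t u => trivial
  | all σ φ ih => exact h
  | ex σ φ ih => exact h
  | _ φ ψ h₁ h₂ => exact ⟨h₁ h.1 s, h₂ h.2 s⟩

theorem Fm.QF.dual {Δ : List Ty} {φ : Fm Δ} (h : φ.QF) : φ.dual.QF := by
  induction φ with
  | eq t u => exact ⟨trivial, trivial⟩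
  | all σ φ ih => exact h
  | ex σ φ ih => exact h
  | imp φ ψ h₁ h₂ => exact ⟨h.1, h₂ h.2⟩
  | _ φ ψ h₁ h₂ => exact ⟨h₁ h.1, h₂ h.2⟩

theorem IsExists.subst {Δ : List Ty} {φ : Fm Δ} (h : IsExists φ) {Δ' : List Ty} (s : Sub Δ Δ') :
    IsExists (φ.subst s) := by
  induction h generalizing Δ' with
  | qf h => exact .qf (h.subst s)
  | ex hσ _ ih => exact .ex hσ (ih _)

theorem IsForall.dual {Δ : List Ty} {φ : Fm Δ} (h : IsForall φ) : IsExists φ.dual := by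
  induction h with
  | qf h => exact .qf h.dual
  | all hσ _ ih => exact .ex hσ ih

/-- Equivalence to an `∃`-formula in a model. -/
def IsE (M : Model) {Δ : List Ty} (φ : Fm Δ) : Prop :=
  ∃ ψ : Fm Δ, IsExists ψ ∧ ∀ ρ : Env M Δ, Sat ρ ψ ↔ Sat ρ φ

section Model

variable {M : Model} {Δ : List Ty} {φ ψ : Fm Δ}

theorem IsExists.isE (h : IsExists φ) : IsE M φ := ⟨φ, h, fun _ => Iff.rfl⟩

theorem IsE.congr (h : IsE M φ) (h' : ∀ ρ : Env M Δ, Sat ρ φ ↔ Sat ρ ψ) : IsE M ψ :=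
  let ⟨χ, h₁, h₂⟩ := h
  ⟨χ, h₁, fun ρ => (h₂ ρ).trans (h' ρ)⟩

theorem IsE.ex {σ : Ty} {φ : Fm (σ :: Δ)} (hσ : IsAdmissible σ) (h : IsE M φ) :
    IsE M (Fm.ex σ φ) :=
  let ⟨χ, h₁, h₂⟩ := h
  ⟨Fm.ex σ χ, .ex hσ h₁, fun _ => exists_congr fun _ => h₂ _⟩

theorem sat_ex_or (ρ : Env M Δ) {σ : Ty} (φ : Fm (σ :: Δ)) (ψ : Fm Δ) :
    Sat ρ (Fm.ex σ (Fm.or φ ψ.wk)) ↔ Sat ρ (Fm.or (Fm.ex σ φ) ψ) := by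
  -- Pulling the quantifier over a disjunct that does not depend on it requires a nonempty domain.
  have : Nonempty (M.D σ) := ⟨(Tm.inhabitant σ).eval ρ⟩
  simp only [Sat, Sat_wk, exists_or, exists_const]

theorem isE_qf_or (hφ : φ.QF) (hψ : IsExists ψ) : IsE M (Fm.or φ ψ) := by
  induction hψ with
  | qf h => exact IsExists.isE (.qf ⟨hφ, h⟩)
  | ex hσ _ ih =>
      refine (IsE.ex hσ (ih (hφ.subst fun _ v => Tm.var (Var.s v)))).congr fun ρ => ?_
      rw [Sat, or_comm, ← Sat, ← sat_ex_or]
      exact exists_congr fun _ => or_comm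

/-- The quantifiers of the first disjunct are moved out one by one, the second being weakened along,
until `isE_qf_or` applies. -/
theorem isE_or (hφ : IsExists φ) (hψ : IsExists ψ) : IsE M (Fm.or φ ψ) := by
  induction hφ with
  | qf h => exact isE_qf_or h hψ
  | ex hσ _ ih => exact (IsE.ex hσ (ih (hψ.subst _))).congr fun ρ => sat_ex_or ρ _ _

theorem IsE.or (hφ : IsE M φ) (hψ : IsE M ψ) : IsE M (Fm.or φ ψ) :=
  let ⟨_, h₁, h₂⟩ := hφ
  let ⟨_, h₁', h₂'⟩ := hψ
  (isE_or h₁ h₁').congr fun ρ => or_congr (h₂ ρ) (h₂' ρ)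

theorem isE_qf_and (hφ : φ.QF) (hψ : IsExists ψ) : IsE M (Fm.and φ ψ) := by
  induction hψ with
  | qf h => exact IsExists.isE (.qf ⟨hφ, h⟩)
  | ex hσ _ ih =>
      refine (IsE.ex hσ (ih (hφ.subst fun _ v => Tm.var (Var.s v)))).congr fun ρ => ?_
      simp only [Sat, ← exists_and_left]
      exact exists_congr fun _ => and_congr_left' (Sat_wk _ _ _)

end Model

/-- De Morgan's laws hold classically; the hypothesis matters only at equations, whose negation is
an implication into `0 = 1`. -/
theorem Sat_dual {M : Model} (hM : ¬ M.eq (M.con Con.zero) (M.app (M.con Con.succ) (M.con Con.zero)))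
    {Δ : List Ty} (ρ : Env M Δ) (φ : Fm Δ) : Sat ρ φ.dual ↔ ¬ Sat ρ φ := by
  induction φ with
  | eq t u => exact ⟨fun h h' => hM (h h'), fun h h' => (h h').elim⟩
  | and φ ψ h₁ h₂ => rw [Fm.dual, Sat, Sat, h₁, h₂, not_and_or]
  | or φ ψ h₁ h₂ => rw [Fm.dual, Sat, Sat, h₁, h₂, not_or]
  | imp φ ψ h₁ h₂ => rw [Fm.dual, Sat, Sat, h₂, Classical.not_imp]
  | all σ φ ih => simp only [Fm.dual, Sat, ih, not_forall]
  | ex σ φ ih => simp only [Fm.dual, Sat, ih, not_exists]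

namespace TModel

variable {Γ Δ : List Ty} {𝔐 : TModel Γ}

theorem sat_dual (ρ : Env 𝔐.M Δ) (φ : Fm Δ) : Sat ρ φ.dual ↔ ¬ Sat ρ φ :=
  Sat_dual 𝔐.zero_ne_one ρ φ

theorem isE_imp {φ ψ : Fm Δ} (hφ : IsForall φ) (hψ : IsE 𝔐.M ψ) : IsE 𝔐.M (Fm.imp φ ψ) :=
  (hφ.dual.isE.or hψ).congr fun ρ => by rw [Sat, Sat, sat_dual, imp_iff_not_or]

/-! ### Uniform boundedness in a model -/

/-- The inequality in a type. -/
def LeM {σ : Ty} (a b : 𝔐.M.D σ) : Prop := Sat (b ▹ a ▹ 𝔐.base) (leF σ v1 v0)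

/-- In a pure type the inequality reduces, after at most one application, to cut-off subtraction in
type `0`, so it depends only on the values of the two terms. -/
theorem sat_leF {τ : Ty} (hτ : IsPure τ) (ρ : Env 𝔐.M Δ) [Good 𝔐 ρ] (s t : Tm Δ τ) :
    Sat ρ (leF τ s t) ↔ LeM (s.eval ρ) (t.eval ρ) := by
  have h : ∀ {Ξ Ξ' : List Ty} (η : Env 𝔐.M Ξ) [Good 𝔐 η] (η' : Env 𝔐.M Ξ') [Good 𝔐 η']
      (s t : Tm Ξ Ty.nat) (s' t' : Tm Ξ' Ty.nat), s.eval η = s'.eval η' → t.eval η = t'.eval η' →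
      (Sat η (leF Ty.nat s t) ↔ Sat η' (leF Ty.nat s' t')) := by
    intro Ξ Ξ' η _ η' _ s t s' t' hs ht
    rw [leF, leF, sat_eq, sat_eq, nev_subT, nev_subT, nev, nev, hs, ht]
    rfl
  cases hτ with
  | nat => exact h _ _ _ _ _ _ rfl rfl
  | succ hτ =>
      refine forall_congr' fun d => h _ _ _ _ _ _ ?_ ?_
      · simp only [Tm.eval, Tm.eval_wk]
        rfl
      · simp only [Tm.eval, Tm.eval_wk]
        rfl

/-- The simplest case of uniform boundedness: `α` is type `0`, the tuple `z` is one variable of the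
ground type `B`, and `y`, `k`, `x` are dummies. The schema is applied to the genuine `∃`-formula
behind `θ`, and the bound is the value of `χ` at `0`. -/
theorem exists_bound {B τ : Ty} (hτ : IsPure τ) (hUB : ∀ Ξ φ, UB B τ Ξ φ → 𝔐.T Ξ φ)
    (ρ : Env 𝔐.M Δ) [Good 𝔐 ρ] {θ : Fm (τ :: B :: Δ)} (hθ : IsE 𝔐.M θ)
    (h : ∀ b, ∃ x, Sat (x ▹ b ▹ ρ) θ) : ∃ X, ∀ b, ∃ x, LeM x X ∧ Sat (x ▹ b ▹ ρ) θ := by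
  obtain ⟨ψ, hψ, hψθ⟩ := hθ
  let s : Sub (τ :: B :: Δ) (τ :: B :: Ty.nat :: Ty.nat :: one :: Δ) :=
    Sub.lift (Sub.lift (fun _ v => Tm.var (Var.s (Var.s (Var.s v)))) B) τ
  have hU : Sat ρ (unifBound τ [] [B] (ψ.subst s)) :=
    𝔐.sat_of_proves ρ (.ax (hUB _ _ (.inst [] [[]] _ (hψ.subst s))))
  obtain ⟨χ, hχ⟩ := hU ((Tm.inhabitant one).eval ρ) fun k x b => by
    obtain ⟨w, hw⟩ := h b
    refine ⟨w, ?_⟩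
    rw [Sat_subst, Sat_subst]
    convert (hψθ _).2 hw using 1
    funext σ v
    cases v with
    | z => rfl
    | s v =>
        cases v with
        | z => rfl
        | s v => rfl
  refine ⟨𝔐.M.app χ (𝔐.M.con Con.zero), fun b => ?_⟩
  obtain ⟨w, hw, hw'⟩ := hχ (𝔐.M.con Con.zero) (𝔐.M.con Con.zero) b
  refine ⟨w, ?_, ?_⟩
  · rw [sat_leF hτ] at hw
    exact hw
  · rw [Sat_subst, Sat_subst] at hw'
    refine (hψθ _).1 ?_
    convert hw' using 1
    funext σ v
    cases v with
    | z => rfl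
    | s v =>
        cases v with
        | z => rfl
        | s v => rfl

end TModel
end FinType

namespace FinType
namespace TModel

/-! ### Probabilistic statements in a model -/

variable {Γ Δ : List Ty} {𝔐 : TModel Γ} {τ : Ty}

/-- The probability of an event. -/
def pr (A : 𝔐.M.D Ty.Ev) : 𝔐.M.D one := 𝔐.M.app (𝔐.M.con Con.prob) A

/-- `ϖ` is in the complement of `A`. -/
def InCompl (ϖ : 𝔐.M.D Ty.Om) (A : 𝔐.M.D Ty.Ev) : Prop :=
  Sat (ϖ ▹ A ▹ 𝔐.base) (memF v0 (compT v1))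

/-- A formula `φ(x, ϖ)` is monotone in `x`. -/
def Mono (φ : Fm (Ty.Om :: τ :: Γ)) : Prop :=
  ∀ (ϖ : 𝔐.M.D Ty.Om) (x y : 𝔐.M.D τ), LeM x y → Sat (ϖ ▹ x ▹ 𝔐.base) φ →
    Sat (ϖ ▹ y ▹ 𝔐.base) φ

theorem sat_at (ρ : Env 𝔐.M Δ) (φ : Fm (Ty.Om :: τ :: Γ)) (ϖ : Tm Δ Ty.Om) (x : Tm Δ τ)
    (s : Sub Γ Δ) : Sat ρ (φ.at ϖ x s) ↔ Sat (ϖ.eval ρ ▹ x.eval ρ ▹ s.eval ρ) φ := by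
  rw [Fm.at, Sat_subst, Sub.eval_cons, Sub.eval_cons]

/-- Argue by contradiction: uniform boundedness collects the `x` that satisfy `θ` at points outside
`A` below one `X`, and monotonicity then contradicts the hypothesis at `X`. Points of `A` make the
implication `Θ` vacuous. -/
theorem exists_forall_of_forall_exists (hτ : IsPure τ) (hUB : ∀ Ξ φ, UB Ty.Om τ Ξ φ → 𝔐.T Ξ φ)
    {θ : Fm (Ty.Om :: τ :: Γ)} (hθ : IsExists θ) (hm : Mono (𝔐 := 𝔐) θ) (A : 𝔐.M.D Ty.Ev)
    (h : ∀ x, ∃ ϖ, InCompl ϖ A ∧ ¬ Sat (ϖ ▹ x ▹ 𝔐.base) θ) :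
    ∃ ϖ, InCompl ϖ A ∧ ∀ x, ¬ Sat (ϖ ▹ x ▹ 𝔐.base) θ := by
  let Θ : Fm (τ :: Ty.Om :: Ty.Ev :: Γ) := Fm.imp (memF v1 (compT v2))
    (θ.at v1 v0 fun _ v => Tm.var (Var.s (Var.s (Var.s v))))
  have hΘ : ∀ x ϖ, Sat (x ▹ ϖ ▹ A ▹ 𝔐.base) Θ ↔
      (InCompl ϖ A → Sat (ϖ ▹ x ▹ 𝔐.base) θ) := fun x ϖ => imp_congr Iff.rfl (sat_at _ _ _ _ _)
  by_contra! hn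
  obtain ⟨X, hX⟩ := exists_bound hτ hUB (A ▹ 𝔐.base) (θ := Θ)
    (isE_imp (.qf trivial) (hθ.subst _).isE) fun ϖ => by
      by_cases hϖ : InCompl ϖ A
      · obtain ⟨x, hx⟩ := hn ϖ hϖ
        exact ⟨x, (hΘ _ _).2 fun _ => hx⟩
      · exact ⟨(Tm.inhabitant τ).eval 𝔐.base, (hΘ _ _).2 fun h => (hϖ h).elim⟩
  obtain ⟨ϖ, hϖ, hX'⟩ := h X
  obtain ⟨x, hx, hx'⟩ := hX ϖ
  exact hX' (hm ϖ x X hx ((hΘ _ _).1 hx' hϖ))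

section Reals

set_option linter.unusedSectionVars false

variable {K : Type} [Field K] [LinearOrder K] [IsStrictOrderedRing K] {f : 𝔐.Num →+* K}

theorem RLe_congr {a c c' : 𝔐.M.D one} (h : ∀ n, appr f c n = appr f c' n) :
    RLe f a c ↔ RLe f a c' := by
  simp only [RLe, h]

/-- From left to right, a strict inequality leaves room for some `m`. From right to left, `P(A) ≤ r
- m` gives `P(A) < r`, hence a point and an `x` depending on `A`; uniform boundedness over events
and monotonicity remove this dependence. -/
theorem forall_pos_exists_iff (hf : StrictMono f) (hτ : IsPure τ)
    (hUB : ∀ Ξ φ, UB Ty.Ev τ Ξ φ → 𝔐.T Ξ φ) {ψ : Fm (Ty.Om :: τ :: Γ)} (hψ : IsExists ψ)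
    (hm : Mono (𝔐 := 𝔐) ψ) (r : 𝔐.M.D one) (t : Tm (Ty.nat :: Γ) one)
    (ht : ∀ m n, appr f (t.eval (m ▹ 𝔐.base)) n = appr f r (succ n) - val f (𝔐.num m)) :
    (∀ m, 0 < val f (𝔐.num m) → ∃ x, ∀ A, RLe f (pr A) (t.eval (m ▹ 𝔐.base)) →
      ∃ ϖ, InCompl ϖ A ∧ Sat (ϖ ▹ x ▹ 𝔐.base) ψ) ↔
    ∀ A, RLt f (pr A) r → ∃ ϖ, InCompl ϖ A ∧ ∃ x, Sat (ϖ ▹ x ▹ 𝔐.base) ψ := by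
  constructor
  · intro h A hA
    obtain ⟨m, hm, hc⟩ := exists_pos_of_RLt hf hA
    obtain ⟨x, hx⟩ := h m hm
    obtain ⟨ϖ, hϖ, h'⟩ := hx A (hc _ (ht m))
    exact ⟨ϖ, hϖ, x, h'⟩
  · intro h m hm₀
    let Θ : Fm (τ :: Ty.Ev :: Ty.nat :: Γ) := Fm.imp (rleF (probT v1) t.wk.wk)
      (Fm.ex Ty.Om (Fm.and (memF v0 (compT v2))
        (ψ.at v0 v1 fun _ v => Tm.var (Var.s (Var.s (Var.s (Var.s v)))))))
    have hΘ : ∀ x A, Sat (x ▹ A ▹ m ▹ 𝔐.base) Θ ↔ (RLe f (pr A) (t.eval (m ▹ 𝔐.base)) →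
        ∃ ϖ, InCompl ϖ A ∧ Sat (ϖ ▹ x ▹ 𝔐.base) ψ) := fun x A => by
      refine imp_congr ?_ (exists_congr fun ϖ => and_congr Iff.rfl (sat_at _ _ _ _ _))
      rw [sat_rleF _ hf, Tm.eval_wk, Tm.eval_wk]
      rfl
    obtain ⟨X, hX⟩ := exists_bound hτ hUB (m ▹ 𝔐.base) (θ := Θ)
      -- The weak inequality between reals is one number quantifier in front of a decidable
      -- comparison. As an antecedent it contributes an existential quantifier, so `Θ` is equivalent
      -- to an `∃`-formula.
      (isE_imp (.all (.ground .nat) (.qf trivial))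
        (.ex (.ground .om) (isE_qf_and trivial (hψ.subst _)))) fun A => by
        by_cases hA : RLe f (pr A) (t.eval (m ▹ 𝔐.base))
        · obtain ⟨ϖ, hϖ, x, hx⟩ := h A (RLt_of_RLe hf hm₀ (ht m) hA)
          exact ⟨x, (hΘ _ _).2 fun _ => ⟨ϖ, hϖ, hx⟩⟩
        · exact ⟨(Tm.inhabitant τ).eval 𝔐.base, (hΘ _ _).2 fun h => (hA h).elim⟩
    refine ⟨X, fun A hA => ?_⟩
    obtain ⟨x, hx, hx'⟩ := hX A
    obtain ⟨ϖ, hϖ, hϖ'⟩ := (hΘ _ _).1 hx' hA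
    exact ⟨ϖ, hϖ, hm ϖ x X hx hϖ'⟩

theorem sat_probGe (hf : StrictMono f) (ρ : Env 𝔐.M Δ) [Good 𝔐 ρ] (φ : Fm (Ty.Om :: Δ))
    (l : Tm Δ one) : Sat ρ (probGe φ l) ↔
      ∀ A, RLt f (pr A) (l.eval ρ) → ∃ ϖ, InCompl ϖ A ∧ Sat (ϖ ▹ ρ) φ := by
  refine forall_congr' fun A => imp_congr ?_ (exists_congr fun ϖ => and_congr Iff.rfl ?_)
  · rw [sat_rltF _ hf, Tm.eval_wk]
    rfl
  · rw [Fm.wkBelow, Sat_subst, Sub.eval_lift]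
    rfl

theorem sat_probGt (hf : StrictMono f) (ρ : Env 𝔐.M Δ) [Good 𝔐 ρ] (φ : Fm (Ty.Om :: Δ))
    (l : Tm Δ one) : Sat ρ (probGt φ l) ↔
      ∀ A, RLe f (pr A) (l.eval ρ) → ∃ ϖ, InCompl ϖ A ∧ Sat (ϖ ▹ ρ) φ := by
  refine forall_congr' fun A => imp_congr ?_ (exists_congr fun ϖ => and_congr Iff.rfl ?_)
  · rw [sat_rleF _ hf, Tm.eval_wk]
    rfl
  · rw [Fm.wkBelow, Sat_subst, Sub.eval_lift]
    rfl

theorem sat_allRatPos (hf : StrictMono f) (ρ : Env 𝔐.M Δ) [Good 𝔐 ρ] (φ : Fm (Ty.nat :: Δ)) :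
    Sat ρ (allRatPos φ) ↔ ∀ m, 0 < val f (𝔐.num m) → Sat (m ▹ ρ) φ := by
  refine forall_congr' fun m => imp_congr ?_ Iff.rfl
  rw [sat_qltF _ hf, val_qzero]
  rfl

end Reals

theorem sat_swap (ρ : Env 𝔐.M Δ) {σ : Ty} (φ : Fm (σ :: τ :: Δ)) (x : 𝔐.M.D τ) (y : 𝔐.M.D σ) :
    Sat (x ▹ y ▹ ρ) φ.swap ↔ Sat (y ▹ x ▹ ρ) φ := by
  rw [Fm.swap, Sat_subst, Sub.eval_cons, Sub.eval_cons]
  rfl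

theorem sat_wkBelow2 (ρ : Env 𝔐.M Δ) {σ υ : Ty} (φ : Fm (σ :: τ :: Δ)) (x : 𝔐.M.D τ)
    (y : 𝔐.M.D σ) (z : 𝔐.M.D υ) : Sat (y ▹ x ▹ z ▹ ρ) φ.wkBelow2 ↔ Sat (y ▹ x ▹ ρ) φ := by
  rw [Fm.wkBelow2, Sat_subst, Sub.eval_lift, Sub.eval_lift]
  rfl

theorem sat_iff (ρ : Env 𝔐.M Δ) (φ ψ : Fm Δ) : Sat ρ (Fm.iff φ ψ) ↔ (Sat ρ φ ↔ Sat ρ ψ) :=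
  iff_iff_implies_and_implies.symm

theorem mono_of_sat_mono (hτ : IsPure τ) {φ : Fm (Ty.Om :: τ :: Γ)} (h : Sat 𝔐.base (mono φ)) :
    Mono (𝔐 := 𝔐) φ := by
  intro ϖ x y hxy hx
  refine (sat_at _ _ _ _ _).1 (h ϖ x y ⟨?_, (sat_at _ _ _ _ _).2 hx⟩)
  rw [sat_leF hτ]
  exact hxy

theorem mono_dual_of_sat_antiMono (hτ : IsPure τ) {φ : Fm (Ty.Om :: τ :: Γ)}
    (h : Sat 𝔐.base (antiMono φ)) : Mono (𝔐 := 𝔐) φ.dual := by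
  intro ϖ x y hxy hx
  rw [sat_dual] at hx ⊢
  refine fun hy => hx ((sat_at _ _ _ _ _).1 (h ϖ x y ⟨?_, (sat_at _ _ _ _ _).2 hy⟩))
  rw [sat_leF hτ]
  exact hxy

end TModel
end FinType

namespace FinType
namespace TModel

/-! ### Interchanging probability and quantifiers -/

variable {Γ : List Ty} {𝔐 : TModel Γ} {τ : Ty}

section Interchange

variable {K : Type} [Field K] [LinearOrder K] [IsStrictOrderedRing K] {f : 𝔐.Num →+* K}
  {φ : Fm (Ty.Om :: τ :: Γ)} (l : Tm Γ one)

/-- The exchange is applied to the dual of `φ`, an `∃`-formula that is monotone because `φ` is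
anti-monotone; the double negations cancel. -/
theorem sat_probGe_all (hf : StrictMono f) (hτ : IsPure τ)
    (hUB : ∀ Ξ χ, UB Ty.Om τ Ξ χ → 𝔐.T Ξ χ) (hφ : IsForall φ) (hm : Sat 𝔐.base (antiMono φ)) :
    Sat 𝔐.base (probGe (Fm.all τ φ.swap) l) ↔ Sat 𝔐.base (Fm.all τ (probGe φ l.wk)) := by
  have h := exists_forall_of_forall_exists hτ hUB hφ.dual (mono_dual_of_sat_antiMono hτ hm)
  simp only [sat_dual, not_not] at h
  simp only [sat_probGe hf, Sat, sat_swap, Tm.eval_wk]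
  constructor
  · intro h' x A hA
    obtain ⟨ϖ, hϖ, hx⟩ := h' A hA
    exact ⟨ϖ, hϖ, hx x⟩
  · exact fun h' A hA => h A fun x => h' x A hA

/-- By definition this concerns the dual of `φ`, that is, points where `φ` fails, so the exchange
applies to `φ` itself. -/
theorem sat_probLe_ex (hf : StrictMono f) (hτ : IsPure τ)
    (hUB : ∀ Ξ χ, UB Ty.Om τ Ξ χ → 𝔐.T Ξ χ) (hφ : IsExists φ) (hm : Sat 𝔐.base (mono φ)) :
    Sat 𝔐.base (probLe (Fm.ex τ φ.swap) l) ↔ Sat 𝔐.base (Fm.all τ (probLe φ l.wk)) := by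
  have h := exists_forall_of_forall_exists hτ hUB hφ (mono_of_sat_mono hτ hm)
  have hr : ∀ (x : 𝔐.M.D τ) a, RLt f a ((rsub rone l.wk).eval (x ▹ 𝔐.base)) ↔
      RLt f a ((rsub rone l).eval 𝔐.base) := fun x a => by
    simp only [RLt, appr_rsub _ hf, appr_rone _ hf, Tm.eval_wk]
  simp only [probLe, Sat, sat_probGe hf, sat_dual, sat_swap, hr, not_exists]
  constructor
  · intro h' x A hA
    obtain ⟨ϖ, hϖ, hx⟩ := h' A hA
    exact ⟨ϖ, hϖ, hx x⟩
  · exact fun h' A hA => h A fun x => h' x A hA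

theorem sat_probLe_all (hf : StrictMono f) (hτ : IsPure τ)
    (hUB : ∀ Ξ χ, UB Ty.Ev τ Ξ χ → 𝔐.T Ξ χ) (hφ : IsForall φ) (hm : Sat 𝔐.base (antiMono φ)) :
    Sat 𝔐.base (allRatPos (Fm.ex τ (probLt φ.wkBelow2 (radd l.wk.wk (rrat v1))))) ↔
      Sat 𝔐.base (probLe (Fm.all τ φ.swap) l) := by
  -- Here `r` is `1 - l`. The index shifts of `radd` and `rsub` fit exactly: both approximations are
  -- `1 - l(n + 2) - m`, so `1 - (l + m)` can serve as `r - m`.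
  have h := forall_pos_exists_iff hf hτ hUB hφ.dual (mono_dual_of_sat_antiMono hτ hm)
    ((rsub rone l).eval 𝔐.base) (rsub rone (radd l.wk (rrat v0))) fun m n => by
      simp only [appr_rsub _ hf, appr_radd _ hf, appr_rone _ hf, appr_rrat _ hf, Tm.eval_wk, nev_v0,
        sub_add_eq_sub_sub]
  have hr : ∀ (x : 𝔐.M.D τ) m a,
      RLe f a ((rsub rone (radd l.wk.wk (rrat v1))).eval (x ▹ m ▹ 𝔐.base)) ↔
        RLe f a ((rsub rone (radd l.wk (rrat v0))).eval (m ▹ 𝔐.base)) := fun x m a =>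
    RLe_congr fun n => by
      simp only [appr_rsub _ hf, appr_radd _ hf, appr_rone _ hf, appr_rrat _ hf, Tm.eval_wk, nev_v0,
        nev_v1]
  simp only [sat_dual] at h
  simp only [sat_allRatPos hf, probLe, probLt, Sat, sat_probGe hf, sat_probGt hf, sat_dual, sat_swap,
    sat_wkBelow2, hr, not_forall]
  exact h

theorem sat_probGe_ex (hf : StrictMono f) (hτ : IsPure τ)
    (hUB : ∀ Ξ χ, UB Ty.Ev τ Ξ χ → 𝔐.T Ξ χ) (hφ : IsExists φ) (hm : Sat 𝔐.base (mono φ)) :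
    Sat 𝔐.base (allRatPos (Fm.ex τ (probGt φ.wkBelow2 (rsub l.wk.wk (rrat v1))))) ↔
      Sat 𝔐.base (probGe (Fm.ex τ φ.swap) l) := by
  have h := forall_pos_exists_iff hf hτ hUB hφ (mono_of_sat_mono hτ hm)
    (l.eval 𝔐.base) (rsub l.wk (rrat v0)) fun m n => by
      simp only [appr_rsub _ hf, appr_rrat _ hf, Tm.eval_wk, nev_v0]
  have hr : ∀ (x : 𝔐.M.D τ) m a,
      RLe f a ((rsub l.wk.wk (rrat v1)).eval (x ▹ m ▹ 𝔐.base)) ↔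
        RLe f a ((rsub l.wk (rrat v0)).eval (m ▹ 𝔐.base)) := fun x m a =>
    RLe_congr fun n => by
      simp only [appr_rsub _ hf, appr_rrat _ hf, Tm.eval_wk, nev_v0, nev_v1]
  simp only [sat_allRatPos hf, Sat, sat_probGe hf, sat_probGt hf, sat_swap, sat_wkBelow2, hr]
  exact h

end Interchange

end TModel

theorem proves_imp_iff {T : Theory} (hT : ExtendsFP T) {Γ : List Ty} {φ ψ χ : Fm Γ}
    (h : ∀ 𝔐 : TModel Γ, 𝔐.T = T → ∀ (K : Type) [Field K] [LinearOrder K] [IsStrictOrderedRing K]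
      (f : 𝔐.Num →+* K), StrictMono f → Sat 𝔐.base φ → (Sat 𝔐.base ψ ↔ Sat 𝔐.base χ)) :
    Proves T (Fm.imp φ (Fm.iff ψ χ)) :=
  proves_of_forall_tmodel hT fun 𝔐 h𝔐 hφ => by
    obtain ⟨K, _, _, _, f, hf⟩ := exists_ordered_field 𝔐.Num
    exact (TModel.sat_iff _ _ _).2 (h 𝔐 h𝔐 K f hf hφ)

end FinType
-- The four equivalences
open FinType in
theorem mainTheorem11 (Γ : List Ty) (τ : Ty) (hτ : IsPure τ)
    (φ : Fm (Ty.Om :: τ :: Γ)) (l : Tm Γ one) :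
    (IsForall φ →
      Proves (FPUBOm τ) (Fm.imp (antiMono φ)
        (Fm.iff (probGe (Fm.all τ φ.swap) l) (Fm.all τ (probGe φ l.wk)))) ∧
      Proves (FPUBEv τ) (Fm.imp (antiMono φ)
        (Fm.iff (allRatPos (Fm.ex τ (probLt φ.wkBelow2 (radd l.wk.wk (rrat v1)))))
          (probLe (Fm.all τ φ.swap) l)))) ∧
    (IsExists φ →
      Proves (FPUBOm τ) (Fm.imp (mono φ)
        (Fm.iff (probLe (Fm.ex τ φ.swap) l) (Fm.all τ (probLe φ l.wk)))) ∧
      Proves (FPUBEv τ) (Fm.imp (mono φ)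
        (Fm.iff (allRatPos (Fm.ex τ (probGt φ.wkBelow2 (rsub l.wk.wk (rrat v1)))))
          (probGe (Fm.ex τ φ.swap) l)))) := by
  have hOm : ExtendsFP (FPUBOm τ) := fun _ _ => Or.inl
  have hEv : ExtendsFP (FPUBEv τ) := fun _ _ => Or.inl
  have uOm : ∀ 𝔐 : TModel Γ, 𝔐.T = FPUBOm τ → ∀ Ξ χ, UB Ty.Om τ Ξ χ → 𝔐.T Ξ χ :=
    fun 𝔐 h Ξ χ hχ => h ▸ Or.inr hχ
  have uEv : ∀ 𝔐 : TModel Γ, 𝔐.T = FPUBEv τ → ∀ Ξ χ, UB Ty.Ev τ Ξ χ → 𝔐.T Ξ χ :=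
    fun 𝔐 h Ξ χ hχ => h ▸ Or.inr hχ
  exact ⟨fun hφ =>
    ⟨proves_imp_iff hOm fun 𝔐 h _ _ _ _ _ hf => TModel.sat_probGe_all l hf hτ (uOm 𝔐 h) hφ,
      proves_imp_iff hEv fun 𝔐 h _ _ _ _ _ hf => TModel.sat_probLe_all l hf hτ (uEv 𝔐 h) hφ⟩,
    fun hφ =>
    ⟨proves_imp_iff hOm fun 𝔐 h _ _ _ _ _ hf => TModel.sat_probLe_ex l hf hτ (uOm 𝔐 h) hφ,
      proves_imp_iff hEv fun 𝔐 h _ _ _ _ _ hf => TModel.sat_probGe_ex l hf hτ (uEv 𝔐 h) hφ⟩⟩
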